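/- **Conventions.** Let $p$ be a prime, $k\in\{1,2,\dots\}\cup\{\infty\}$, and let $E$ be an ultrametric Banach space over $\mathbb Q_p$. Put $k_+:=k$ if $\dim E<\infty$ and $k_+:=k+1$ otherwise. Maps of class $C^n$ are understood in the sense of Bertram–Glöckner–Neeb: $f:O\to F$ ($O\subseteq E$ open) is $C^0$ if it is continuous, and $C^{n+1}$ if it is continuous and the map $(x,y,t)\mapsto t^{-1}(f(x+ty)-f(x))$ ($t\neq 0$) extends to a $C^n$-map on $\{(x,y,t)\in O\times E\times\mathbb Q_p: x+ty\in O\}$; $C^\infty$ means $C^n$ for all $n$. A map is $SC^1$ if it is strictly differentiable at each point. Let $G$ be a Lie group of class $C^{k_+}$ over $\mathbb Q_p$ modelled on $E$, and let $L(G)=T_1G\cong E$, with the norm of $E$. For $0<s$ write $V_s:=\{v\in L(G):\|v\|<s\}$. An *exponential map* of $G$ is a map $\psi:\Omega\to G$ on a balanced $0$-neighbourhood $\Omega\subseteq L(G)$, continuous at $0$, such that $\psi(\Omega)$ is an identity neighbourhood and, for each $x\in\Omega$, $\mathbb Z_p\to G$, $z\mapsto\psi(zx)$ is a $C^1$-homomorphism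 with derivative $x$ at $0$. Let $\Gamma(G)$ be the set of germs $[\xi]$ at $0$ of continuous homomorphisms $\xi:W\to G$ on open subgroups $W\subseteq\mathbb Q_p$. If $\psi$ is an exponential map, then $\theta:L(G)\to\Gamma(G)$, $\theta(x):=[t\mapsto\psi(tx)]$ is a bijection, and $\Gamma(G)$ is given the topological $\mathbb Q_p$-vector space structure that makes $\theta$ an isomorphism. An *adapted chart* is a $C^{k_+}$-diffeomorphism $\phi:U\to V_r$ with $0<r<1$ and $U\subseteq G$ an open subgroup, such that $\phi(1)=0$, $T_1\phi=\mathrm{id}$ and, writing $x*y:=\phi(\phi^{-1}(x)\phi^{-1}(y))$ and $\tau_p$ for the $p$-th power map of $(V_r,*)$: $x*V_s=V_s*x=x+V_s$ for all $x\in V_r$, $0<s\le r$; and $p^{-1}\tau_p$ is a surjective isometry $V_r\to V_r$. Given an adapted chart, for $x\in U$ put $\log_G(x):=(\phi\circ\eta_x)'(0)$, where $\eta_x:\mathbb Z_p\to U$ is the continuous homomorphism with $\eta_x(1)=x$; let $\exp_G:=\log_G^{-1}$; and let $x^{p^{-n}}$ be the unique element of $U$ with $p^n$-th power $x$, if it exists.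 **Lemma.** Adapted charts exist. For each adapted chart $\phi: U\to V_r$, $\log_G:U\to V_r$ is well defined and bijective, $\exp_G:V_r\to U$ is an exponential map, and the following holds. (a) For all $x,y\in V_r$, the roots below exist for all $n\in\mathbb N_0$, and $$x+y=\lim_{n\to\infty}\log_G\big((\exp_G(p^nx)\exp_G(p^ny))^{p^{-n}}\big).$$ (b) If $[\xi_1],[\xi_2],[\xi_3]\in\Gamma(G)$ and $[\xi_1]+[\xi_2]=[\xi_3]$ (with respect to any exponential map of $G$), then there is $\delta>0$ such that, for all $t\in\mathbb Z_p$ with $|t|_p\le\delta$, the elements $\xi_1(t),\xi_2(t),\xi_3(t)$ are defined and lie in $U$, the roots below exist for all $n\in\mathbb N_0$, and $$\xi_3(t)=\lim_{n\to\infty}(\xi_1(p^nt)\,\xi_2(p^nt))^{p^{-n}}.$$ (c) Let $\widetilde E$ be an ultrametric Banach space over $\mathbb Q_p$ and let $\widetilde G$ be a Lie group of class $C^{k_+}$ modelled on $\widetilde E$ ($k_+$ being formed with $\widetilde E$) that has the same underlying topological group as $G$. Then $\Gamma(G)=\Gamma(\widetilde G)$ as a set and as a topological $\mathbb Q_p$-vector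 space (for any choice of exponential maps of $G$ and $\widetilde G$). Furthermore $G$ and $\widetilde G$ are $SC^1$-Lie groups, and the identity map $G\to\widetilde G$, $x\mapsto x$ is an isomorphism of $SC^1$-Lie groups: it and its inverse are $SC^1$. -/

import Mathlib

open Set Filter Topology Metric

noncomputable section

namespace PadicLie

universe u v

/-! ### Differential calculus over a valued field -/

/-- For `U ⊆ E`, the set `U^{[1]} = {(x, y, t) ∈ U × E × 𝕜 : x + t y ∈ U}`. -/
def diffDomain (𝕜 : Type) [NontriviallyNormedField 𝕜] {E : Type u} [AddCommGroup E] [Module 𝕜 E]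
    (U : Set E) : Set (E × E × 𝕜) :=
  {q | q.1 ∈ U ∧ q.1 + q.2.2 • q.2.1 ∈ U}

/-- `IsCn 𝕜 n f U`: the map `f` is of class `C^n` on the open set `U`, in the sense of Bertram,
Glöckner and Neeb: `f` is `C^0` if it is continuous, and `C^{n+1}` if it is continuous and the
difference quotient `(x, y, t) ↦ t⁻¹ (f (x + t y) - f x)` (`t ≠ 0`) extends to a map `f^{[1]}` of
class `C^n` on all of `U^{[1]}`. Only the values of `f` on `U` matter. -/
def IsCn (𝕜 : Type) [NontriviallyNormedField 𝕜] {F : Type v} [AddCommGroup F] [Module 𝕜 F]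
    [TopologicalSpace F] :
    ℕ → ∀ {E : Type u} [AddCommGroup E] [Module 𝕜 E] [TopologicalSpace E],
      (E → F) → Set E → Prop
  | 0, _, _, _, _, f, U => ContinuousOn f U
  | n + 1, E, _, _, _, f, U => ContinuousOn f U ∧
      ∃ g : E × E × 𝕜 → F,
        (∀ q ∈ diffDomain 𝕜 U, q.2.2 ≠ 0 →
          g q = q.2.2⁻¹ • (f (q.1 + q.2.2 • q.2.1) - f q.1)) ∧
        IsCn 𝕜 n g (diffDomain 𝕜 U)

/-- Class `C^k` for `k ∈ ℕ ∪ {∞}`. -/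
def IsCk (𝕜 : Type) [NontriviallyNormedField 𝕜] {F : Type v} [AddCommGroup F] [Module 𝕜 F]
    [TopologicalSpace F] {E : Type u} [AddCommGroup E] [Module 𝕜 E] [TopologicalSpace E]
    (k : ℕ∞) (f : E → F) (U : Set E) : Prop :=
  ∀ n : ℕ, (n : ℕ∞) ≤ k → IsCn 𝕜 n f U

/-- `f` is strictly differentiable (`SC^1`) on `U`: strictly differentiable at each point. -/
def IsSC1 (𝕜 : Type) [NontriviallyNormedField 𝕜] {E : Type u} [NormedAddCommGroup E]
    [NormedSpace 𝕜 E] {F : Type v} [NormedAddCommGroup F] [NormedSpace 𝕜 F]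
    (f : E → F) (U : Set E) : Prop :=
  ∀ x ∈ U, ∃ f' : E →L[𝕜] F, HasStrictFDerivAt f f' x

/-! ### Maps between manifolds; a manifold is given by its atlas -/

/-- `f : M → M'` is `C^k` on the open set `s ⊆ M`, where `M`, `M'` are modelled on `E`, `E'`. -/
def CkMapOn (𝕜 : Type) [NontriviallyNormedField 𝕜] (k : ℕ∞)
    (E : Type u) [NormedAddCommGroup E] [NormedSpace 𝕜 E]
    (E' : Type v) [NormedAddCommGroup E'] [NormedSpace 𝕜 E']
    {M : Type*} [TopologicalSpace M] [ChartedSpace E M]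
    {M' : Type*} [TopologicalSpace M'] [ChartedSpace E' M'] (f : M → M') (s : Set M) : Prop :=
  ContinuousOn f s ∧ ∀ e ∈ atlas E M, ∀ e' ∈ atlas E' M',
    IsCk 𝕜 k (fun y => e' (f (e.symm y)))
      {y | y ∈ e.target ∧ e.symm y ∈ s ∧ f (e.symm y) ∈ e'.source}

/-- `f : M → M'` is an `SC^1`-map, where `M`, `M'` are modelled on `E`, `E'`. -/
def SC1Map (𝕜 : Type) [NontriviallyNormedField 𝕜]
    (E : Type u) [NormedAddCommGroup E] [NormedSpace 𝕜 E]
    (E' : Type v) [NormedAddCommGroup E'] [NormedSpace 𝕜 E']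
    {M : Type*} [TopologicalSpace M] [ChartedSpace E M]
    {M' : Type*} [TopologicalSpace M'] [ChartedSpace E' M'] (f : M → M') : Prop :=
  Continuous f ∧ ∀ e ∈ atlas E M, ∀ e' ∈ atlas E' M',
    IsSC1 𝕜 (fun y => e' (f (e.symm y))) {y | y ∈ e.target ∧ f (e.symm y) ∈ e'.source}

/-- The topological group `G`, with the charts of `atlas E G`, is a Lie group of class `C^k`
modelled on `E`: chart changes, multiplication and inversion (in charts) are `C^k`. -/
structure IsCkLieGroup (𝕜 : Type) [NontriviallyNormedField 𝕜] (k : ℕ∞)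
    (E : Type u) [NormedAddCommGroup E] [NormedSpace 𝕜 E]
    (G : Type v) [Group G] [TopologicalSpace G] [IsTopologicalGroup G] [ChartedSpace E G] :
    Prop where
  compatible : ∀ e ∈ atlas E G, ∀ e' ∈ atlas E G,
    IsCk 𝕜 k (fun y => e' (e.symm y)) {y | y ∈ e.target ∧ e.symm y ∈ e'.source}
  mul : ∀ e₁ ∈ atlas E G, ∀ e₂ ∈ atlas E G, ∀ e₃ ∈ atlas E G,
    IsCk 𝕜 k (fun q : E × E => e₃ (e₁.symm q.1 * e₂.symm q.2))
      {q | q.1 ∈ e₁.target ∧ q.2 ∈ e₂.target ∧ e₁.symm q.1 * e₂.symm q.2 ∈ e₃.source}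
  inv : ∀ e ∈ atlas E G, ∀ e' ∈ atlas E G,
    IsCk 𝕜 k (fun y => e' (e.symm y)⁻¹) {y | y ∈ e.target ∧ (e.symm y)⁻¹ ∈ e'.source}

/-- The topological group `G`, with the charts of `atlas E G`, is an `SC^1`-Lie group. -/
structure IsSC1LieGroup (𝕜 : Type) [NontriviallyNormedField 𝕜]
    (E : Type u) [NormedAddCommGroup E] [NormedSpace 𝕜 E]
    (G : Type v) [Group G] [TopologicalSpace G] [IsTopologicalGroup G] [ChartedSpace E G] :
    Prop where
  compatible : ∀ e ∈ atlas E G, ∀ e' ∈ atlas E G,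
    IsSC1 𝕜 (fun y => e' (e.symm y)) {y | y ∈ e.target ∧ e.symm y ∈ e'.source}
  mul : ∀ e₁ ∈ atlas E G, ∀ e₂ ∈ atlas E G, ∀ e₃ ∈ atlas E G,
    IsSC1 𝕜 (fun q : E × E => e₃ (e₁.symm q.1 * e₂.symm q.2))
      {q | q.1 ∈ e₁.target ∧ q.2 ∈ e₂.target ∧ e₁.symm q.1 * e₂.symm q.2 ∈ e₃.source}
  inv : ∀ e ∈ atlas E G, ∀ e' ∈ atlas E G,
    IsSC1 𝕜 (fun y => e' (e.symm y)⁻¹) {y | y ∈ e.target ∧ (e.symm y)⁻¹ ∈ e'.source}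

open Classical in
/-- `k₊ = k` if the modelling space is finite-dimensional (`ℚ_p` is locally compact),
and `k₊ = k + 1` otherwise. -/
def kPlus (p : ℕ) [Fact p.Prime] (k : ℕ∞) (E : Type u) [NormedAddCommGroup E]
    [NormedSpace ℚ_[p] E] : ℕ∞ :=
  if FiniteDimensional ℚ_[p] E then k else k + 1

/-! ### Exponential maps and germs of one-parameter subgroups

The tangent space `L(G) = T_1 G` is identified with the modelling space `E` by means of the
preferred chart `chartAt E 1`. -/

/-- `ψ : Ω → G` is an exponential map of the `p`-adic Lie group `G` (values of `ψ` outside `Ω` are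
irrelevant). -/
structure IsExpMap (p : ℕ) [Fact p.Prime] {E : Type u} [NormedAddCommGroup E] [NormedSpace ℚ_[p] E]
    {G : Type v} [Group G] [TopologicalSpace G] [ChartedSpace E G]
    (Ω : Set E) (ψ : E → G) : Prop where
  nhds_zero : Ω ∈ 𝓝 (0 : E)
  balanced : Balanced ℚ_[p] Ω
  image_nhds_one : ψ '' Ω ∈ 𝓝 (1 : G)
  continuousAt_zero : ContinuousAt ψ 0
  map_add : ∀ x ∈ Ω, ∀ z w : ℚ_[p], ‖z‖ ≤ 1 → ‖w‖ ≤ 1 → ψ ((z + w) • x) = ψ (z • x) * ψ (w • x)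
  class_C1 : ∀ x ∈ Ω, CkMapOn ℚ_[p] 1 ℚ_[p] E (fun z : ℚ_[p] => ψ (z • x)) (closedBall 0 1)
  hasDerivAt : ∀ x ∈ Ω, HasDerivAt (fun z : ℚ_[p] => chartAt E (1 : G) (ψ (z • x))) x 0

/-- `ξ` restricts to a continuous homomorphism `W → G` on the open subgroup `W` of `ℚ_p`
(values of `ξ` outside `W` are irrelevant). -/
structure IsPadicHom (p : ℕ) [Fact p.Prime] {G : Type v} [Group G] [TopologicalSpace G]
    (W : AddSubgroup ℚ_[p]) (ξ : ℚ_[p] → G) : Prop where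
  isOpen : IsOpen (W : Set ℚ_[p])
  continuousOn : ContinuousOn ξ W
  map_add : ∀ s ∈ W, ∀ t ∈ W, ξ (s + t) = ξ s * ξ t

/-- `Γ(G)`: the germs at `0` of continuous homomorphisms from open subgroups of `ℚ_p` to `G`.
As a set, it depends only on the topological group `G`. -/
def Gam (p : ℕ) [Fact p.Prime] (G : Type v) [Group G] [TopologicalSpace G] : Type v :=
  {γ : Germ (𝓝 (0 : ℚ_[p])) G // ∃ (W : AddSubgroup ℚ_[p]) (ξ : ℚ_[p] → G),
    IsPadicHom p W ξ ∧ (ξ : Germ (𝓝 (0 : ℚ_[p])) G) = γ}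

/-- The germ `[ξ] ∈ Γ(G)`. -/
def IsPadicHom.germ {p : ℕ} [Fact p.Prime] {G : Type v} [Group G] [TopologicalSpace G]
    {W : AddSubgroup ℚ_[p]} {ξ : ℚ_[p] → G} (h : IsPadicHom p W ξ) : Gam p G :=
  ⟨(ξ : Germ (𝓝 (0 : ℚ_[p])) G), W, ξ, h, rfl⟩

section theta

variable {p : ℕ} [Fact p.Prime] {E : Type u} [NormedAddCommGroup E] [NormedSpace ℚ_[p] E]
    {G : Type v} [Group G] [TopologicalSpace G] [ChartedSpace E G] {Ω : Set E} {ψ : E → G}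

theorem exists_scale {s : Set E} (hs : s ∈ 𝓝 (0 : E)) (x : E) :
    ∃ c : ℚ_[p], c ≠ 0 ∧ c • x ∈ s := by
  have h1 : Tendsto (fun c : ℚ_[p] => c • x) (𝓝[≠] 0) (𝓝 0) := by
    have : Continuous (fun c : ℚ_[p] => c • x) := by fun_prop
    have h := this.tendsto 0
    rw [zero_smul] at h
    exact h.mono_left nhdsWithin_le_nhds
  obtain ⟨c, hc, hc0⟩ := ((h1.eventually hs).and self_mem_nhdsWithin).exists
  exact ⟨c, hc0, hc⟩

theorem isOpen_unitSubgroup : IsOpen {z : ℚ_[p] | ‖z‖ ≤ 1} := by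
  have := IsUltrametricDist.isOpen_closedBall (0 : ℚ_[p]) one_ne_zero
  simpa [closedBall, dist_zero_right] using this

theorem IsExpMap.exists_isPadicHom (h : IsExpMap p Ω ψ) (x : E) :
    ∃ W, IsPadicHom p W (fun t : ℚ_[p] => ψ (t • x)) := by
  obtain ⟨c, hc0, hc⟩ := exists_scale (p := p) h.nhds_zero x
  have key : ∀ t : ℚ_[p], t • x = (t * c⁻¹) • (c • x) := fun t => by
    rw [smul_smul, mul_assoc, inv_mul_cancel₀ hc0, mul_one]
  have hcont : Continuous (fun t : ℚ_[p] => t * c⁻¹) := by fun_prop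
  refine ⟨(PadicInt.subring p).toAddSubgroup.comap (AddMonoidHom.mulRight c⁻¹), ?_, ?_, ?_⟩
  · exact (isOpen_unitSubgroup (p := p)).preimage hcont
  · have h1 := (h.class_C1 _ hc).1.comp hcont.continuousOn
      (s := {t : ℚ_[p] | ‖t * c⁻¹‖ ≤ 1}) (fun t ht => by simpa using ht)
    refine h1.congr (fun t _ => ?_)
    simp only [Function.comp]
    rw [← key]
  · intro s hs t ht
    rw [key, key s, key t, add_mul]
    exact h.map_add _ hc _ _ hs ht

theorem IsExpMap.hasDerivAt_all (h : IsExpMap p Ω ψ) (x : E) :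
    HasDerivAt (fun z : ℚ_[p] => chartAt E (1 : G) (ψ (z • x))) x 0 := by
  obtain ⟨c, hc0, hc⟩ := exists_scale (p := p) h.nhds_zero x
  have h1 := h.hasDerivAt _ hc
  have h2 : HasDerivAt (fun t : ℚ_[p] => t * c⁻¹) c⁻¹ 0 := by
    simpa using (hasDerivAt_id (0 : ℚ_[p])).mul_const c⁻¹
  have h3 := HasDerivAt.scomp_of_eq (0 : ℚ_[p]) h1 h2 (by simp)
  rw [smul_smul, inv_mul_cancel₀ hc0, one_smul] at h3
  refine h3.congr_of_eventuallyEq (Eventually.of_forall fun t => ?_)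
  simp only [Function.comp]
  rw [smul_smul, mul_assoc, inv_mul_cancel₀ hc0, mul_one]

/-- `θ_G : L(G) → Γ(G)`, `x ↦ [t ↦ exp_G (t x)]`. -/
def IsExpMap.theta (h : IsExpMap p Ω ψ) (x : E) : Gam p G :=
  (h.exists_isPadicHom x).choose_spec.germ

theorem IsExpMap.theta_injective (h : IsExpMap p Ω ψ) : Function.Injective h.theta := by
  intro x y hxy
  have h1 : (fun t : ℚ_[p] => ψ (t • x)) =ᶠ[𝓝 0] (fun t : ℚ_[p] => ψ (t • y)) :=
    Germ.coe_eq.1 (congrArg Subtype.val hxy)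
  have h2 := (h.hasDerivAt_all y).congr_of_eventuallyEq
    (h1.fun_comp (chartAt E (1 : G)))
  exact (h.hasDerivAt_all x).unique h2

theorem IsExpMap.theta_surjective [T2Space G] (h : IsExpMap p Ω ψ) :
    Function.Surjective h.theta := by
  rintro ⟨γ, W, ξ, hξ, rfl⟩
  have hW : (W : Set ℚ_[p]) ∈ 𝓝 (0 : ℚ_[p]) := hξ.isOpen.mem_nhds W.zero_mem
  have hξ0 : ξ 0 = 1 := by
    have := hξ.map_add 0 W.zero_mem 0 W.zero_mem
    rw [add_zero] at this
    exact left_eq_mul.mp this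
  have hψ0 : ψ 0 = 1 := by
    have := h.map_add 0 (mem_of_mem_nhds h.nhds_zero) 0 0 (by simp) (by simp)
    rw [add_zero, zero_smul] at this
    exact left_eq_mul.mp this
  have hcξ : ContinuousAt ξ 0 := hξ.continuousOn.continuousAt hW
  have hev : ∀ᶠ c in 𝓝 (0 : ℚ_[p]), ξ c ∈ ψ '' Ω :=
    hcξ.eventually (by rw [hξ0]; exact h.image_nhds_one)
  obtain ⟨ε, hε, hball⟩ := Metric.mem_nhds_iff.1 hW
  have hev2 : ∀ᶠ c in 𝓝[≠] (0 : ℚ_[p]), (ξ c ∈ ψ '' Ω ∧ c ∈ ball (0 : ℚ_[p]) ε) ∧ c ≠ 0 :=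
    ((hev.and (ball_mem_nhds _ hε)).filter_mono nhdsWithin_le_nhds).and self_mem_nhdsWithin
  obtain ⟨c, ⟨⟨x, hx, hxc⟩, hcε⟩, hc0⟩ := hev2.exists
  have hmem : ∀ z : ℤ_[p], (z : ℚ_[p]) * c ∈ W := fun z => by
    apply hball
    rw [mem_ball_zero_iff] at hcε ⊢
    rw [norm_mul]
    exact lt_of_le_of_lt (mul_le_of_le_one_left (norm_nonneg _) z.2) hcε
  have hnat : ∀ m : ℕ, ξ ((m : ℚ_[p]) * c) = ψ ((m : ℚ_[p]) • x) := by
    intro m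
    induction m with
    | zero => simp [hξ0, hψ0]
    | succ m ih =>
      have e1 := hξ.map_add ((m : ℚ_[p]) * c) (by simpa using hmem (m : ℤ_[p])) c
        (by simpa using hmem 1)
      have e2 := h.map_add x hx (m : ℚ_[p]) 1 (by simpa using ((m : ℤ_[p])).2) (by simp)
      rw [one_smul] at e2
      push_cast
      rw [add_mul, one_mul, e1, ih, e2, hxc]
  have hcoe : Continuous (fun z : ℤ_[p] => (z : ℚ_[p])) := continuous_subtype_val
  have hfun : (fun z : ℤ_[p] => ξ ((z : ℚ_[p]) * c)) = fun z : ℤ_[p] => ψ ((z : ℚ_[p]) • x) := by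
    refine PadicInt.denseRange_natCast.equalizer ?_ ?_ ?_
    · exact hξ.continuousOn.comp_continuous (by fun_prop) hmem
    · exact (h.class_C1 x hx).1.comp_continuous hcoe (fun z => by simpa using z.2)
    · funext m
      simpa using hnat m
  refine ⟨c⁻¹ • x, Subtype.ext (Germ.coe_eq.2 ?_)⟩
  filter_upwards [closedBall_mem_nhds (0 : ℚ_[p]) (norm_pos_iff.2 hc0)] with t ht
  have ht1 : ‖t * c⁻¹‖ ≤ 1 := by
    rw [mem_closedBall_zero_iff] at ht
    rw [norm_mul, norm_inv]
    exact mul_inv_le_one_of_le₀ ht (norm_nonneg _)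
  have e := congrFun hfun ⟨t * c⁻¹, ht1⟩
  simp only at e
  rw [mul_assoc, inv_mul_cancel₀ hc0, mul_one] at e
  rw [smul_smul, e]

/-- The bijection `θ_G : L(G) → Γ(G)`. -/
def IsExpMap.thetaEquiv [T2Space G] (h : IsExpMap p Ω ψ) : E ≃ Gam p G :=
  Equiv.ofBijective h.theta ⟨h.theta_injective, h.theta_surjective⟩

/-- Addition on `Γ(G)`, transported from `L(G)` by `θ_G`. -/
def IsExpMap.add [T2Space G] (h : IsExpMap p Ω ψ) (a b : Gam p G) : Gam p G :=
  h.thetaEquiv (h.thetaEquiv.symm a + h.thetaEquiv.symm b)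

/-- Scalar multiplication on `Γ(G)`, transported from `L(G)` by `θ_G`. -/
def IsExpMap.smul [T2Space G] (h : IsExpMap p Ω ψ) (z : ℚ_[p]) (a : Gam p G) : Gam p G :=
  h.thetaEquiv (z • h.thetaEquiv.symm a)

/-- The topology on `Γ(G)`, transported from `L(G)` by `θ_G`. -/
@[reducible]
def IsExpMap.topology [T2Space G] (h : IsExpMap p Ω ψ) : TopologicalSpace (Gam p G) :=
  TopologicalSpace.coinduced h.thetaEquiv inferInstance

end theta

/-! ### Adapted charts, logarithm, exponential function and roots -/

/-- A `C^{k₊}`-diffeomorphism `φ : U → V_r` from an open subgroup `U` of `G` onto the ball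
`V_r = B_r(0)` of `L(G) = E`, such that `φ 1 = 0`, `T_1 φ = id`, and such that, for the group
multiplication `x * y = φ (φ⁻¹ x · φ⁻¹ y)` on `V_r`, one has `x * V_s = V_s * x = x + V_s` for all
`x ∈ V_r` and `0 < s ≤ r`, and `p⁻¹ τ_p : V_r → V_r` is a surjective isometry, where `τ_p` is the
`p`-th power map with respect to `*`. -/
structure AdaptedChart (p : ℕ) [Fact p.Prime] (k : ℕ∞)
    (E : Type u) [NormedAddCommGroup E] [NormedSpace ℚ_[p] E]
    (G : Type v) [Group G] [TopologicalSpace G] [ChartedSpace E G] where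
  /-- the open subgroup -/
  U : Subgroup G
  /-- the radius -/
  r : ℝ
  /-- the chart -/
  φ : OpenPartialHomeomorph G E
  r_pos : 0 < r
  r_lt_one : r < 1
  source_eq : φ.source = U
  target_eq : φ.target = ball (0 : E) r
  map_one : φ 1 = 0
  class_Ck : CkMapOn ℚ_[p] (kPlus p k E) E E φ U
  class_Ck_symm : CkMapOn ℚ_[p] (kPlus p k E) E E φ.symm (ball (0 : E) r)
  tangent_one : HasFDerivAt (fun y => φ ((chartAt E (1 : G)).symm y))
    (ContinuousLinearMap.id ℚ_[p] E) (chartAt E (1 : G) 1)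
  left_coset : ∀ x ∈ ball (0 : E) r, ∀ s : ℝ, 0 < s → s ≤ r →
    (fun y => φ (φ.symm x * φ.symm y)) '' ball 0 s = ball x s
  right_coset : ∀ x ∈ ball (0 : E) r, ∀ s : ℝ, 0 < s → s ≤ r →
    (fun y => φ (φ.symm y * φ.symm x)) '' ball 0 s = ball x s
  power_isometry : ∀ x ∈ ball (0 : E) r, ∀ y ∈ ball (0 : E) r,
    dist ((p : ℚ_[p])⁻¹ • φ (φ.symm x ^ p)) ((p : ℚ_[p])⁻¹ • φ (φ.symm y ^ p)) = dist x y
  power_surjective :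
    (fun x => (p : ℚ_[p])⁻¹ • φ (φ.symm x ^ p)) '' ball (0 : E) r = ball (0 : E) r

namespace AdaptedChart

variable {p : ℕ} [Fact p.Prime] {k : ℕ∞} {E : Type u} [NormedAddCommGroup E] [NormedSpace ℚ_[p] E]
    {G : Type v} [Group G] [TopologicalSpace G] [ChartedSpace E G]

/-- `v = η'(0)` in the chart `φ`, for a continuous homomorphism `η : ℤ_p → U` with `η 1 = x`,
that is, a continuous extension of `ℤ → U`, `n ↦ x ^ n`. -/
def IsLog (D : AdaptedChart p k E G) (x : G) (v : E) : Prop :=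
  ∃ η : ℚ_[p] → G, IsPadicHom p (PadicInt.subring p).toAddSubgroup η ∧
    (∀ z : ℚ_[p], ‖z‖ ≤ 1 → η z ∈ D.U) ∧ η 1 = x ∧ HasDerivAt (fun z => D.φ (η z)) v 0

open Classical in
/-- `log_G : U → V_r`, `log_G x = η_x'(0)` with `η_x : ℤ_p → U` as in `IsLog`. -/
def log (D : AdaptedChart p k E G) (x : G) : E :=
  if h : ∃ v, D.IsLog x v then h.choose else 0

/-- `exp_G : V_r → U`, the inverse of `log_G`. -/
def exp (D : AdaptedChart p k E G) (v : E) : G :=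
  Function.invFunOn D.log (D.U : Set G) v

/-- `x^{p^{-n}}`: the element of `U` whose `p^n`-th power is `x`. -/
def root (D : AdaptedChart p k E G) (n : ℕ) (x : G) : G :=
  Function.invFunOn (fun y : G => y ^ (p ^ n)) (D.U : Set G) x

end AdaptedChart

end PadicLie

end

open PadicLie

namespace PadicLie

universe u v w

/-! ### Difference quotients and strict differentiability. -/

section Calculus

variable {𝕜 : Type} [NontriviallyNormedField 𝕜] {E : Type u} [NormedAddCommGroup E]
  [NormedSpace 𝕜 E] {F : Type v} [NormedAddCommGroup F] [NormedSpace 𝕜 F]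

/-! Everything is drawn from one estimate (`MulEstimate`): near the identity, in a chart `φ` with `φ
1 = 0`, multiplication differs from addition by a map with small Lipschitz constant. This is strict
differentiability of the multiplication at `1`. The class `C^{k₊}` supplies it: in finite dimension
`C^1` suffices because the unit ball is compact, and otherwise the extra derivative makes the
difference quotient locally Lipschitz.

In the ultrametric setting the errors of iterated products do not add up. Hence `φ (g ^ m) - φ (h ^
m)` equals `m (φ g - φ h)` up to `ε ‖φ g - φ h‖`, with `ε` independent of `m`
(`MulEstimate.pow_sub`). For `m = p` and `ε = ‖p‖ / 2`, the map `p⁻¹ τ_p` is a perturbation of the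
identity with Lipschitz constant `1/2`, hence an isometry of the ball onto itself; this produces
adapted charts.

In an adapted chart the maps `g ↦ p⁻ⁿ φ (g ^ pⁿ)` are isometric for the distance read in `φ`, and
they converge uniformly. The limit `limLog` is again isometric, maps `U` onto `V_r`, and has strict
derivative the identity at `0`. A continuous homomorphism `ξ : ℤ_p → U` has derivative `limLog (ξ
1)` at `0`, so `log = limLog` and `exp` is an exponential map.

For (a), the logarithm of the `pⁿ`-th root of `a b` is `p⁻ⁿ limLog (a b)`. When `a` and `b` have
size at most `‖p‖ⁿ`, both `limLog - φ` and the failure of `φ` to be additive are of size `o(‖p‖ⁿ)`.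
Part (b) is (a) applied to `t v₁` and `t v₂`, followed by `exp`.

For (c), the formula in (b) involves only the topological group once roots in the two subgroups are
matched (`StrictMul.add_eq_of_subset`), so the two additions on germs agree; scalar multiplication
is reparametrization. The resulting linear map `T` between the Lie algebras equals `log' ∘ exp` near
`0`, hence is continuous. Since logarithms and exponentials are strictly differentiable at `0`, so
is the change of charts at the identity, and left translations carry this to every point. -/

theorem isOpen_diffDomain {U : Set E} (hU : IsOpen U) : IsOpen (diffDomain 𝕜 U) := by
  have h1 : Continuous fun q : E × E × 𝕜 => q.1 := by fun_prop
  have h2 : Continuous fun q : E × E × 𝕜 => q.1 + q.2.2 • q.2.1 := by fun_prop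
  exact (hU.preimage h1).inter (hU.preimage h2)

theorem mk_zero_mem_diffDomain {U : Set E} {x : E} (hx : x ∈ U) (y : E) :
    (x, y, (0 : 𝕜)) ∈ diffDomain 𝕜 U := by
  simp [diffDomain, hx]

/-- The directional derivative of a `C^1`-map, as a continuous linear map. -/
theorem exists_clm_eq_of_diffQuot {f : E → F} {U : Set E} (hU : IsOpen U)
    {g : E × E × 𝕜 → F}
    (hg : ∀ q ∈ diffDomain 𝕜 U, q.2.2 ≠ 0 →
      g q = q.2.2⁻¹ • (f (q.1 + q.2.2 • q.2.1) - f q.1))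
    (hc : ContinuousOn g (diffDomain 𝕜 U)) {x : E} (hx : x ∈ U) :
    ∃ A : E →L[𝕜] F, ∀ y, A y = g (x, y, 0) := by
  have hcont : ∀ y, ContinuousAt g (x, y, 0) := fun y =>
    hc.continuousAt ((isOpen_diffDomain hU).mem_nhds (mk_zero_mem_diffDomain hx y))
  have hmem : ∀ y : E, ∀ᶠ t in 𝓝[≠] (0 : 𝕜), x + t • y ∈ U := fun y => by
    have h1 : Tendsto (fun t : 𝕜 => x + t • y) (𝓝 0) (𝓝 x) := by
      have : Continuous fun t : 𝕜 => x + t • y := by fun_prop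
      simpa using this.tendsto 0
    exact (h1.eventually (hU.mem_nhds hx)).filter_mono nhdsWithin_le_nhds
  have hne : ∀ᶠ t in 𝓝[≠] (0 : 𝕜), t ≠ 0 := self_mem_nhdsWithin
  have hlim : ∀ y, Tendsto (fun t : 𝕜 => g (x, y, t)) (𝓝[≠] 0) (𝓝 (g (x, y, 0))) := fun y => by
    have h1 : Tendsto (fun t : 𝕜 => (x, y, t)) (𝓝 0) (𝓝 (x, y, 0)) := by
      have : Continuous fun t : 𝕜 => (x, y, t) := by fun_prop
      exact this.tendsto 0
    exact ((hcont y).tendsto.comp h1).mono_left nhdsWithin_le_nhds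
  have hadd : ∀ y z, g (x, y + z, 0) = g (x, y, 0) + g (x, z, 0) := fun y z => by
    have h1 : Tendsto (fun t : 𝕜 => (x + t • y, z, t)) (𝓝 0) (𝓝 (x, z, 0)) := by
      have : Continuous fun t : 𝕜 => (x + t • y, z, t) := by fun_prop
      simpa using this.tendsto 0
    have h2 := (hlim y).add (((hcont z).tendsto.comp h1).mono_left
      (nhdsWithin_le_nhds (s := {0}ᶜ)))
    refine tendsto_nhds_unique (hlim (y + z)) (h2.congr' ?_)
    filter_upwards [hmem y, hmem (y + z), hne] with t ht1 ht2 ht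
    have ht2' : x + t • y + t • z ∈ U := by rwa [add_assoc, ← smul_add]
    simp only [Function.comp]
    rw [hg (x, y, t) ⟨hx, ht1⟩ ht, hg (x + t • y, z, t) ⟨ht1, ht2'⟩ ht,
      hg (x, y + z, t) ⟨hx, ht2⟩ ht, ← smul_add]
    rw [smul_add t y z, ← add_assoc]
    change t⁻¹ • (f (x + t • y) - f x + (f (x + t • y + t • z) - f (x + t • y))) =
      t⁻¹ • (f (x + t • y + t • z) - f x)
    congr 1
    abel
  have hsmul : ∀ (c : 𝕜) (y), g (x, c • y, 0) = c • g (x, y, 0) := fun c y => by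
    rcases eq_or_ne c 0 with rfl | hc0
    · rw [zero_smul, zero_smul]
      have := hadd 0 0
      rw [add_zero] at this
      exact left_eq_add.mp this
    have h1 : Tendsto (fun t : 𝕜 => (x, y, t * c)) (𝓝 0) (𝓝 (x, y, 0)) := by
      have : Continuous fun t : 𝕜 => (x, y, t * c) := by fun_prop
      simpa using this.tendsto 0
    have h2 := (((hcont y).tendsto.comp h1).mono_left
      (nhdsWithin_le_nhds (s := {0}ᶜ))).const_smul c
    refine tendsto_nhds_unique (hlim (c • y)) (h2.congr' ?_)
    filter_upwards [hmem (c • y), hne] with t ht1 ht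
    have ht1' : x + (t * c) • y ∈ U := by rwa [mul_smul]
    simp only [Function.comp]
    rw [hg (x, c • y, t) ⟨hx, ht1⟩ ht, hg (x, y, t * c) ⟨hx, ht1'⟩ (mul_ne_zero ht hc0)]
    rw [mul_smul, smul_smul c]
    congr 1
    field_simp
  refine ⟨⟨⟨⟨fun y => g (x, y, 0), hadd⟩, hsmul⟩, ?_⟩, fun y => rfl⟩
  refine continuous_iff_continuousAt.2 fun y => ?_
  have : Continuous fun y : E => (x, y, (0 : 𝕜)) := by fun_prop
  exact ContinuousAt.comp (f := fun y : E => (x, y, (0 : 𝕜))) (hcont y) this.continuousAt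

/-- A difference `a - b` is a scalar multiple `d⁻¹ • y` with `‖y‖ ≤ δ` and `‖d⁻¹‖` comparable to `‖a
- b‖`, so `f a - f b` is `d⁻¹` times a value of the difference quotient. Closeness of `g (z, y, t)`
to `g (x, y, 0)`, uniform in `y`, is therefore all that strict differentiability needs. -/
theorem hasStrictFDerivAt_of_diffQuot {f : E → F} {U : Set E} (hU : IsOpen U)
    {g : E × E × 𝕜 → F}
    (hg : ∀ q ∈ diffDomain 𝕜 U, q.2.2 ≠ 0 →
      g q = q.2.2⁻¹ • (f (q.1 + q.2.2 • q.2.1) - f q.1))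
    {x : E} (hx : x ∈ U) {A : E →L[𝕜] F} (hA : ∀ y, A y = g (x, y, 0)) {δ : ℝ} (hδ : 0 < δ)
    (hu : ∀ ε > 0, ∃ η > 0, ∀ z y : E, ∀ t : 𝕜, ‖z - x‖ < η → ‖y‖ ≤ δ → ‖t‖ < η →
      ‖g (z, y, t) - g (x, y, 0)‖ ≤ ε) :
    HasStrictFDerivAt f A x := by
  rw [hasStrictFDerivAt_iff_isLittleO, Asymptotics.isLittleO_iff]
  intro ε hε
  obtain ⟨c, hc⟩ := NormedField.exists_one_lt_norm 𝕜
  have hc0 : 0 < ‖c‖ := one_pos.trans hc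
  obtain ⟨η, hη, h⟩ := hu (ε * (δ⁻¹ * ‖c‖)⁻¹) (by positivity)
  obtain ⟨ρ, hρ, hball⟩ := Metric.isOpen_iff.1 hU x hx
  -- The bound `ρ` puts `a` and `b` in `U`, and `η` puts `b` near `x`. The last term makes `‖a - b‖`
  -- small enough that the rescaling factor satisfies `‖d⁻¹‖ < η`; its `/ 2` pays for the triangle
  -- inequality.
  set σ := min (min ρ η) (η * (δ⁻¹ * ‖c‖)⁻¹ / 2) with hσ
  have hσ0 : 0 < σ := by positivity
  filter_upwards [ball_mem_nhds (x, x) hσ0] with q hq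
  obtain ⟨a, b⟩ := q
  rw [← ball_prod_same, mem_prod, mem_ball_iff_norm, mem_ball_iff_norm] at hq
  obtain ⟨ha, hb⟩ := hq
  simp only at ha hb ⊢
  rcases eq_or_ne a b with rfl | hab
  · simp
  obtain ⟨d, hd0, hd1, -, hd3⟩ := rescale_to_shell hc hδ (sub_ne_zero.2 hab)
  have hnab : ‖a - b‖ < η * (δ⁻¹ * ‖c‖)⁻¹ := by
    calc ‖a - b‖ = ‖(a - x) - (b - x)‖ := by congr 1; abel
      _ ≤ ‖a - x‖ + ‖b - x‖ := norm_sub_le _ _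
      _ < σ + σ := add_lt_add ha hb
      _ ≤ _ := by have := min_le_right (min ρ η) (η * (δ⁻¹ * ‖c‖)⁻¹ / 2); linarith
  have hdη : ‖d⁻¹‖ < η := by
    rw [norm_inv]
    refine hd3.trans_lt ?_
    rw [mul_comm]
    rwa [← lt_div_iff₀ (by positivity), div_eq_mul_inv]
  have hab' : b + d⁻¹ • d • (a - b) = a := by
    rw [smul_smul, inv_mul_cancel₀ hd0, one_smul]; abel
  have hbU : b ∈ U := hball (by
    rw [mem_ball_iff_norm]; exact hb.trans_le ((min_le_left _ _).trans (min_le_left _ _)))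
  have haU : a ∈ U := hball (by
    rw [mem_ball_iff_norm]; exact ha.trans_le ((min_le_left _ _).trans (min_le_left _ _)))
  have e1 := hg (b, d • (a - b), d⁻¹) ⟨hbU, by simp only [hab']; exact haU⟩ (inv_ne_zero hd0)
  simp only [hab', inv_inv] at e1
  have e2 : f a - f b = d⁻¹ • g (b, d • (a - b), d⁻¹) := by
    rw [e1, smul_smul, inv_mul_cancel₀ hd0, one_smul]
  have e3 : A (a - b) = d⁻¹ • g (x, d • (a - b), 0) := by
    rw [← hA, map_smul, smul_smul, inv_mul_cancel₀ hd0, one_smul]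
  rw [e2, e3, ← smul_sub, norm_smul]
  have h4 := h b (d • (a - b)) d⁻¹ (hb.trans_le ((min_le_left _ _).trans (min_le_right _ _)))
    hd1.le hdη
  calc ‖d⁻¹‖ * _ ≤ (δ⁻¹ * ‖c‖ * ‖a - b‖) * (ε * (δ⁻¹ * ‖c‖)⁻¹) := by
        rw [norm_inv]; gcongr
    _ = ε * ‖a - b‖ := by field_simp

/-- Continuity of the difference quotient at each `(x, y, 0)` becomes uniform in `y` because the
closed unit ball is compact. -/
theorem IsCn.isSC1_of_properSpace [ProperSpace E] {f : E → F} {U : Set E} (hU : IsOpen U)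
    (hf : IsCn 𝕜 1 f U) : IsSC1 𝕜 f U := by
  intro x hx
  obtain ⟨-, g, hg, hc⟩ := hf
  obtain ⟨A, hA⟩ := exists_clm_eq_of_diffQuot hU hg hc hx
  refine ⟨A, hasStrictFDerivAt_of_diffQuot hU hg hx hA one_pos fun ε hε => ?_⟩
  have hcont : ∀ y, ContinuousAt g (x, y, 0) := fun y =>
    ContinuousOn.continuousAt hc
      ((isOpen_diffDomain hU).mem_nhds (mk_zero_mem_diffDomain hx y))
  have key : ∀ᶠ q in 𝓝 (x, (0 : 𝕜)), ∀ y ∈ closedBall (0 : E) 1,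
      ‖g (q.1, y, q.2) - g (x, y, 0)‖ ≤ ε := by
    refine (isCompact_closedBall (0 : E) 1).eventually_forall_of_forall_eventually ?_
    intro y _
    have h1 : ContinuousAt (fun z : (E × 𝕜) × E => g (z.1.1, z.2, z.1.2) - g (x, z.2, 0))
        ((x, 0), y) := by
      refine ContinuousAt.sub ?_ ?_
      · have h2 : Continuous fun z : (E × 𝕜) × E => (z.1.1, z.2, z.1.2) := by fun_prop
        exact ContinuousAt.comp (f := fun z : (E × 𝕜) × E => (z.1.1, z.2, z.1.2))
          (x := ((x, 0), y)) (hcont y) h2.continuousAt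
      · have h2 : Continuous fun z : (E × 𝕜) × E => (x, z.2, (0 : 𝕜)) := by fun_prop
        exact ContinuousAt.comp (f := fun z : (E × 𝕜) × E => (x, z.2, (0 : 𝕜)))
          (x := ((x, 0), y)) (hcont y) h2.continuousAt
    have h3 := h1.norm.tendsto
    simp only [sub_self, norm_zero] at h3
    filter_upwards [h3.eventually (gt_mem_nhds hε)] with z hz using le_of_lt hz
  obtain ⟨η, hη, h⟩ := Metric.eventually_nhds_iff_ball.1 key
  refine ⟨η, hη, fun z y t hz hy ht => h (z, t) ?_ y (by simpa using hy)⟩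
  rw [← ball_prod_same]
  exact ⟨by simpa [dist_eq_norm] using hz, by simpa using ht⟩

/-- The difference quotient is bounded near `(x, 0, 0)`, and rescaling directions into the shell
below radius `ρ` turns this bound into a Lipschitz constant. -/
theorem IsCn.exists_lipschitz {f : E → F} {U : Set E} (hU : IsOpen U)
    (hf : IsCn 𝕜 1 f U) {x : E} (hx : x ∈ U) :
    ∃ C > 0, ∃ δ > 0, ∀ a b : E, ‖a - x‖ < δ → ‖b - x‖ < δ → ‖f a - f b‖ ≤ C * ‖a - b‖ := by
  obtain ⟨-, g, hg, hc⟩ := hf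
  have hcont : ContinuousAt g (x, 0, 0) :=
    ContinuousOn.continuousAt hc
      ((isOpen_diffDomain hU).mem_nhds (mk_zero_mem_diffDomain hx 0))
  set K := ‖g (x, 0, 0)‖ + 1 with hK
  have hK0 : 0 < K := by positivity
  have hev : ∀ᶠ q in 𝓝 (x, (0 : E), (0 : 𝕜)), ‖g q‖ < K :=
    hcont.norm.tendsto.eventually (gt_mem_nhds (by rw [hK]; linarith))
  obtain ⟨ρ, hρ, hb⟩ := Metric.eventually_nhds_iff_ball.1 hev
  obtain ⟨ρ', hρ', hball⟩ := Metric.isOpen_iff.1 hU x hx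
  obtain ⟨c, hc⟩ := NormedField.exists_one_lt_norm 𝕜
  have hc0 : 0 < ‖c‖ := one_pos.trans hc
  set M := ρ⁻¹ * ‖c‖ with hM
  have hM0 : 0 < M := by positivity
  refine ⟨K * M, by positivity, min (min ρ ρ') (ρ * M⁻¹ / 2), by positivity, ?_⟩
  intro a b ha hb'
  rcases eq_or_ne a b with rfl | hab
  · simp
  obtain ⟨d, hd0, hd1, -, hd3⟩ := rescale_to_shell hc hρ (sub_ne_zero.2 hab)
  have hnab : ‖a - b‖ < ρ * M⁻¹ := by
    have := min_le_right (min ρ ρ') (ρ * M⁻¹ / 2)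
    calc ‖a - b‖ = ‖(a - x) - (b - x)‖ := by congr 1; abel
      _ ≤ ‖a - x‖ + ‖b - x‖ := norm_sub_le _ _
      _ < _ := add_lt_add ha hb'
      _ ≤ _ := by linarith
  have hdρ : ‖d⁻¹‖ < ρ := by
    rw [norm_inv]
    refine hd3.trans_lt ?_
    rw [← hM, mul_comm]
    rwa [← lt_div_iff₀ (by positivity), div_eq_mul_inv]
  have hab' : b + d⁻¹ • d • (a - b) = a := by
    rw [smul_smul, inv_mul_cancel₀ hd0, one_smul]; abel
  have hbU : b ∈ U := hball (by
    rw [mem_ball_iff_norm]; exact hb'.trans_le ((min_le_left _ _).trans (min_le_right _ _)))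
  have haU : a ∈ U := hball (by
    rw [mem_ball_iff_norm]; exact ha.trans_le ((min_le_left _ _).trans (min_le_right _ _)))
  have e1 := hg (b, d • (a - b), d⁻¹) ⟨hbU, by simp only [hab']; exact haU⟩ (inv_ne_zero hd0)
  simp only [hab', inv_inv] at e1
  have e2 : f a - f b = d⁻¹ • g (b, d • (a - b), d⁻¹) := by
    rw [e1, smul_smul, inv_mul_cancel₀ hd0, one_smul]
  have e3 : ‖g (b, d • (a - b), d⁻¹)‖ < K := by
    apply hb
    rw [← ball_prod_same, ← ball_prod_same]
    refine ⟨?_, ?_, ?_⟩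
    · simp only [mem_ball_iff_norm]
      exact hb'.trans_le ((min_le_left _ _).trans (min_le_left _ _))
    · simpa using hd1
    · simpa using hdρ
  rw [e2, norm_smul, norm_inv]
  calc _ ≤ (ρ⁻¹ * ‖c‖ * ‖a - b‖) * K := by gcongr
    _ = _ := by rw [hM]; ring

/-- The difference quotient is itself `C^1`, hence Lipschitz near `(x, 0, 0)`. The points `(z, y,
t)` and `(x, y, 0)` differ by `max ‖z - x‖ ‖t‖` whatever `y` is, which gives the uniformity without
compactness. -/
theorem IsCn.isSC1_of_two {f : E → F} {U : Set E} (hU : IsOpen U)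
    (hf : IsCn 𝕜 2 f U) : IsSC1 𝕜 f U := by
  intro x hx
  obtain ⟨-, g, hg, hg1⟩ := hf
  obtain ⟨A, hA⟩ := exists_clm_eq_of_diffQuot hU hg hg1.1 hx
  obtain ⟨C, hC, δ, hδ, h⟩ := IsCn.exists_lipschitz (isOpen_diffDomain hU) hg1
    (mk_zero_mem_diffDomain hx (0 : E))
  refine ⟨A, hasStrictFDerivAt_of_diffQuot hU hg hx hA (half_pos hδ) fun ε hε => ?_⟩
  refine ⟨min δ (ε * C⁻¹), by positivity, fun z y t hz hy ht => ?_⟩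
  have hy' : ‖y‖ < δ := by linarith
  refine (h _ _ ?_ ?_).trans ?_
  · simp only [Prod.mk_sub_mk, Prod.norm_mk, sub_zero, sup_lt_iff]
    exact ⟨hz.trans_le (min_le_left _ _), hy', ht.trans_le (min_le_left _ _)⟩
  · simp [Prod.norm_mk, hy']
  · simp only [Prod.mk_sub_mk, Prod.norm_mk, sub_zero, sub_self, norm_zero]
    have h1 : max ‖z - x‖ (max 0 ‖t‖) ≤ ε * C⁻¹ := by
      refine max_le (hz.le.trans (min_le_right _ _)) (max_le (by positivity) ?_)
      exact ht.le.trans (min_le_right _ _)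
    calc _ ≤ C * (ε * C⁻¹) := by gcongr
      _ = ε := by field_simp

theorem IsCn.mono {n : ℕ} {E : Type u} [NormedAddCommGroup E] [NormedSpace 𝕜 E]
    {f : E → F} {U V : Set E} (hf : IsCn 𝕜 n f U) (hVU : V ⊆ U) : IsCn 𝕜 n f V := by
  induction n generalizing E with
  | zero => exact ContinuousOn.mono hf hVU
  | succ n ih =>
    obtain ⟨h1, g, hg, h2⟩ := hf
    have hd : diffDomain 𝕜 V ⊆ diffDomain 𝕜 U := fun q hq => ⟨hVU hq.1, hVU hq.2⟩
    exact ⟨h1.mono hVU, g, fun q hq => hg q (hd hq), ih h2 hd⟩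

theorem IsCn.comp_add_right {n : ℕ} {E : Type u} [NormedAddCommGroup E] [NormedSpace 𝕜 E]
    {f : E → F} {U : Set E} (hf : IsCn 𝕜 n f U) (a : E) :
    IsCn 𝕜 n (fun x => f (x + a)) {x | x + a ∈ U} := by
  induction n generalizing E with
  | zero =>
    exact ContinuousOn.comp (t := U) hf (by fun_prop) fun x hx => hx
  | succ n ih =>
    obtain ⟨h1, g, hg, h2⟩ := hf
    refine ⟨h1.comp (by fun_prop) fun x hx => hx, fun q => g (q + (a, 0, 0)), ?_, ?_⟩
    · rintro ⟨x, y, t⟩ hq ht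
      have hq' : (x + a, y, t) ∈ diffDomain 𝕜 U := by
        refine ⟨hq.1, ?_⟩
        have := hq.2
        simp only [mem_ofPred_eq] at this ⊢
        rwa [add_right_comm]
      simpa [add_right_comm] using hg _ hq' ht
    · refine (ih h2 (a, 0, 0)).mono ?_
      rintro ⟨x, y, t⟩ hq
      refine ⟨by simpa using hq.1, ?_⟩
      have := hq.2
      simp only [mem_ofPred_eq, Prod.mk_add_mk, add_zero] at this ⊢
      rwa [add_right_comm]

theorem IsCn.add_const {n : ℕ} {f : E → F} {U : Set E} (hf : IsCn 𝕜 n f U) (b : F) :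
    IsCn 𝕜 n (fun x => f x + b) U := by
  cases n with
  | zero => exact ContinuousOn.add hf continuousOn_const
  | succ n =>
    obtain ⟨h1, g, hg, h2⟩ := hf
    exact ⟨h1.add continuousOn_const, g, fun q hq ht => by simp [hg q hq ht], h2⟩

theorem isCn_congr {n : ℕ} {f f' : E → F} {U : Set E} (hf : IsCn 𝕜 n f U)
    (h : ∀ x ∈ U, f' x = f x) : IsCn 𝕜 n f' U := by
  cases n with
  | zero => exact ContinuousOn.congr hf h
  | succ n =>
    obtain ⟨h1, g, hg, h2⟩ := hf
    exact ⟨h1.congr h, g, fun q hq ht => by rw [hg q hq ht, h _ hq.1, h _ hq.2], h2⟩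

open Classical in
-- The `C^1` condition on one-parameter subgroups in `IsExpMap` is obtained from this converse. The
-- quotient is extended to `t = 0` by the derivative, and the strict estimate at the single point
-- `x` controls both the quotients and the derivatives at nearby points.
theorem IsSC1.isCn_one {f : E → F} {U : Set E} (hU : IsOpen U) (hf : IsSC1 𝕜 f U) :
    IsCn 𝕜 1 f U := by
  have hcont : ContinuousOn f U := fun x hx => by
    obtain ⟨A, hA⟩ := hf x hx
    exact hA.continuousAt.continuousWithinAt
  choose A hA using hf
  refine ⟨hcont, fun q => if q.2.2 = 0 then (if h : q.1 ∈ U then A q.1 h q.2.1 else 0)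
    else q.2.2⁻¹ • (f (q.1 + q.2.2 • q.2.1) - f q.1), fun q hq ht => by simp [ht], ?_⟩
  change ContinuousOn _ _
  refine continuousOn_of_forall_continuousAt fun q hq => ?_
  obtain ⟨x, y, t⟩ := q
  have hx : x ∈ U := hq.1
  have hxt : x + t • y ∈ U := hq.2
  by_cases ht : t = 0
  · subst ht
    have hs := (hasStrictFDerivAt_iff_isLittleO.1 (hA x hx))
    rw [ContinuousAt, Metric.tendsto_nhds]
    intro ε hε
    simp only [if_true, hx, dif_pos]
    set c := ε / 2 / (‖y‖ + 1) with hc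
    have hy0 : 0 < ‖y‖ + 1 := by positivity
    have hc0 : 0 < c := by positivity
    have h1 := Asymptotics.isLittleO_iff.1 hs hc0
    have h2 : Tendsto (fun q : E × E × 𝕜 => (q.1 + q.2.2 • q.2.1, q.1)) (𝓝 (x, y, 0))
        (𝓝 (x, x)) := by
      have : Continuous (fun q : E × E × 𝕜 => (q.1 + q.2.2 • q.2.1, q.1)) := by fun_prop
      simpa using this.tendsto (x, y, 0)
    have h3 := h2.eventually h1
    have h4 : ∀ᶠ q : E × E × 𝕜 in 𝓝 (x, y, 0), ‖q.2.1‖ < ‖y‖ + 1 := by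
      have : Continuous fun q : E × E × 𝕜 => ‖q.2.1‖ := by fun_prop
      exact (this.tendsto (x, y, 0)).eventually (gt_mem_nhds (by simp))
    have h5 : ∀ᶠ q : E × E × 𝕜 in 𝓝 (x, y, 0), ‖A x hx q.2.1 - A x hx y‖ < ε / 2 := by
      have : Continuous fun q : E × E × 𝕜 => ‖A x hx q.2.1 - A x hx y‖ := by fun_prop
      exact (this.tendsto (x, y, 0)).eventually (gt_mem_nhds (by simpa using half_pos hε))
    have hlin : ∀ a b : E, ∀ s : 𝕜, s ≠ 0 →
        ‖f (a + s • b) - f a - A x hx (a + s • b - a)‖ ≤ c * ‖a + s • b - a‖ →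
        ‖s⁻¹ • (f (a + s • b) - f a) - A x hx b‖ ≤ c * ‖b‖ := by
      intro a b s hs hle
      rw [add_sub_cancel_left, map_smul, norm_smul] at hle
      have : s⁻¹ • (f (a + s • b) - f a) - A x hx b
          = s⁻¹ • (f (a + s • b) - f a - s • A x hx b) := by
        rw [smul_sub _ _ (s • A x hx b), smul_smul _ _ (A x hx b), inv_mul_cancel₀ hs, one_smul]
      rw [this, norm_smul, norm_inv]
      calc _ ≤ ‖s‖⁻¹ * (c * (‖s‖ * ‖b‖)) := by gcongr
        _ = c * ‖b‖ := by have := norm_ne_zero_iff.2 hs; field_simp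
    -- Continuity of the derivative comes for free: `A a b` is a limit of slopes at `a`, and each of
    -- these lies within `c ‖b‖` of `A x b`.
    have h6 : ∀ᶠ q : E × E × 𝕜 in 𝓝 (x, y, 0), ∀ h : q.1 ∈ U, q.2.2 = 0 →
        ‖A q.1 h q.2.1 - A x hx q.2.1‖ ≤ c * ‖q.2.1‖ := by
      filter_upwards [h3.eventually_nhds, hU.eventually_mem hx |>.prod_inl_nhds (y, (0 : 𝕜))]
        with q hq hqU h hq0
      obtain ⟨a, b, s⟩ := q
      simp only at h hq0
      subst hq0
      have hlim : Tendsto (fun s : 𝕜 => s⁻¹ • (f (a + s • b) - f a)) (𝓝[≠] 0)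
          (𝓝 (A a h b)) := by
        have := ((hA a h).hasFDerivAt.hasLineDerivAt b).tendsto_slope_zero
        simpa using this
      have hlim2 := (hlim.sub_const (A x hx b)).norm
      refine le_of_tendsto hlim2 ?_
      have h7 : Tendsto (fun s : 𝕜 => (a, b, s)) (𝓝[≠] 0) (𝓝 (a, b, 0)) := by
        have : Continuous fun s : 𝕜 => (a, b, s) := by fun_prop
        exact (this.tendsto 0).mono_left nhdsWithin_le_nhds
      filter_upwards [h7.eventually hq, self_mem_nhdsWithin] with s hs hs0
      exact hlin a b s hs0 hs
    filter_upwards [h3, h4, h5, h6, hU.eventually_mem hx |>.prod_inl_nhds (y, (0 : 𝕜))]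
      with q hq3 hq4 hq5 hq6 hqU
    obtain ⟨a, b, s⟩ := q
    simp only at hq3 hq4 hq5 hq6 hqU ⊢
    have main : ‖(if s = 0 then (if h : a ∈ U then A a h b else 0)
        else s⁻¹ • (f (a + s • b) - f a)) - A x hx b‖ ≤ c * ‖b‖ := by
      split_ifs with hs
      · exact hq6 hqU hs
      · exact hlin a b s hs hq3
    rw [dist_eq_norm]
    calc _ ≤ _ := norm_sub_le_norm_sub_add_norm_sub _ (A x hx b) _
      _ < c * ‖b‖ + ε / 2 := add_lt_add_of_le_of_lt main hq5
      _ ≤ c * (‖y‖ + 1) + ε / 2 := by gcongr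
      _ = ε := by rw [hc]; field_simp; ring
  · have hev : ∀ᶠ q : E × E × 𝕜 in 𝓝 (x, y, t), q.2.2 ≠ 0 := by
      have : Continuous fun q : E × E × 𝕜 => q.2.2 := by fun_prop
      exact (this.tendsto (x, y, t)).eventually (isOpen_ne.mem_nhds ht)
    have h1 : ContinuousAt f x := (hA x hx).continuousAt
    have h2 : ContinuousAt f (x + t • y) := (hA _ hxt).continuousAt
    have h3 : ContinuousAt (fun q : E × E × 𝕜 =>
        q.2.2⁻¹ • (f (q.1 + q.2.2 • q.2.1) - f q.1)) (x, y, t) := by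
      refine ContinuousAt.smul ?_ (ContinuousAt.sub ?_ ?_)
      · exact ContinuousAt.inv₀ (by fun_prop) ht
      · exact ContinuousAt.comp (f := fun q : E × E × 𝕜 => q.1 + q.2.2 • q.2.1)
          (x := (x, y, t)) h2 (by fun_prop)
      · exact ContinuousAt.comp (f := fun q : E × E × 𝕜 => q.1)
          (x := (x, y, t)) h1 (by fun_prop)
    refine h3.congr ?_
    filter_upwards [hev] with q hq
    rw [if_neg hq]

end Calculus

/-! ### Class `C^{k₊}` implies `SC^1`. -/

section Padic

variable {p : ℕ} [Fact p.Prime] {k : ℕ∞}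

/-- Maps of class `C^{k₊}` with `k ≥ 1` are strictly differentiable. -/
theorem IsCk.isSC1 (hk : 1 ≤ k) {E₀ : Type w} [NormedAddCommGroup E₀] [NormedSpace ℚ_[p] E₀]
    {E : Type u} [NormedAddCommGroup E] [NormedSpace ℚ_[p] E]
    (hfd : FiniteDimensional ℚ_[p] E₀ → FiniteDimensional ℚ_[p] E)
    {F : Type v} [NormedAddCommGroup F] [NormedSpace ℚ_[p] F] {f : E → F} {U : Set E}
    (hU : IsOpen U) (hf : IsCk ℚ_[p] (kPlus p k E₀) f U) : IsSC1 ℚ_[p] f U := by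
  by_cases h : FiniteDimensional ℚ_[p] E₀
  · have := hfd h
    have : ProperSpace E := FiniteDimensional.proper ℚ_[p] E
    refine IsCn.isSC1_of_properSpace hU (hf 1 ?_)
    simpa [kPlus, h] using hk
  · refine IsCn.isSC1_of_two hU (hf 2 ?_)
    rw [kPlus, if_neg h]
    calc ((2 : ℕ) : ℕ∞) = 1 + 1 := by norm_num
      _ ≤ k + 1 := by gcongr

section LieGroup

variable {E : Type u} [NormedAddCommGroup E] [NormedSpace ℚ_[p] E]
    {G : Type v} [Group G] [TopologicalSpace G] [IsTopologicalGroup G] [ChartedSpace E G]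

theorem IsCkLieGroup.isSC1LieGroup (hk : 1 ≤ k) (hG : IsCkLieGroup ℚ_[p] (kPlus p k E) E G) :
    IsSC1LieGroup ℚ_[p] E G where
  compatible e he e' he' := by
    refine (hG.compatible e he e' he').isSC1 hk id ?_
    exact e.isOpen_inter_preimage_symm e'.open_source
  mul e₁ h₁ e₂ h₂ e₃ h₃ := by
    refine (hG.mul e₁ h₁ e₂ h₂ e₃ h₃).isSC1 hk (fun h => inferInstance) ?_
    have h1 : ContinuousOn (fun q : E × E => e₁.symm q.1 * e₂.symm q.2)
        (e₁.target ×ˢ e₂.target) :=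
      (e₁.continuousOn_symm.comp continuousOn_fst fun q hq => hq.1).mul
        (e₂.continuousOn_symm.comp continuousOn_snd fun q hq => hq.2)
    have h2 : {q : E × E | q.1 ∈ e₁.target ∧ q.2 ∈ e₂.target ∧ e₁.symm q.1 * e₂.symm q.2 ∈ e₃.source}
        = e₁.target ×ˢ e₂.target ∩ (fun q : E × E => e₁.symm q.1 * e₂.symm q.2) ⁻¹' e₃.source := by
      ext q
      simp [and_assoc]
    rw [h2]
    exact h1.isOpen_inter_preimage (e₁.open_target.prod e₂.open_target) e₃.open_source
  inv e he e' he' := by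
    refine (hG.inv e he e' he').isSC1 hk id ?_
    exact e.continuousOn_symm.inv.isOpen_inter_preimage e.open_target e'.open_source

end LieGroup

end Padic

end PadicLie

namespace PadicLie

universe u v w

/-! ### Products and powers under the multiplication estimate. -/

section MulEstimate

variable {E : Type u} [NormedAddCommGroup E] {G : Type v} [Group G] [TopologicalSpace G]

/-- On the elements of `φ.source` whose coordinates have norm less than `s`, the multiplication
is `ε`-close to addition in the coordinates `φ`. -/
def MulEstimate (φ : OpenPartialHomeomorph G E) (ε s : ℝ) : Prop :=
  ∀ g ∈ φ.source, ∀ g' ∈ φ.source, ∀ h ∈ φ.source, ∀ h' ∈ φ.source,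
    ‖φ g‖ < s → ‖φ g'‖ < s → ‖φ h‖ < s → ‖φ h'‖ < s →
    g * h ∈ φ.source ∧
      ‖φ (g * h) - φ (g' * h') - (φ g - φ g') - (φ h - φ h')‖ ≤
        ε * max ‖φ g - φ g'‖ ‖φ h - φ h'‖

variable {φ : OpenPartialHomeomorph G E} {ε s : ℝ}

theorem MulEstimate.norm_sub_sub_le (H : MulEstimate φ ε s) (h1 : (1 : G) ∈ φ.source)
    (hφ1 : φ 1 = 0) {g h : G} (hg : g ∈ φ.source) (hh : h ∈ φ.source)
    (hgs : ‖φ g‖ < s) (hhs : ‖φ h‖ < s) :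
    g * h ∈ φ.source ∧ ‖φ (g * h) - φ g - φ h‖ ≤ ε * max ‖φ g‖ ‖φ h‖ := by
  have hs : ‖φ (1 : G)‖ < s := by rw [hφ1, norm_zero]; exact (norm_nonneg _).trans_lt hgs
  have := H g hg 1 h1 h hh 1 h1 hgs hs hhs hs
  simpa [hφ1] using this

variable [IsUltrametricDist E]

theorem MulEstimate.norm_mul_le (H : MulEstimate φ ε s) (hε : ε ≤ 1) (h1 : (1 : G) ∈ φ.source)
    (hφ1 : φ 1 = 0) {g h : G} (hg : g ∈ φ.source) (hh : h ∈ φ.source)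
    (hgs : ‖φ g‖ < s) (hhs : ‖φ h‖ < s) : ‖φ (g * h)‖ ≤ max ‖φ g‖ ‖φ h‖ := by
  have h2 := (H.norm_sub_sub_le h1 hφ1 hg hh hgs hhs).2
  have h3 : ε * max ‖φ g‖ ‖φ h‖ ≤ max ‖φ g‖ ‖φ h‖ :=
    mul_le_of_le_one_left (le_max_of_le_left (norm_nonneg _)) hε
  have e : φ (g * h) = φ (g * h) - φ g - φ h + (φ g + φ h) := by abel
  rw [e]
  exact (IsUltrametricDist.norm_add_le_max _ _).trans
    (max_le (h2.trans h3) (IsUltrametricDist.norm_add_le_max _ _))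

theorem MulEstimate.pow (H : MulEstimate φ ε s) (hε : ε ≤ 1) (h1 : (1 : G) ∈ φ.source)
    (hφ1 : φ 1 = 0) {g : G} (hg : g ∈ φ.source) (hgs : ‖φ g‖ < s) (m : ℕ) :
    g ^ m ∈ φ.source ∧ ‖φ (g ^ m)‖ ≤ ‖φ g‖ := by
  induction m with
  | zero => simp [h1, hφ1]
  | succ m ih =>
    have hm := ih.2.trans_lt hgs
    rw [pow_succ]
    refine ⟨(H.norm_sub_sub_le h1 hφ1 ih.1 hg hm hgs).1, ?_⟩
    exact (H.norm_mul_le hε h1 hφ1 ih.1 hg hm hgs).trans (max_le ih.2 le_rfl)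

/-- Induction on `m`: each further factor contributes an error of at most `ε ‖φ g - φ h‖`, and the
ultrametric inequality replaces the sum of the errors by their maximum. The constant is thus
independent of `m`. -/
theorem MulEstimate.pow_sub {p : ℕ} [Fact p.Prime] [NormedSpace ℚ_[p] E]
    (H : MulEstimate φ ε s) (hε0 : 0 ≤ ε) (hε : ε ≤ 1)
    (h1 : (1 : G) ∈ φ.source)
    (hφ1 : φ 1 = 0) {g h : G} (hg : g ∈ φ.source) (hgs : ‖φ g‖ < s)
    (hh : h ∈ φ.source) (hhs : ‖φ h‖ < s) (m : ℕ) :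
    ‖φ (g ^ m) - φ (h ^ m) - (m : ℚ_[p]) • (φ g - φ h)‖ ≤ ε * ‖φ g - φ h‖ := by
  induction m with
  | zero => simpa using by positivity
  | succ m ih =>
    obtain ⟨hg1, hg2⟩ := H.pow hε h1 hφ1 hg hgs m
    obtain ⟨hh1, hh2⟩ := H.pow hε h1 hφ1 hh hhs m
    have h3 := (H _ hg1 _ hh1 _ hg _ hh (hg2.trans_lt hgs) (hh2.trans_lt hhs) hgs hhs).2
    have h4 : ‖φ (g ^ m) - φ (h ^ m)‖ ≤ ‖φ g - φ h‖ := by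
      have e : φ (g ^ m) - φ (h ^ m) =
        (φ (g ^ m) - φ (h ^ m) - (m : ℚ_[p]) • (φ g - φ h)) + (m : ℚ_[p]) • (φ g - φ h) := by
          abel
      rw [e]
      refine (IsUltrametricDist.norm_add_le_max _ _).trans (max_le ?_ ?_)
      · exact ih.trans (mul_le_of_le_one_left (norm_nonneg _) hε)
      · rw [norm_smul]
        exact mul_le_of_le_one_left (norm_nonneg _) (IsUltrametricDist.norm_natCast_le_one ℚ_[p] m)
    rw [max_eq_right h4] at h3
    have e : φ (g ^ (m + 1)) - φ (h ^ (m + 1)) - ((m + 1 : ℕ) : ℚ_[p]) • (φ g - φ h) =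
        (φ (g ^ m * g) - φ (h ^ m * h) - (φ (g ^ m) - φ (h ^ m)) - (φ g - φ h)) +
        (φ (g ^ m) - φ (h ^ m) - (m : ℚ_[p]) • (φ g - φ h)) := by
      rw [pow_succ, pow_succ]
      push_cast
      rw [add_smul, one_smul]
      abel
    rw [e]
    exact (IsUltrametricDist.norm_add_le_max _ _).trans (max_le h3 ih)

end MulEstimate

/-! ### The multiplication estimate from strict differentiability. -/

section Chart

variable {𝕜 : Type} [NontriviallyNormedField 𝕜] {E : Type u} [NormedAddCommGroup E]
  [NormedSpace 𝕜 E] {G : Type v} [Group G] [TopologicalSpace G]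

theorem tendsto_symm_zero {φ : OpenPartialHomeomorph G E}
    (h1 : (1 : G) ∈ φ.source) (hφ1 : φ 1 = 0) : Tendsto φ.symm (𝓝 0) (𝓝 1) := by
  have h0 : (0 : E) ∈ φ.target := hφ1 ▸ φ.map_source h1
  have := (φ.continuousAt_symm h0).tendsto
  rwa [← hφ1, φ.left_inv h1, hφ1] at this

theorem symm_zero_eq_one {φ : OpenPartialHomeomorph G E}
    (h1 : (1 : G) ∈ φ.source) (hφ1 : φ 1 = 0) : φ.symm 0 = 1 := by
  rw [← hφ1, φ.left_inv h1]

variable [IsTopologicalGroup G]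

/-- Conjugating the multiplication by chart changes shows that some strict derivative exists. It
must be addition, since multiplication by `1` on either side is the identity and so determines the
derivative on both axes. -/
theorem hasStrictFDerivAt_mul_zero [ChartedSpace E G] (hG : IsSC1LieGroup 𝕜 E G)
    {φ : OpenPartialHomeomorph G E} (h1 : (1 : G) ∈ φ.source) (hφ1 : φ 1 = 0) {A B : E →L[𝕜] E}
    (hA : HasStrictFDerivAt (fun y => φ ((chartAt E (1 : G)).symm y)) A (chartAt E (1 : G) 1))
    (hB : HasStrictFDerivAt (fun y => chartAt E (1 : G) (φ.symm y)) B 0) :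
    HasStrictFDerivAt (fun q : E × E => φ (φ.symm q.1 * φ.symm q.2))
      (ContinuousLinearMap.fst 𝕜 E E + ContinuousLinearMap.snd 𝕜 E E) (0, 0) := by
  set c := chartAt E (1 : G) with hc
  have hca : c ∈ atlas E G := chart_mem_atlas E 1
  have hc1 : (1 : G) ∈ c.source := mem_chart_source E 1
  have h0 : (0 : E) ∈ φ.target := hφ1 ▸ φ.map_source h1
  have hs0 := symm_zero_eq_one h1 hφ1
  have hts := tendsto_symm_zero h1 hφ1
  obtain ⟨M, hM⟩ := hG.mul c hca c hca c hca (c 1, c 1)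
    ⟨c.map_source hc1, c.map_source hc1, by simpa [c.left_inv hc1] using hc1⟩
  have hB2 : HasStrictFDerivAt (fun q : E × E => (c (φ.symm q.1), c (φ.symm q.2)))
      (B.prodMap B) (0, 0) := hB.prodMap (0, 0) hB
  have hM' : HasStrictFDerivAt (fun q : E × E => c (c.symm q.1 * c.symm q.2)) M
      ((fun q : E × E => (c (φ.symm q.1), c (φ.symm q.2))) (0, 0)) := by
    simpa only [hs0] using hM
  have h3 := hM'.comp (0, 0) hB2
  have hA' : HasStrictFDerivAt (fun y => φ (c.symm y)) A
      (((fun q : E × E => c (c.symm q.1 * c.symm q.2)) ∘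
        (fun q : E × E => (c (φ.symm q.1), c (φ.symm q.2)))) (0, 0)) := by
    simpa only [Function.comp, hs0, c.left_inv hc1, mul_one] using hA
  have h4 := hA'.comp (0, 0) h3
  have hfst : Tendsto (fun q : E × E => φ.symm q.1) (𝓝 (0, 0)) (𝓝 1) :=
    hts.comp (continuous_fst.tendsto (0, 0))
  have hsnd : Tendsto (fun q : E × E => φ.symm q.2) (𝓝 (0, 0)) (𝓝 1) :=
    hts.comp (continuous_snd.tendsto (0, 0))
  have hmul : Tendsto (fun q : E × E => φ.symm q.1 * φ.symm q.2) (𝓝 (0, 0)) (𝓝 1) := by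
    simpa using hfst.mul hsnd
  have hcn : c.source ∈ 𝓝 (1 : G) := c.open_source.mem_nhds hc1
  have h5 : HasStrictFDerivAt (fun q : E × E => φ (φ.symm q.1 * φ.symm q.2))
      (A.comp (M.comp (B.prodMap B))) (0, 0) := by
    refine h4.congr_of_eventuallyEq ?_
    filter_upwards [hfst hcn, hsnd hcn, hmul hcn] with q hq1 hq2 hq3
    simp only [Function.comp]
    rw [c.left_inv hq1, c.left_inv hq2, c.left_inv hq3]
  have hφt : φ.target ∈ 𝓝 (0 : E) := φ.open_target.mem_nhds h0
  have hinl : HasFDerivAt (fun y : E => φ (φ.symm y * φ.symm 0)) (ContinuousLinearMap.id 𝕜 E) 0 := by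
    refine (hasFDerivAt_id (0 : E)).congr_of_eventuallyEq ?_
    filter_upwards [hφt] with y hy
    rw [hs0, mul_one, φ.right_inv hy, id]
  have hinr : HasFDerivAt (fun y : E => φ (φ.symm 0 * φ.symm y)) (ContinuousLinearMap.id 𝕜 E) 0 := by
    refine (hasFDerivAt_id (0 : E)).congr_of_eventuallyEq ?_
    filter_upwards [hφt] with y hy
    rw [hs0, one_mul, φ.right_inv hy, id]
  have u1 := (HasFDerivAt.comp (f := fun e : E => (e, (0 : E))) (0 : E) h5.hasFDerivAt
    (hasFDerivAt_prodMk_left (𝕜 := 𝕜) (0 : E) (0 : E))).unique hinl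
  have u2 := (HasFDerivAt.comp (f := fun e : E => ((0 : E), e)) (0 : E) h5.hasFDerivAt
    (hasFDerivAt_prodMk_right (𝕜 := 𝕜) (0 : E) (0 : E))).unique hinr
  convert h5 using 1
  ext y
  · have := DFunLike.congr_fun u1 y
    simpa using this.symm
  · have := DFunLike.congr_fun u2 y
    simpa using this.symm

theorem exists_mulEstimate [ChartedSpace E G] (hG : IsSC1LieGroup 𝕜 E G)
    {φ : OpenPartialHomeomorph G E} (h1 : (1 : G) ∈ φ.source) (hφ1 : φ 1 = 0) {A B : E →L[𝕜] E}
    (hA : HasStrictFDerivAt (fun y => φ ((chartAt E (1 : G)).symm y)) A (chartAt E (1 : G) 1))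
    (hB : HasStrictFDerivAt (fun y => chartAt E (1 : G) (φ.symm y)) B 0) {ε : ℝ} (hε : 0 < ε) :
    ∃ s > 0, MulEstimate φ ε s := by
  have h := hasStrictFDerivAt_mul_zero hG h1 hφ1 hA hB
  have h2 := Asymptotics.isLittleO_iff.1 (hasStrictFDerivAt_iff_isLittleO.1 h) hε
  have hts := tendsto_symm_zero h1 hφ1
  have hfst : Tendsto (fun q : E × E => φ.symm q.1) (𝓝 (0, 0)) (𝓝 1) :=
    hts.comp (continuous_fst.tendsto (0, 0))
  have hsnd : Tendsto (fun q : E × E => φ.symm q.2) (𝓝 (0, 0)) (𝓝 1) :=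
    hts.comp (continuous_snd.tendsto (0, 0))
  have hmul : Tendsto (fun q : E × E => φ.symm q.1 * φ.symm q.2) (𝓝 (0, 0)) (𝓝 1) := by
    simpa using hfst.mul hsnd
  have h3 := hmul (φ.open_source.mem_nhds h1)
  obtain ⟨s, hs, H1⟩ := Metric.eventually_nhds_iff_ball.1 h2
  obtain ⟨s', hs', H2⟩ := Metric.eventually_nhds_iff_ball.1 h3
  refine ⟨min s s', by positivity, fun g hg g' hg' k hk k' hk' n1 n2 n3 n4 => ?_⟩
  rw [lt_min_iff] at n1 n2 n3 n4
  constructor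
  · have := H2 (φ g, φ k) (by
      rw [← ball_prod_same]; exact ⟨by simpa using n1.2, by simpa using n3.2⟩)
    simpa [φ.left_inv hg, φ.left_inv hk] using this
  · have := H1 ((φ g, φ k), (φ g', φ k')) (by
      rw [← ball_prod_same, ← ball_prod_same]
      exact ⟨⟨by simpa using n1.1, by simpa using n3.1⟩, ⟨by simpa using n2.1, by simpa using n4.1⟩⟩)
    simp only [φ.left_inv hg, φ.left_inv hk, φ.left_inv hg', φ.left_inv hk', Prod.norm_def] at this
    rw [sub_sub]
    exact this

end Chart

end PadicLie

namespace PadicLie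

universe u v w

/-! ### Ultrametric perturbations of the identity. -/

section Perturbation

variable {E : Type u} [NormedAddCommGroup E] [IsUltrametricDist E]

theorem norm_eq_of_norm_sub_le {a b : E} {ε : ℝ} (hε : ε < 1) (h : ‖a - b‖ ≤ ε * ‖b‖) :
    ‖a‖ = ‖b‖ := by
  rcases eq_or_ne b 0 with rfl | hb
  · have : a = 0 := by simpa using h
    rw [this]
  have hb0 : 0 < ‖b‖ := norm_pos_iff.2 hb
  have h1 : ‖a - b‖ < ‖b‖ := h.trans_lt (by nlinarith)
  have h2 := IsUltrametricDist.norm_add_eq_max_of_norm_ne_norm (x := a - b) (y := b) h1.ne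
  rwa [sub_add_cancel, max_eq_right h1.le] at h2

/-- In an ultrametric Banach space, a small Lipschitz perturbation of the identity maps
each ball around `0` onto itself. -/
theorem image_ball_eq_of_perturbation [CompleteSpace E] {f : E → E} {r : ℝ} (hr : 0 < r)
    (hf0 : f 0 = 0)
    (hf : ∀ x ∈ ball (0 : E) r, ∀ y ∈ ball (0 : E) r,
      ‖f x - f y - (x - y)‖ ≤ 1 / 2 * ‖x - y‖) :
    f '' ball (0 : E) r = ball 0 r := by
  have h0 : (0 : E) ∈ ball (0 : E) r := mem_ball_self hr
  have hiso : ∀ x ∈ ball (0 : E) r, ‖f x‖ = ‖x‖ := fun x hx =>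
    norm_eq_of_norm_sub_le (by norm_num : (1 / 2 : ℝ) < 1)
      (by simpa [hf0] using hf x hx 0 h0)
  refine Subset.antisymm ?_ fun z hz => ?_
  · rintro _ ⟨x, hx, rfl⟩
    rw [mem_ball_zero_iff, hiso x hx]
    exact mem_ball_zero_iff.1 hx
  -- Preimages of `z` under `f` are the fixed points of `T`, which is a `1/2`-contraction of the
  -- ball; balls are closed, hence complete.
  set T : E → E := fun x => z - (f x - x) with hT
  have hmaps : MapsTo T (ball 0 r) (ball 0 r) := fun x hx => by
    have h1 : ‖f x - x‖ ≤ 1 / 2 * ‖x‖ := by simpa [hf0] using hf x hx 0 h0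
    rw [mem_ball_zero_iff] at hx hz ⊢
    have h2 : ‖z - (f x - x)‖ ≤ max ‖z‖ ‖f x - x‖ := by
      have := IsUltrametricDist.norm_add_le_max z (-(f x - x))
      rwa [← sub_eq_add_neg, norm_neg] at this
    refine h2.trans_lt (max_lt hz (h1.trans_lt ?_))
    have := norm_nonneg x
    linarith
  have hcomp : IsComplete (ball (0 : E) r) :=
    (IsUltrametricDist.isClosed_ball (0 : E) r).isComplete
  have hK : ContractingWith (1 / 2 : NNReal) (hmaps.restrict T (ball 0 r) (ball 0 r)) := by
    refine ⟨by norm_num [← NNReal.coe_lt_coe], LipschitzWith.of_dist_le_mul fun x y => ?_⟩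
    rw [Subtype.dist_eq, Subtype.dist_eq, dist_eq_norm, dist_eq_norm]
    have e : T x.1 - T y.1 = -(f x.1 - f y.1 - (x.1 - y.1)) := by
      simp only [hT]
      abel
    simp only [MapsTo.val_restrict_apply]
    rw [e, norm_neg]
    simpa using hf x.1 x.2 y.1 y.2
  obtain ⟨x, hx, hfix, -⟩ := hK.exists_fixedPoint' hcomp hmaps h0 (edist_ne_top _ _)
  refine ⟨x, hx, ?_⟩
  have h3 : z - (f x - x) = x := hfix
  have h4 : z = x + (f x - x) := sub_eq_iff_eq_add.1 h3
  rw [h4]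
  abel

end Perturbation

section MulEstimate

variable {E : Type u} [NormedAddCommGroup E] [IsUltrametricDist E] {G : Type v} [Group G]
  [TopologicalSpace G] {φ : OpenPartialHomeomorph G E} {ε s : ℝ}

theorem MulEstimate.norm_mul_sub_mul_le (H : MulEstimate φ ε s) (hε : ε ≤ 1) {g g' h h' : G}
    (hg : g ∈ φ.source) (hg' : g' ∈ φ.source) (hh : h ∈ φ.source) (hh' : h' ∈ φ.source)
    (hgs : ‖φ g‖ < s) (hgs' : ‖φ g'‖ < s) (hhs : ‖φ h‖ < s) (hhs' : ‖φ h'‖ < s) :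
    ‖φ (g * h) - φ (g' * h')‖ ≤ max ‖φ g - φ g'‖ ‖φ h - φ h'‖ := by
  have h2 := (H g hg g' hg' h hh h' hh' hgs hgs' hhs hhs').2
  have h3 : ε * max ‖φ g - φ g'‖ ‖φ h - φ h'‖ ≤ max ‖φ g - φ g'‖ ‖φ h - φ h'‖ :=
    mul_le_of_le_one_left (le_max_of_le_left (norm_nonneg _)) hε
  have e : φ (g * h) - φ (g' * h') =
      φ (g * h) - φ (g' * h') - (φ g - φ g') - (φ h - φ h') + ((φ g - φ g') + (φ h - φ h')) := by
    abel
  rw [e]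
  exact (IsUltrametricDist.norm_add_le_max _ _).trans
    (max_le (h2.trans h3) (IsUltrametricDist.norm_add_le_max _ _))

/-- From `g g⁻¹ = 1`, the sum `φ g + φ g⁻¹` has norm at most `ε` times the larger of the two norms.
If `‖φ g⁻¹‖` were strictly larger, the ultrametric inequality would be violated. -/
theorem MulEstimate.norm_inv_le (H : MulEstimate φ ε s) (hε : ε < 1) (h1 : (1 : G) ∈ φ.source)
    (hφ1 : φ 1 = 0) {g : G} (hg : g ∈ φ.source) (hgi : g⁻¹ ∈ φ.source)
    (hgs : ‖φ g‖ < s) (hgis : ‖φ g⁻¹‖ < s) : ‖φ g⁻¹‖ ≤ ‖φ g‖ := by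
  have h2 := (H.norm_sub_sub_le h1 hφ1 hg hgi hgs hgis).2
  rw [mul_inv_cancel, hφ1, zero_sub] at h2
  by_contra! hlt
  rw [max_eq_right hlt.le] at h2
  have h3 : ‖φ g⁻¹‖ ≤ max ‖-φ g - φ g⁻¹‖ ‖φ g‖ := by
    have e : φ g⁻¹ = -((-φ g - φ g⁻¹) + φ g) := by abel
    calc ‖φ g⁻¹‖ = ‖(-φ g - φ g⁻¹) + φ g‖ := by rw [← norm_neg ((-φ g - φ g⁻¹) + φ g), ← e]
      _ ≤ _ := IsUltrametricDist.norm_add_le_max _ _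
  have hpos : 0 < ‖φ g⁻¹‖ := (norm_nonneg _).trans_lt hlt
  refine absurd h3 (not_le.2 (max_lt (h2.trans_lt ?_) hlt))
  nlinarith

end MulEstimate

theorem exists_restrict_target {E : Type u} {G : Type v} [TopologicalSpace E]
    [TopologicalSpace G] (φ₀ : OpenPartialHomeomorph G E) {B : Set E} (hB : IsOpen B)
    (hBt : B ⊆ φ₀.target) :
    ∃ φ : OpenPartialHomeomorph G E, φ.source = φ₀.source ∩ φ₀ ⁻¹' B ∧ φ.target = B ∧
      (∀ g, φ g = φ₀ g) ∧ ∀ x, φ.symm x = φ₀.symm x := by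
  refine ⟨(φ₀.symm.restrOpen B hB).symm, ?_, ?_, fun g => rfl, fun x => rfl⟩
  · ext g
    simp
  · simpa using hBt

/-! ### Existence of adapted charts. -/

section Existence

variable {p : ℕ} [Fact p.Prime] {k : ℕ∞} {E : Type u} [NormedAddCommGroup E] [NormedSpace ℚ_[p] E]
    {G : Type v} [Group G] [TopologicalSpace G] [IsTopologicalGroup G] [ChartedSpace E G]

theorem ckMapOn_translated_chart {k : ℕ∞} (hG : IsCkLieGroup ℚ_[p] k E G) {f : G → E} {s : Set G}
    {c : OpenPartialHomeomorph G E} (hc : c ∈ atlas E G) (a : E) (hs : s ⊆ c.source)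
    (hf : ∀ g, f g = c g - a) : CkMapOn ℚ_[p] k E E f s := by
  have hfe : f = fun g => c g - a := funext hf
  refine ⟨?_, fun e he e' he' n hn => ?_⟩
  · rw [hfe]
    exact (c.continuousOn.mono hs).sub continuousOn_const
  · rw [chartedSpaceSelf_atlas] at he'
    subst he'
    refine isCn_congr (((hG.compatible e he c hc n hn).add_const (-a)).mono ?_) ?_
    · exact fun y hy => ⟨hy.1, hs hy.2.1⟩
    · intro y _
      simp [hfe, sub_eq_add_neg]

theorem ckMapOn_translated_chart_symm {k : ℕ∞} (hG : IsCkLieGroup ℚ_[p] k E G) {f : E → G}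
    {s : Set E} {c : OpenPartialHomeomorph G E} (hc : c ∈ atlas E G) (a : E)
    (hs : ∀ x ∈ s, x + a ∈ c.target) (hf : ∀ x, f x = c.symm (x + a)) :
    CkMapOn ℚ_[p] k E E f s := by
  have hfe : f = fun x => c.symm (x + a) := funext hf
  refine ⟨?_, fun e he e' he' n hn => ?_⟩
  · rw [hfe]
    exact c.continuousOn_symm.comp (by fun_prop) hs
  · rw [chartedSpaceSelf_atlas] at he
    subst he
    refine isCn_congr (((hG.compatible c hc e' he' n hn).comp_add_right a).mono ?_) ?_
    · intro y hy
      refine ⟨hs y hy.2.1, ?_⟩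
      have := hy.2.2
      rwa [hfe] at this
    · intro y _
      simp [hfe]

variable [CompleteSpace E] [IsUltrametricDist E]

/-- The chart at `1`, translated to send `1` to `0`, is restricted to a small ball. The estimate
makes the preimage of the ball a subgroup and makes both translations nonexpansive, which yields the
coset conditions. The freedom to place `U` inside a given neighbourhood serves the comparison of two
Lie group structures. -/
theorem exists_adaptedChart (hk : 1 ≤ k) (hG : IsCkLieGroup ℚ_[p] (kPlus p k E) E G)
    {N : Set G} (hN : N ∈ 𝓝 (1 : G)) : ∃ D : AdaptedChart p k E G, (D.U : Set G) ⊆ N := by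
  set c := chartAt E (1 : G) with hc
  have hca : c ∈ atlas E G := chart_mem_atlas E 1
  have hc1 : (1 : G) ∈ c.source := mem_chart_source E 1
  set φ₀ : OpenPartialHomeomorph G E := c.transHomeomorph (Homeomorph.subRight (c 1)) with hφ₀
  have hcoe : ∀ g, φ₀ g = c g - c 1 := fun g => rfl
  have hsymm : ∀ x, φ₀.symm x = c.symm (x + c 1) := fun x => rfl
  have h1 : (1 : G) ∈ φ₀.source := hc1
  have hφ1 : φ₀ 1 = 0 := by rw [hcoe, sub_self]
  have hct : c.target ∈ 𝓝 (c 1) := c.open_target.mem_nhds (c.map_source hc1)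
  have hA : HasStrictFDerivAt (fun y => φ₀ (c.symm y)) (ContinuousLinearMap.id ℚ_[p] E) (c 1) := by
    refine ((hasStrictFDerivAt_id (𝕜 := ℚ_[p]) (c 1)).sub_const (c 1)).congr_of_eventuallyEq ?_
    filter_upwards [hct] with y hy
    rw [hcoe, c.right_inv hy, id]
  have hB : HasStrictFDerivAt (fun y => c (φ₀.symm y)) (ContinuousLinearMap.id ℚ_[p] E) 0 := by
    refine ((hasStrictFDerivAt_id (𝕜 := ℚ_[p]) (0 : E)).add_const (c 1)).congr_of_eventuallyEq ?_
    have : Tendsto (fun y : E => y + c 1) (𝓝 0) (𝓝 (c 1)) := by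
      have h : Continuous fun y : E => y + c 1 := by fun_prop
      simpa using h.tendsto 0
    filter_upwards [this hct] with y hy
    rw [hsymm, c.right_inv hy, id]
  have hp0 : (p : ℚ_[p]) ≠ 0 := by exact_mod_cast (Fact.out : p.Prime).ne_zero
  have hpn : 0 < ‖(p : ℚ_[p])‖ := norm_pos_iff.2 hp0
  have hp1 : ‖(p : ℚ_[p])‖ ≤ 1 := IsUltrametricDist.norm_natCast_le_one ℚ_[p] p
  -- The factor `‖p‖` is lost on dividing the `p`-th power map by `p`, which leaves the perturbation
  -- constant `1/2`.
  obtain ⟨s, hs, H⟩ := exists_mulEstimate (hG.isSC1LieGroup hk) h1 hφ1 hA hB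
    (ε := ‖(p : ℚ_[p])‖ / 2) (by positivity)
  have hε1 : ‖(p : ℚ_[p])‖ / 2 < 1 := by linarith
  have h0t : φ₀.target ∈ 𝓝 (0 : E) := φ₀.open_target.mem_nhds (hφ1 ▸ φ₀.map_source h1)
  obtain ⟨R, hR, hRt⟩ := Metric.mem_nhds_iff.1 h0t
  have hts := tendsto_symm_zero h1 hφ1
  have hti : Tendsto (fun x => (φ₀.symm x)⁻¹) (𝓝 0) (𝓝 1) := by simpa using hts.inv
  have htφ : Tendsto (fun x => ‖φ₀ (φ₀.symm x)⁻¹‖) (𝓝 0) (𝓝 0) := by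
    have := ((φ₀.continuousAt h1).tendsto.comp hti).norm
    simpa [hφ1] using this
  have hev : ∀ᶠ x in 𝓝 (0 : E), (φ₀.symm x)⁻¹ ∈ φ₀.source ∧ ‖φ₀ (φ₀.symm x)⁻¹‖ < s ∧
      φ₀.symm x ∈ N :=
    (hti.eventually (φ₀.open_source.mem_nhds h1)).and
      ((htφ.eventually (gt_mem_nhds hs)).and (hts.eventually hN))
  obtain ⟨r₁, hr₁, hball⟩ := Metric.eventually_nhds_iff_ball.1 hev
  -- Here `s` gives the multiplication estimate, `R` keeps the ball in the chart's target, `r₁`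
  -- controls inverses and membership in `N`, and `1/2` ensures `r < 1`.
  set r := min (min s R) (min r₁ (1 / 2)) with hr
  have hr0 : 0 < r := by positivity
  have hrs : r ≤ s := (min_le_left _ _).trans (min_le_left _ _)
  have hrR : r ≤ R := (min_le_left _ _).trans (min_le_right _ _)
  have hrr : r ≤ r₁ := (min_le_right _ _).trans (min_le_left _ _)
  have hr1 : r < 1 := ((min_le_right _ _).trans (min_le_right _ _)).trans_lt (by norm_num)
  have hrt : ball (0 : E) r ⊆ φ₀.target := (ball_subset_ball hrR).trans hRt
  obtain ⟨φ, hφs, hφt, hφc, hφsc⟩ := exists_restrict_target φ₀ isOpen_ball hrt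
  have hφss : ∀ g ∈ φ.source, g ∈ φ₀.source ∧ ‖φ₀ g‖ < s := fun g hg => by
    rw [hφs] at hg
    exact ⟨hg.1, (mem_ball_zero_iff.1 hg.2).trans_le hrs⟩
  have hφr : ∀ g ∈ φ.source, ‖φ₀ g‖ < r := fun g hg => by
    rw [hφs] at hg
    exact mem_ball_zero_iff.1 hg.2
  have hmem : ∀ g ∈ φ₀.source, ‖φ₀ g‖ < r → g ∈ φ.source := fun g hg hgr => by
    rw [hφs]
    exact ⟨hg, mem_ball_zero_iff.2 hgr⟩
  let U : Subgroup G :=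
    { carrier := φ.source
      mul_mem' := fun {g h} hg hh => by
        obtain ⟨a, b⟩ := hφss g hg
        obtain ⟨a', b'⟩ := hφss h hh
        refine hmem _ (H.norm_sub_sub_le h1 hφ1 a a' b b').1 ?_
        exact (H.norm_mul_le hε1.le h1 hφ1 a a' b b').trans_lt (max_lt (hφr g hg) (hφr h hh))
      one_mem' := hmem 1 h1 (by rw [hφ1, norm_zero]; exact hr0)
      inv_mem' := fun {g} hg => by
        obtain ⟨a, b⟩ := hφss g hg
        obtain ⟨i1, i2, -⟩ := hball (φ₀ g) (by
          rw [mem_ball_zero_iff]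
          exact (hφr g hg).trans_le hrr)
        rw [φ₀.left_inv a] at i1 i2
        exact hmem _ i1 ((H.norm_inv_le hε1 h1 hφ1 a i1 b i2).trans_lt (hφr g hg)) }
  have hUmem : ∀ g, g ∈ U ↔ g ∈ φ.source := fun g => Iff.rfl
  have hxU : ∀ x ∈ ball (0 : E) r, φ₀.symm x ∈ U ∧ φ₀ (φ₀.symm x) = x := fun x hx => by
    rw [hUmem, ← hφsc]
    refine ⟨φ.map_target (hφt ▸ hx), ?_⟩
    rw [← hφc, φ.right_inv (hφt ▸ hx)]
  have hdist : ∀ g ∈ U, ∀ g' ∈ U, ∀ h ∈ U, ∀ h' ∈ U,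
      ‖φ₀ (g * h) - φ₀ (g' * h')‖ ≤ max ‖φ₀ g - φ₀ g'‖ ‖φ₀ h - φ₀ h'‖ := by
    intro g hg g' hg' h hh h' hh'
    exact H.norm_mul_sub_mul_le hε1.le (hφss g hg).1 (hφss g' hg').1 (hφss h hh).1 (hφss h' hh').1
      (hφss g hg).2 (hφss g' hg').2 (hφss h hh).2 (hφss h' hh').2
  have hsub : ∀ x ∈ ball (0 : E) r, ∀ s : ℝ, s ≤ r → ball x s ⊆ ball 0 r := fun x hx s hs => by
    refine (ball_subset_ball hs).trans ?_
    rw [IsUltrametricDist.ball_eq_of_mem hx]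
  set f : E → E := fun x => (p : ℚ_[p])⁻¹ • φ (φ.symm x ^ p) with hf
  have hf0 : f 0 = 0 := by
    simp only [hf, hφc, hφsc]
    rw [symm_zero_eq_one h1 hφ1, one_pow, hφ1, smul_zero]
  have hpert : ∀ x ∈ ball (0 : E) r, ∀ y ∈ ball (0 : E) r,
      ‖f x - f y - (x - y)‖ ≤ 1 / 2 * ‖x - y‖ := by
    intro x hx y hy
    obtain ⟨hxU1, hx2⟩ := hxU x hx
    obtain ⟨hyU1, hy2⟩ := hxU y hy
    have h3 := H.pow_sub (p := p) (by positivity) hε1.le h1 hφ1 (hφss _ hxU1).1 (hφss _ hxU1).2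
      (hφss _ hyU1).1 (hφss _ hyU1).2 p
    rw [hx2, hy2] at h3
    have e : f x - f y - (x - y) = (p : ℚ_[p])⁻¹ •
        (φ₀ (φ₀.symm x ^ p) - φ₀ (φ₀.symm y ^ p) - (p : ℚ_[p]) • (x - y)) := by
      simp only [hf, hφc, hφsc]
      rw [smul_sub _ _ ((p : ℚ_[p]) • (x - y)), smul_smul, inv_mul_cancel₀ hp0, one_smul, smul_sub]
    rw [e, norm_smul, norm_inv]
    calc _ ≤ ‖(p : ℚ_[p])‖⁻¹ * (‖(p : ℚ_[p])‖ / 2 * ‖x - y‖) := by gcongr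
      _ = 1 / 2 * ‖x - y‖ := by field_simp
  refine ⟨{ U := U, r := r, φ := φ, r_pos := hr0, r_lt_one := hr1, source_eq := rfl,
            target_eq := hφt, map_one := by rw [hφc, hφ1], class_Ck := ?_, class_Ck_symm := ?_,
            tangent_one := ?_, left_coset := ?_, right_coset := ?_,
            power_isometry := ?_, power_surjective := ?_ }, ?_⟩
  · exact ckMapOn_translated_chart hG hca (c 1) (fun g hg => (hφss g hg).1)
      (fun g => by rw [hφc, hcoe])
  · exact ckMapOn_translated_chart_symm hG hca (c 1)
      (fun x hx => hrt hx) (fun g => by rw [hφsc, hsymm])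
  · have := hA.hasFDerivAt
    simpa only [hφc] using this
  · intro x hx s' hs' hsr
    obtain ⟨hxU1, hx2⟩ := hxU x hx
    refine Subset.antisymm ?_ fun z hz => ?_
    · rintro _ ⟨y, hy, rfl⟩
      obtain ⟨hyU1, hy2⟩ := hxU y (ball_subset_ball hsr hy)
      simp only [hφc, hφsc]
      have := hdist _ hxU1 _ hxU1 _ hyU1 1 U.one_mem
      rw [mul_one, hx2, hy2, hφ1, sub_self, norm_zero, sub_zero, max_eq_right (norm_nonneg _)]
        at this
      rw [mem_ball_iff_norm]
      exact this.trans_lt (mem_ball_zero_iff.1 hy)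
    · obtain ⟨hzU1, hz2⟩ := hxU z (hsub x hx s' hsr hz)
      have hiU := U.mul_mem (U.inv_mem hxU1) hzU1
      refine ⟨φ₀ ((φ₀.symm x)⁻¹ * φ₀.symm z), ?_, ?_⟩
      · have := hdist _ (U.inv_mem hxU1) _ (U.inv_mem hxU1) _ hzU1 _ hxU1
        rw [inv_mul_cancel, hφ1, sub_self, norm_zero, sub_zero, max_eq_right (norm_nonneg _),
          hz2, hx2] at this
        rw [mem_ball_zero_iff]
        exact this.trans_lt (mem_ball_iff_norm.1 hz)
      · simp only [hφc, hφsc]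
        rw [φ₀.left_inv (hφss _ hiU).1, mul_inv_cancel_left, hz2]
  · intro x hx s' hs' hsr
    obtain ⟨hxU1, hx2⟩ := hxU x hx
    refine Subset.antisymm ?_ fun z hz => ?_
    · rintro _ ⟨y, hy, rfl⟩
      obtain ⟨hyU1, hy2⟩ := hxU y (ball_subset_ball hsr hy)
      simp only [hφc, hφsc]
      have := hdist _ hyU1 1 U.one_mem _ hxU1 _ hxU1
      rw [one_mul, hx2, hy2, hφ1, sub_self, norm_zero, sub_zero, max_eq_left (norm_nonneg _)]
        at this
      rw [mem_ball_iff_norm]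
      exact this.trans_lt (mem_ball_zero_iff.1 hy)
    · obtain ⟨hzU1, hz2⟩ := hxU z (hsub x hx s' hsr hz)
      have hiU := U.mul_mem hzU1 (U.inv_mem hxU1)
      refine ⟨φ₀ (φ₀.symm z * (φ₀.symm x)⁻¹), ?_, ?_⟩
      · have := hdist _ hzU1 _ hxU1 _ (U.inv_mem hxU1) _ (U.inv_mem hxU1)
        rw [mul_inv_cancel, hφ1, sub_self, norm_zero, sub_zero, max_eq_left (norm_nonneg _),
          hz2, hx2] at this
        rw [mem_ball_zero_iff]
        exact this.trans_lt (mem_ball_iff_norm.1 hz)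
      · simp only [hφc, hφsc]
        rw [φ₀.left_inv (hφss _ hiU).1, inv_mul_cancel_right, hz2]
  · intro x hx y hy
    rw [dist_eq_norm, dist_eq_norm]
    exact norm_eq_of_norm_sub_le (by norm_num : (1 / 2 : ℝ) < 1) (hpert x hx y hy)
  · exact image_ball_eq_of_perturbation hr0 hf0 hpert
  · intro g hg
    have hg' : g ∈ φ.source := hg
    have := (hball (φ₀ g) (by
      rw [mem_ball_zero_iff]
      exact (hφr g hg').trans_le hrr)).2.2
    rwa [φ₀.left_inv (hφss g hg').1] at this

end Existence

end PadicLie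

namespace PadicLie

universe u v w

/-! ### Powers, roots and `p`-adic exponents in an adapted chart. -/

variable {p : ℕ} [Fact p.Prime]

theorem padic_p_ne_zero : (p : ℚ_[p]) ≠ 0 := by
  exact_mod_cast (Fact.out : p.Prime).ne_zero

theorem padic_norm_p_pos : 0 < ‖(p : ℚ_[p])‖ := norm_pos_iff.2 padic_p_ne_zero

theorem exists_padicInt_eq_unit_mul_pow {z : ℤ_[p]} (hz : z ≠ 0) :
    ∃ (u : ℤ_[p]) (n : ℕ), z = u * (p : ℤ_[p]) ^ n ∧ ‖u‖ = 1 ∧ ‖z‖ = ‖(p : ℚ_[p])‖ ^ n := by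
  refine ⟨PadicInt.unitCoeff hz, z.valuation, PadicInt.unitCoeff_spec hz,
    PadicInt.norm_units _, ?_⟩
  conv_lhs => rw [PadicInt.unitCoeff_spec hz]
  rw [norm_mul, PadicInt.norm_units, one_mul, norm_pow]
  simp

namespace AdaptedChart

variable {k : ℕ∞} {E : Type u} [NormedAddCommGroup E]
    [NormedSpace ℚ_[p] E] {G : Type v} [Group G] [TopologicalSpace G]
    [ChartedSpace E G] (D : AdaptedChart p k E G)

theorem mem_source {g : G} : g ∈ D.φ.source ↔ g ∈ D.U := by
  rw [D.source_eq]; rfl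

theorem mem_target {x : E} : x ∈ D.φ.target ↔ x ∈ ball (0 : E) D.r := by
  rw [D.target_eq]

theorem one_mem_source : (1 : G) ∈ D.φ.source := D.mem_source.2 D.U.one_mem

theorem map_mem_ball {g : G} (hg : g ∈ D.U) : D.φ g ∈ ball (0 : E) D.r :=
  D.mem_target.1 (D.φ.map_source (D.mem_source.2 hg))

theorem norm_lt {g : G} (hg : g ∈ D.U) : ‖D.φ g‖ < D.r :=
  mem_ball_zero_iff.1 (D.map_mem_ball hg)

theorem symm_mem {x : E} (hx : x ∈ ball (0 : E) D.r) : D.φ.symm x ∈ D.U :=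
  D.mem_source.1 (D.φ.map_target (D.mem_target.2 hx))

theorem right_inv {x : E} (hx : x ∈ ball (0 : E) D.r) : D.φ (D.φ.symm x) = x :=
  D.φ.right_inv (D.mem_target.2 hx)

theorem left_inv {g : G} (hg : g ∈ D.U) : D.φ.symm (D.φ g) = g :=
  D.φ.left_inv (D.mem_source.2 hg)

theorem injOn {g h : G} (hg : g ∈ D.U) (hh : h ∈ D.U) (e : D.φ g = D.φ h) : g = h :=
  D.φ.injOn (D.mem_source.2 hg) (D.mem_source.2 hh) e

theorem isOpen_U : IsOpen (D.U : Set G) := D.source_eq ▸ D.φ.open_source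

theorem U_mem_nhds {g : G} (hg : g ∈ D.U) : (D.U : Set G) ∈ 𝓝 g := D.isOpen_U.mem_nhds hg

theorem continuousAt_φ {g : G} (hg : g ∈ D.U) : ContinuousAt D.φ g :=
  D.φ.continuousAt (D.mem_source.2 hg)

theorem continuousAt_symm {x : E} (hx : x ∈ ball (0 : E) D.r) : ContinuousAt D.φ.symm x :=
  D.φ.continuousAt_symm (D.mem_target.2 hx)

/-- The norm form of the left coset condition, through which that condition enters all later
estimates. -/
theorem norm_mul_sub_le {g h : G} (hg : g ∈ D.U) (hh : h ∈ D.U) :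
    ‖D.φ (g * h) - D.φ g‖ ≤ ‖D.φ h‖ := by
  by_contra! hlt
  -- The minimum with `r` is needed because coset conditions are available only for radii up to `r`.
  set s := min ‖D.φ (g * h) - D.φ g‖ D.r with hs
  have h1 : ‖D.φ h‖ < s := lt_min hlt (D.norm_lt hh)
  have h2 : D.φ (g * h) ∈ ball (D.φ g) s := by
    rw [← D.left_coset _ (D.map_mem_ball hg) s ((norm_nonneg _).trans_lt h1) (min_le_right _ _)]
    exact ⟨D.φ h, mem_ball_zero_iff.2 h1, by simp only [D.left_inv hg, D.left_inv hh]⟩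
  rw [mem_ball_iff_norm] at h2
  exact absurd (min_le_left _ _) (not_le.2 h2)

theorem norm_pow_p_sub {g h : G} (hg : g ∈ D.U) (hh : h ∈ D.U) :
    ‖D.φ (g ^ p) - D.φ (h ^ p)‖ = ‖(p : ℚ_[p])‖ * ‖D.φ g - D.φ h‖ := by
  have h1 := D.power_isometry _ (D.map_mem_ball hg) _ (D.map_mem_ball hh)
  rw [D.left_inv hg, D.left_inv hh, dist_smul₀, dist_eq_norm, dist_eq_norm, norm_inv] at h1
  rw [← h1, mul_inv_cancel_left₀ padic_norm_p_pos.ne']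

theorem norm_pow_pow_sub {g h : G} (hg : g ∈ D.U) (hh : h ∈ D.U) (n : ℕ) :
    ‖D.φ (g ^ p ^ n) - D.φ (h ^ p ^ n)‖ = ‖(p : ℚ_[p])‖ ^ n * ‖D.φ g - D.φ h‖ := by
  induction n with
  | zero => simp
  | succ n ih =>
    rw [pow_succ p, pow_mul, pow_mul, D.norm_pow_p_sub (D.U.pow_mem hg _) (D.U.pow_mem hh _), ih]
    ring

theorem norm_pow_pow {g : G} (hg : g ∈ D.U) (n : ℕ) :
    ‖D.φ (g ^ p ^ n)‖ = ‖(p : ℚ_[p])‖ ^ n * ‖D.φ g‖ := by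
  simpa [D.map_one] using D.norm_pow_pow_sub hg D.U.one_mem n

/-- Surjectivity of `p⁻¹ τ_p` gives one `p`-th root at a time; each extraction divides the norm by
`‖p‖`, so the hypothesis leaves room for exactly `n` of them. -/
theorem exists_root {h : G} (hh : h ∈ D.U) (n : ℕ) (hn : ‖D.φ h‖ < ‖(p : ℚ_[p])‖ ^ n * D.r) :
    ∃ g ∈ D.U, g ^ p ^ n = h := by
  induction n generalizing h with
  | zero => exact ⟨h, hh, by simp⟩
  | succ n ih =>
    have hp := padic_norm_p_pos (p := p)
    have hn' : ‖D.φ h‖ < ‖(p : ℚ_[p])‖ * (‖(p : ℚ_[p])‖ ^ n * D.r) := by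
      rw [pow_succ] at hn
      linarith
    have hp1 : ‖(p : ℚ_[p])‖ ≤ 1 := IsUltrametricDist.norm_natCast_le_one ℚ_[p] p
    have h1 : (p : ℚ_[p])⁻¹ • D.φ h ∈ ball (0 : E) D.r := by
      rw [mem_ball_zero_iff, norm_smul, norm_inv, inv_mul_lt_iff₀ hp]
      refine hn'.trans_le ?_
      have h2 : ‖(p : ℚ_[p])‖ ^ n ≤ 1 := pow_le_one₀ hp.le hp1
      have := D.r_pos
      gcongr
      exact mul_le_of_le_one_left this.le h2
    rw [← D.power_surjective] at h1
    obtain ⟨x, hx, hxe⟩ := h1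
    have hg := D.symm_mem hx
    set g := D.φ.symm x with hgdef
    have hgp : g ^ p = h := by
      refine D.injOn (D.U.pow_mem hg p) hh ?_
      exact smul_right_injective E (inv_ne_zero padic_p_ne_zero) hxe
    have hgn : ‖D.φ g‖ < ‖(p : ℚ_[p])‖ ^ n * D.r := by
      have h2 := D.norm_pow_p_sub hg D.U.one_mem
      rw [one_pow, D.map_one, sub_zero, sub_zero, hgp] at h2
      rw [h2] at hn'
      exact lt_of_mul_lt_mul_left hn' hp.le
    obtain ⟨y, hy, hyg⟩ := ih hg hgn
    exact ⟨y, hy, by rw [pow_succ, pow_mul, hyg, hgp]⟩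

theorem root_unique {g h : G} (hg : g ∈ D.U) (hh : h ∈ D.U) (n : ℕ)
    (e : g ^ p ^ n = h ^ p ^ n) : g = h := by
  have h1 := D.norm_pow_pow_sub hg hh n
  rw [e, sub_self, norm_zero] at h1
  have h2 := (mul_eq_zero.1 h1.symm).resolve_left (pow_pos padic_norm_p_pos n).ne'
  exact D.injOn hg hh (sub_eq_zero.1 (norm_eq_zero.1 h2))

theorem root_spec {h : G} (hh : h ∈ D.U) (n : ℕ)
    (hn : ‖D.φ h‖ < ‖(p : ℚ_[p])‖ ^ n * D.r) : D.root n h ∈ D.U ∧ D.root n h ^ p ^ n = h :=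
  ⟨Function.invFunOn_mem (D.exists_root hh n hn), Function.invFunOn_eq (D.exists_root hh n hn)⟩

section Ultrametric

variable [IsUltrametricDist E]

theorem norm_mul_le {g h : G} (hg : g ∈ D.U) (hh : h ∈ D.U) :
    ‖D.φ (g * h)‖ ≤ max ‖D.φ g‖ ‖D.φ h‖ := by
  have := IsUltrametricDist.norm_add_le_max (D.φ (g * h) - D.φ g) (D.φ g)
  rw [sub_add_cancel, max_comm] at this
  exact this.trans (max_le_max le_rfl (D.norm_mul_sub_le hg hh))

theorem norm_pow_le {g : G} (hg : g ∈ D.U) (m : ℕ) : ‖D.φ (g ^ m)‖ ≤ ‖D.φ g‖ := by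
  induction m with
  | zero => simp [D.map_one]
  | succ m ih =>
    rw [pow_succ]
    exact (D.norm_mul_le (D.U.pow_mem hg m) hg).trans (max_le ih le_rfl)

/-- Write `m = pⁿ m'` with `m'` prime to `p`: the factor `pⁿ` scales norms exactly, and `m'` does
not increase them. This makes `m ↦ g ^ m` Lipschitz for the `p`-adic metric, hence extendable to
`ℤ_p`. -/
theorem norm_pow_natCast_le {g : G} (hg : g ∈ D.U) (m : ℕ) :
    ‖D.φ (g ^ m)‖ ≤ ‖(m : ℚ_[p])‖ * ‖D.φ g‖ := by
  rcases eq_or_ne m 0 with rfl | hm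
  · simp [D.map_one]
  obtain ⟨n, m', hm', rfl⟩ := Nat.exists_eq_pow_mul_and_not_dvd hm p
    (Fact.out : p.Prime).ne_one
  have h1 : ‖(m' : ℚ_[p])‖ = 1 :=
    Padic.norm_natCast_eq_one_iff.2 ((Fact.out : p.Prime).coprime_iff_not_dvd.2 hm')
  rw [mul_comm, pow_mul, D.norm_pow_pow (D.U.pow_mem hg _)]
  push_cast
  rw [norm_mul, h1, one_mul, norm_pow]
  gcongr
  exact D.norm_pow_le hg m'

theorem norm_pow_sub_pow_le {g : G} (hg : g ∈ D.U) (a b : ℕ) :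
    ‖D.φ (g ^ a) - D.φ (g ^ b)‖ ≤ ‖(a : ℚ_[p]) - b‖ * ‖D.φ g‖ := by
  wlog hab : b ≤ a generalizing a b
  · rw [norm_sub_rev, norm_sub_rev (a : ℚ_[p])]
    exact this b a (not_le.1 hab).le
  obtain ⟨d, rfl⟩ := Nat.exists_eq_add_of_le hab
  rw [pow_add]
  refine (D.norm_mul_sub_le (D.U.pow_mem hg b) (D.U.pow_mem hg d)).trans ?_
  simpa using D.norm_pow_natCast_le hg d

variable [CompleteSpace E]

theorem exists_padicPow {g : G} (hg : g ∈ D.U) (z : ℤ_[p]) :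
    ∃ y ∈ D.U, ∀ m : ℕ, ‖D.φ y - D.φ (g ^ m)‖ ≤ ‖z - m‖ * ‖D.φ g‖ := by
  obtain ⟨u, hu, hz⟩ := mem_closure_iff_seq_limit.1 (PadicInt.denseRange_natCast z)
  choose a ha using hu
  have hcau : CauchySeq fun n => D.φ (g ^ a n) := by
    rw [Metric.cauchySeq_iff']
    intro ε hε
    have hc := hz.cauchySeq
    rw [Metric.cauchySeq_iff'] at hc
    obtain ⟨N, hN⟩ := hc (ε / (‖D.φ g‖ + 1)) (by positivity)
    refine ⟨N, fun n hn => ?_⟩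
    have h1 := hN n hn
    rw [← ha n, ← ha N, dist_eq_norm, PadicInt.norm_def] at h1
    push_cast at h1
    rw [lt_div_iff₀ (by positivity)] at h1
    rw [dist_eq_norm]
    refine (D.norm_pow_sub_pow_le hg _ _).trans_lt (lt_of_le_of_lt ?_ h1)
    gcongr
    linarith
  obtain ⟨x, hx⟩ := cauchySeq_tendsto_of_complete hcau
  -- The limit stays in the open ball because all terms are bounded by the fixed number `‖φ g‖ < r`.
  have hxr : ‖x‖ ≤ ‖D.φ g‖ :=
    le_of_tendsto hx.norm (Eventually.of_forall fun n => D.norm_pow_le hg _)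
  have hxb : x ∈ ball (0 : E) D.r := mem_ball_zero_iff.2 (hxr.trans_lt (D.norm_lt hg))
  refine ⟨D.φ.symm x, D.symm_mem hxb, fun m => ?_⟩
  rw [D.right_inv hxb]
  refine le_of_tendsto_of_tendsto (hx.sub_const _).norm
    (((hz.sub_const (m : ℤ_[p])).norm).mul_const ‖D.φ g‖) (Eventually.of_forall fun n => ?_)
  simp only [← ha n]
  simpa [PadicInt.norm_def] using D.norm_pow_sub_pow_le hg (a n) m

variable [IsTopologicalGroup G] [T2Space G]

/-- The continuous homomorphism `ℤ_p → U`, `z ↦ g ^ z`. -/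
theorem exists_oneParam {g : G} (hg : g ∈ D.U) :
    ∃ η : ℤ_[p] → G, Continuous η ∧ (∀ z, η z ∈ D.U) ∧ (∀ m : ℕ, η m = g ^ m) ∧
      (∀ z w, η (z + w) = η z * η w) ∧
      ∀ z w, ‖D.φ (η z) - D.φ (η w)‖ ≤ ‖z - w‖ * ‖D.φ g‖ := by
  choose η hηU hη using D.exists_padicPow hg
  have hnat : ∀ m : ℕ, η m = g ^ m := fun m => by
    refine D.injOn (hηU _) (D.U.pow_mem hg m) (sub_eq_zero.1 (norm_le_zero_iff.1 ?_))
    simpa using hη m m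
  have hlip : ∀ z w, ‖D.φ (η z) - D.φ (η w)‖ ≤ ‖z - w‖ * ‖D.φ g‖ := by
    intro z w
    rcases eq_or_ne z w with rfl | hzw
    · simp
    -- An integer `m` closer to `w` than `z` is satisfies `‖z - m‖ ≤ ‖z - w‖` by the ultrametric
    -- inequality, so `g ^ m` can serve as an intermediate point.
    obtain ⟨m, hm⟩ := PadicInt.denseRange_natCast.exists_dist_lt w
      (norm_pos_iff.2 (sub_ne_zero.2 hzw))
    rw [dist_eq_norm] at hm
    have h1 : ‖z - m‖ ≤ ‖z - w‖ := by
      have := IsUltrametricDist.norm_add_le_max (z - w) (w - m)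
      rw [sub_add_sub_cancel] at this
      exact this.trans (max_le le_rfl hm.le)
    have h2 := IsUltrametricDist.norm_add_le_max (D.φ (η z) - D.φ (g ^ m))
      (D.φ (g ^ m) - D.φ (η w))
    rw [sub_add_sub_cancel] at h2
    refine h2.trans (max_le ((hη z m).trans ?_) ?_)
    · gcongr
    · rw [norm_sub_rev]
      refine (hη w m).trans ?_
      gcongr
  have hcφ : Continuous fun z => D.φ (η z) := by
    refine (LipschitzWith.of_dist_le_mul (K := ‖D.φ g‖₊) fun z w => ?_).continuous
    rw [dist_eq_norm, dist_eq_norm, coe_nnnorm, mul_comm]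
    exact hlip z w
  have hcont : Continuous η := by
    have : η = fun z => D.φ.symm (D.φ (η z)) := funext fun z => (D.left_inv (hηU z)).symm
    rw [this]
    exact D.φ.continuousOn_symm.comp_continuous hcφ
      fun z => D.mem_target.2 (D.map_mem_ball (hηU z))
  refine ⟨η, hcont, hηU, hnat, fun z w => ?_, hlip⟩
  refine congr_fun ((PadicInt.denseRange_natCast.prodMap PadicInt.denseRange_natCast).equalizer
    (g := fun q : ℤ_[p] × ℤ_[p] => η (q.1 + q.2)) (h := fun q => η q.1 * η q.2)
    (by fun_prop) (by fun_prop) ?_) (z, w)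
  funext ⟨a, b⟩
  simp only [Function.comp, Prod.map]
  rw [← Nat.cast_add, hnat, hnat, hnat, pow_add]

end Ultrametric

end AdaptedChart

end PadicLie

namespace PadicLie

universe u v w

variable {p : ℕ} [Fact p.Prime]

theorem tendsto_padic_pow : Tendsto (fun n : ℕ => ‖(p : ℚ_[p])‖ ^ n) atTop (𝓝 0) :=
  tendsto_pow_atTop_nhds_zero_of_lt_one (norm_nonneg _) Padic.norm_p_lt_one

/-! ### Continuous homomorphisms on `ℤ_p`. -/

namespace IsPadicHom

variable {G : Type v} [Group G] [TopologicalSpace G] {ξ ξ' : ℚ_[p] → G}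

theorem map_zero {W : AddSubgroup ℚ_[p]} (h : IsPadicHom p W ξ) : ξ 0 = 1 := by
  have := h.map_add 0 W.zero_mem 0 W.zero_mem
  rw [add_zero] at this
  exact left_eq_mul.mp this

theorem map_natCast_mul {W : AddSubgroup ℚ_[p]} (h : IsPadicHom p W ξ) {z : ℚ_[p]} (hz : z ∈ W)
    (m : ℕ) : ξ (m * z) = ξ z ^ m := by
  induction m with
  | zero => simp [h.map_zero]
  | succ m ih =>
    have hm : (m : ℚ_[p]) * z ∈ W := by
      rw [← nsmul_eq_mul]
      exact W.nsmul_mem hz m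
    push_cast
    rw [add_mul, one_mul, h.map_add _ hm _ hz, ih, pow_succ]

variable (h : IsPadicHom p (PadicInt.subring p).toAddSubgroup ξ)
include h

theorem continuous_coe : Continuous fun z : ℤ_[p] => ξ z :=
  h.continuousOn.comp_continuous continuous_subtype_val fun z => z.2

theorem map_add_of_norm_le {z w : ℚ_[p]} (hz : ‖z‖ ≤ 1) (hw : ‖w‖ ≤ 1) :
    ξ (z + w) = ξ z * ξ w := h.map_add z hz w hw

theorem map_pow_mul {z : ℚ_[p]} (hz : ‖z‖ ≤ 1) (n : ℕ) :
    ξ ((p : ℚ_[p]) ^ n * z) = ξ z ^ p ^ n := by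
  have := h.map_natCast_mul (z := z) hz (p ^ n)
  push_cast at this
  exact this

theorem eqOn_of_map_one [T2Space G] (h' : IsPadicHom p (PadicInt.subring p).toAddSubgroup ξ')
    (h1 : ξ 1 = ξ' 1) {z : ℚ_[p]} (hz : ‖z‖ ≤ 1) : ξ z = ξ' z := by
  have : (fun z : ℤ_[p] => ξ z) = fun z : ℤ_[p] => ξ' z := by
    refine PadicInt.denseRange_natCast.equalizer h.continuous_coe h'.continuous_coe ?_
    funext m
    have e := h.map_natCast_mul (z := 1) (by simp) m
    have e' := h'.map_natCast_mul (z := 1) (by simp) m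
    rw [mul_one] at e e'
    simp [e, e', h1]
  exact congrFun this ⟨z, hz⟩

theorem comp_mul {a : ℚ_[p]} (ha : ‖a‖ ≤ 1) :
    IsPadicHom p (PadicInt.subring p).toAddSubgroup fun z => ξ (z * a) := by
  have hm : ∀ z : ℚ_[p], ‖z‖ ≤ 1 → ‖z * a‖ ≤ 1 := fun z hz => by
    rw [norm_mul]
    exact mul_le_one₀ hz (norm_nonneg _) ha
  refine ⟨h.isOpen, ?_, fun s hs t ht => ?_⟩
  · exact h.continuousOn.comp (by fun_prop) fun z hz => hm z hz
  · rw [add_mul]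
    exact h.map_add_of_norm_le (hm s hs) (hm t ht)

end IsPadicHom

theorem isPadicHom_extend {G : Type v} [Group G] [TopologicalSpace G] {η : ℤ_[p] → G}
    (hc : Continuous η) (hadd : ∀ z w, η (z + w) = η z * η w) :
    ∃ ξ : ℚ_[p] → G, IsPadicHom p (PadicInt.subring p).toAddSubgroup ξ ∧
      ∀ z : ℤ_[p], ξ z = η z := by
  classical
  have hext : ∀ z : ℤ_[p], (fun z : ℚ_[p] => if h : ‖z‖ ≤ 1 then η ⟨z, h⟩ else 1) z = η z :=
    fun z => dif_pos z.2
  -- The value `1` outside `ℤ_p` is arbitrary; `IsPadicHom` constrains the map only on the subgroup.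
  refine ⟨fun z => if h : ‖z‖ ≤ 1 then η ⟨z, h⟩ else 1, ⟨?_, ?_, ?_⟩, hext⟩
  · exact isOpen_unitSubgroup
  · rw [continuousOn_iff_continuous_domRestrict]
    exact hc.congr fun z => (hext z).symm
  · intro s hs t ht
    exact (hext (⟨s, hs⟩ + ⟨t, ht⟩)).trans
      ((hadd _ _).trans (congrArg₂ _ (hext ⟨s, hs⟩).symm (hext ⟨t, ht⟩).symm))

/-! ### The logarithm as the limit of `p⁻ⁿ φ (g ^ pⁿ)`. -/

namespace AdaptedChart

variable {k : ℕ∞} {E : Type u} [NormedAddCommGroup E]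
    [NormedSpace ℚ_[p] E] {G : Type v} [Group G] [TopologicalSpace G]
    [ChartedSpace E G] (D : AdaptedChart p k E G)

/-- The normalization of the chart prescribes only a Fréchet derivative. The class `C^{k₊}` provides
a strict one, and uniqueness identifies the two. -/
theorem hasStrictFDerivAt_chart (hk : 1 ≤ k) :
    HasStrictFDerivAt (fun y => D.φ ((chartAt E (1 : G)).symm y))
      (ContinuousLinearMap.id ℚ_[p] E) (chartAt E (1 : G) 1) := by
  set c := chartAt E (1 : G) with hc
  have hca : c ∈ atlas E G := chart_mem_atlas E 1
  have hc1 : (1 : G) ∈ c.source := mem_chart_source E 1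
  have h1 := (D.class_Ck.2 c hca (OpenPartialHomeomorph.refl E) (by simp)).isSC1 hk id (by
    simp only [OpenPartialHomeomorph.refl_source, mem_univ, and_true]
    exact c.isOpen_inter_preimage_symm D.isOpen_U)
  obtain ⟨A, hA⟩ := h1 (c 1) ⟨c.map_source hc1, by simp [c.left_inv hc1, D.U.one_mem], by simp⟩
  have hA' : HasStrictFDerivAt (fun y => D.φ (c.symm y)) A (c 1) := hA
  rwa [hA'.hasFDerivAt.unique D.tangent_one] at hA'

theorem hasStrictFDerivAt_chart_symm (hk : 1 ≤ k) :
    HasStrictFDerivAt (fun y => chartAt E (1 : G) (D.φ.symm y))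
      (ContinuousLinearMap.id ℚ_[p] E) 0 := by
  set c := chartAt E (1 : G) with hc
  have hca : c ∈ atlas E G := chart_mem_atlas E 1
  have hc1 : (1 : G) ∈ c.source := mem_chart_source E 1
  have hs0 := symm_zero_eq_one D.one_mem_source D.map_one
  have h1 := (D.class_Ck_symm.2 (OpenPartialHomeomorph.refl E) (by simp) c hca).isSC1 hk id (by
    have := D.φ.isOpen_inter_preimage_symm c.open_source
    rw [D.target_eq] at this
    simp only [OpenPartialHomeomorph.refl_target, mem_univ, true_and]
    exact this)
  obtain ⟨B, hB⟩ := h1 0 ⟨by simp, by simpa using D.r_pos, by simpa [hs0] using hc1⟩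
  have hB' : HasStrictFDerivAt (fun y => c (D.φ.symm y)) B 0 := hB
  have hA := D.hasStrictFDerivAt_chart hk
  have hB2 : HasStrictFDerivAt (fun y => c (D.φ.symm y)) B (D.φ (c.symm (c 1))) := by
    rwa [c.left_inv hc1, D.map_one]
  have h3 := (HasFDerivAt.comp (f := fun y => D.φ (c.symm y)) (c 1) hB2.hasFDerivAt hA.hasFDerivAt)
  have h4 : HasFDerivAt (fun y => c (D.φ.symm (D.φ (c.symm y)))) (ContinuousLinearMap.id ℚ_[p] E)
      (c 1) := by
    refine (hasFDerivAt_id (c 1)).congr_of_eventuallyEq ?_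
    have hct : Tendsto c.symm (𝓝 (c 1)) (𝓝 1) := by
      have := (c.continuousAt_symm (c.map_source hc1)).tendsto
      rwa [c.left_inv hc1] at this
    filter_upwards [c.open_target.mem_nhds (c.map_source hc1),
      hct.eventually (D.U_mem_nhds D.U.one_mem)] with y hy hyU
    rw [D.left_inv hyU, c.right_inv hy, id]
  have h5 := h3.unique h4
  rw [ContinuousLinearMap.comp_id] at h5
  rwa [h5] at hB'

theorem exists_mulEstimate [IsTopologicalGroup G] (hk : 1 ≤ k) (hG : IsSC1LieGroup ℚ_[p] E G)
    {ε : ℝ} (hε : 0 < ε) : ∃ s > 0, MulEstimate D.φ ε s :=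
  PadicLie.exists_mulEstimate hG D.one_mem_source D.map_one (D.hasStrictFDerivAt_chart hk)
    (D.hasStrictFDerivAt_chart_symm hk) hε

/-- The approximations `p⁻ⁿ φ(g^{pⁿ})` of `log g`. -/
noncomputable def approxLog (n : ℕ) (g : G) : E := ((p : ℚ_[p]) ^ n)⁻¹ • D.φ (g ^ p ^ n)

/-- The `pⁿ`-th power map scales distances by exactly `‖p‖ⁿ`, which the division cancels. -/
theorem norm_approxLog_sub {g h : G} (hg : g ∈ D.U) (hh : h ∈ D.U) (n : ℕ) :
    ‖D.approxLog n g - D.approxLog n h‖ = ‖D.φ g - D.φ h‖ := by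
  rw [approxLog, approxLog, ← smul_sub, norm_smul, D.norm_pow_pow_sub hg hh, norm_inv, norm_pow,
    inv_mul_cancel_left₀ (pow_pos padic_norm_p_pos n).ne']

theorem approxLog_one (n : ℕ) : D.approxLog n (1 : G) = 0 := by
  simp [approxLog, D.map_one]

theorem exists_approxLog_eq {v : E} (hv : v ∈ ball (0 : E) D.r) (n : ℕ) :
    ∃ g ∈ D.U, D.approxLog n g = v := by
  have hp : ‖(p : ℚ_[p])‖ ^ n ≤ 1 :=
    pow_le_one₀ (norm_nonneg _) (IsUltrametricDist.norm_natCast_le_one ℚ_[p] p)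
  rw [mem_ball_zero_iff] at hv
  have hnorm : ‖(p : ℚ_[p]) ^ n • v‖ = ‖(p : ℚ_[p])‖ ^ n * ‖v‖ := by rw [norm_smul, norm_pow]
  have h1 : (p : ℚ_[p]) ^ n • v ∈ ball (0 : E) D.r := by
    rw [mem_ball_zero_iff, hnorm]
    exact (mul_le_of_le_one_left (norm_nonneg _) hp).trans_lt hv
  obtain ⟨g, hg, hgn⟩ := D.exists_root (D.symm_mem h1) n (by
    rw [D.right_inv h1, hnorm]
    have := pow_pos (padic_norm_p_pos (p := p)) n
    gcongr)
  refine ⟨g, hg, ?_⟩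
  rw [approxLog, hgn, D.right_inv h1, smul_smul, inv_mul_cancel₀ (pow_ne_zero n padic_p_ne_zero),
    one_smul]

theorem pow_smul_mem_ball {x : E} (hx : x ∈ ball (0 : E) D.r) (n : ℕ) :
    (p : ℚ_[p]) ^ n • x ∈ ball (0 : E) D.r := by
  rw [mem_ball_zero_iff] at hx ⊢
  rw [norm_smul, norm_pow]
  refine (mul_le_of_le_one_left (norm_nonneg _) ?_).trans_lt hx
  exact pow_le_one₀ (norm_nonneg _) (IsUltrametricDist.norm_natCast_le_one ℚ_[p] p)

theorem approxLog_pow (n m : ℕ) (g : G) :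
    D.approxLog n (g ^ p ^ m) = (p : ℚ_[p]) ^ m • D.approxLog (n + m) g := by
  rw [approxLog, approxLog, ← pow_mul, ← pow_add, add_comm m n, smul_smul]
  congr 1
  have := pow_ne_zero m (padic_p_ne_zero (p := p))
  rw [pow_add]
  field_simp

theorem exists_pow_mul_le {s : ℝ} (hs : 0 < s) :
    ∃ n₀ : ℕ, ∀ n ≥ n₀, ‖(p : ℚ_[p])‖ ^ n * D.r ≤ s := by
  have h1 : Tendsto (fun n : ℕ => ‖(p : ℚ_[p])‖ ^ n * D.r) atTop (𝓝 0) := by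
    simpa using (tendsto_padic_pow (p := p)).mul_const D.r
  obtain ⟨n₀, h⟩ := eventually_atTop.1 (h1.eventually (gt_mem_nhds hs))
  exact ⟨n₀, fun n hn => (h n hn).le⟩

section Ultrametric

variable [IsUltrametricDist E] {D} {ε s : ℝ}

/-- The power estimate is applied to `g ^ pⁿ` and `h ^ pⁿ`, whose distance carries a factor `‖p‖ⁿ`.
Division by `pⁿ⁺¹` then uses up precisely the extra `‖p‖` in the constant of `H`. -/
theorem norm_approxLog_succ_sub (H : MulEstimate D.φ (‖(p : ℚ_[p])‖ * ε) s) (hε0 : 0 ≤ ε)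
    (hε1 : ε ≤ 1) {g h : G} (hg : g ∈ D.U) (hh : h ∈ D.U) {n : ℕ} (hgs : ‖D.φ (g ^ p ^ n)‖ < s)
    (hhs : ‖D.φ (h ^ p ^ n)‖ < s) :
    ‖D.approxLog (n + 1) g - D.approxLog (n + 1) h - (D.approxLog n g - D.approxLog n h)‖ ≤
      ε * ‖D.φ g - D.φ h‖ := by
  have hp := padic_norm_p_pos (p := p)
  have hp0 := padic_p_ne_zero (p := p)
  have h1 := H.pow_sub (p := p) (by positivity)
    (mul_le_one₀ (IsUltrametricDist.norm_natCast_le_one ℚ_[p] p) hε0 hε1)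
    D.one_mem_source D.map_one (D.mem_source.2 (D.U.pow_mem hg _)) hgs
    (D.mem_source.2 (D.U.pow_mem hh _)) hhs p
  rw [D.norm_pow_pow_sub hg hh] at h1
  have e : D.approxLog (n + 1) g - D.approxLog (n + 1) h - (D.approxLog n g - D.approxLog n h) =
      ((p : ℚ_[p]) ^ (n + 1))⁻¹ • (D.φ ((g ^ p ^ n) ^ p) - D.φ ((h ^ p ^ n) ^ p) -
        (p : ℚ_[p]) • (D.φ (g ^ p ^ n) - D.φ (h ^ p ^ n))) := by
    simp only [approxLog, ← pow_mul, ← pow_succ]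
    rw [← smul_sub, ← smul_sub, smul_sub _ _ ((p : ℚ_[p]) • _), smul_smul]
    congr 2
    rw [pow_succ]
    field_simp
  rw [e, norm_smul, norm_inv, norm_pow]
  have hpn := pow_pos hp n
  calc _ ≤ (‖(p : ℚ_[p])‖ ^ (n + 1))⁻¹ *
        (‖(p : ℚ_[p])‖ * ε * (‖(p : ℚ_[p])‖ ^ n * ‖D.φ g - D.φ h‖)) := by gcongr
    _ = ε * ‖D.φ g - D.φ h‖ := by rw [pow_succ]; field_simp

/-- Ultrametric telescoping from `n = 0`, for elements already in the range of the estimate. In the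
limit it gives the strict derivative of `limLog` at the identity. -/
theorem norm_approxLog_sub_sub (H : MulEstimate D.φ (‖(p : ℚ_[p])‖ * ε) s) (hε0 : 0 ≤ ε)
    (hε1 : ε ≤ 1) {g h : G} (hg : g ∈ D.U) (hh : h ∈ D.U) (hgs : ‖D.φ g‖ < s)
    (hhs : ‖D.φ h‖ < s) (n : ℕ) :
    ‖D.approxLog n g - D.approxLog n h - (D.φ g - D.φ h)‖ ≤ ε * ‖D.φ g - D.φ h‖ := by
  induction n with
  | zero => simpa [approxLog] using by positivity
  | succ n ih =>
    have h1 := norm_approxLog_succ_sub H hε0 hε1 hg hh ((D.norm_pow_le hg (p ^ n)).trans_lt hgs)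
      ((D.norm_pow_le hh (p ^ n)).trans_lt hhs)
    have := IsUltrametricDist.norm_add_le_max
      (D.approxLog (n + 1) g - D.approxLog (n + 1) h - (D.approxLog n g - D.approxLog n h))
      (D.approxLog n g - D.approxLog n h - (D.φ g - D.φ h))
    rw [sub_add_sub_cancel] at this
    exact this.trans (max_le h1 ih)

/-- For arbitrary `g` in `U`, telescoping starts only at an `n` for which `g ^ pⁿ` has entered the
range of the estimate. That `n` depends on `r` and `s` but not on `g`, so the convergence is
uniform. -/
theorem norm_approxLog_sub_le (H : MulEstimate D.φ (‖(p : ℚ_[p])‖ * ε) s) (hε0 : 0 ≤ ε)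
    (hε1 : ε ≤ 1) {n : ℕ} (hn : ‖(p : ℚ_[p])‖ ^ n * D.r ≤ s) {m : ℕ} (hnm : n ≤ m)
    {g : G} (hg : g ∈ D.U) : ‖D.approxLog m g - D.approxLog n g‖ ≤ ε * ‖D.φ g‖ := by
  have hp := padic_norm_p_pos (p := p)
  induction m, hnm using Nat.le_induction with
  | base => simpa using by positivity
  | succ m hnm ih =>
    have hgs : ‖D.φ (g ^ p ^ m)‖ < s := by
      rw [D.norm_pow_pow hg]
      refine lt_of_lt_of_le ?_ hn
      have h2 : ‖(p : ℚ_[p])‖ ^ m ≤ ‖(p : ℚ_[p])‖ ^ n :=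
        pow_le_pow_of_le_one hp.le (IsUltrametricDist.norm_natCast_le_one ℚ_[p] p) hnm
      have := D.norm_lt hg
      have h3 := pow_pos hp m
      calc _ < ‖(p : ℚ_[p])‖ ^ m * D.r := by gcongr
        _ ≤ _ := by have := D.r_pos; gcongr
    have hs0 : ‖D.φ ((1 : G) ^ p ^ m)‖ < s := by
      rw [one_pow, D.map_one, norm_zero]
      exact (norm_nonneg _).trans_lt hgs
    have h1 := norm_approxLog_succ_sub H hε0 hε1 hg D.U.one_mem hgs hs0
    rw [approxLog_one, approxLog_one, D.map_one, sub_zero, sub_zero, sub_zero] at h1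
    have := IsUltrametricDist.norm_add_le_max
      (D.approxLog (m + 1) g - D.approxLog m g) (D.approxLog m g - D.approxLog n g)
    rw [sub_add_sub_cancel] at this
    exact this.trans (max_le h1 ih)

/-- The multiplication is strictly differentiable at the identity in the chart `φ`. -/
def StrictMul (D : AdaptedChart p k E G) : Prop := ∀ ε > 0, ∃ s > 0, MulEstimate D.φ ε s

theorem StrictMul.exists_norm_approxLog_sub_le (hD : D.StrictMul) {ε : ℝ} (hε : 0 < ε) :
    ∃ n₀ : ℕ, ∀ n ≥ n₀, ∀ m ≥ n, ∀ g ∈ D.U, ‖D.approxLog m g - D.approxLog n g‖ ≤ ε * ‖D.φ g‖ := by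
  have hp := padic_norm_p_pos (p := p)
  obtain ⟨s, hs, H⟩ := hD (‖(p : ℚ_[p])‖ * min ε 1) (by positivity)
  obtain ⟨n₀, hn₀⟩ := D.exists_pow_mul_le hs
  refine ⟨n₀, fun n hn m hm g hg => ?_⟩
  refine (norm_approxLog_sub_le H (by positivity) (min_le_right _ _) (hn₀ n hn) hm hg).trans ?_
  gcongr
  exact min_le_left _ _

/-- The limit of `p⁻ⁿ φ(g^{pⁿ})`. -/
noncomputable def limLog (D : AdaptedChart p k E G) (g : G) : E :=
  limUnder atTop fun n => D.approxLog n g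

theorem limLog_one : D.limLog (1 : G) = 0 := by
  have : Tendsto (fun n => D.approxLog n (1 : G)) atTop (𝓝 0) := by
    simp only [approxLog_one]
    exact tendsto_const_nhds
  exact this.limUnder_eq

variable [CompleteSpace E]

theorem StrictMul.tendsto_approxLog (hD : D.StrictMul) {g : G} (hg : g ∈ D.U) :
    Tendsto (fun n => D.approxLog n g) atTop (𝓝 (D.limLog g)) := by
  refine CauchySeq.tendsto_limUnder (Metric.cauchySeq_iff'.2 fun ε hε => ?_)
  obtain ⟨n₀, h⟩ := hD.exists_norm_approxLog_sub_le (ε := ε / (‖D.φ g‖ + 1)) (by positivity)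
  refine ⟨n₀, fun n hn => ?_⟩
  rw [dist_eq_norm]
  refine (h n₀ le_rfl n hn g hg).trans_lt ?_
  rw [div_mul_eq_mul_div, div_lt_iff₀ (by positivity)]
  linarith

theorem StrictMul.norm_limLog_sub (hD : D.StrictMul) {g h : G} (hg : g ∈ D.U) (hh : h ∈ D.U) :
    ‖D.limLog g - D.limLog h‖ = ‖D.φ g - D.φ h‖ := by
  refine tendsto_nhds_unique ((hD.tendsto_approxLog hg).sub (hD.tendsto_approxLog hh)).norm ?_
  simp only [D.norm_approxLog_sub hg hh]
  exact tendsto_const_nhds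

theorem StrictMul.exists_norm_limLog_sub_le (hD : D.StrictMul) {ε : ℝ} (hε : 0 < ε) :
    ∃ n₀ : ℕ, ∀ n ≥ n₀, ∀ g ∈ D.U, ‖D.limLog g - D.approxLog n g‖ ≤ ε * ‖D.φ g‖ := by
  obtain ⟨n₀, h⟩ := hD.exists_norm_approxLog_sub_le hε
  refine ⟨n₀, fun n hn g hg => ?_⟩
  exact le_of_tendsto ((hD.tendsto_approxLog hg).sub_const _).norm
    (eventually_atTop.2 ⟨n, fun m hm => h n hn m hm g hg⟩)

theorem StrictMul.exists_norm_limLog_sub_sub_le (hD : D.StrictMul) {ε : ℝ} (hε : 0 < ε) :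
    ∃ s > 0, ∀ g ∈ D.U, ∀ h ∈ D.U, ‖D.φ g‖ < s → ‖D.φ h‖ < s →
      ‖D.limLog g - D.limLog h - (D.φ g - D.φ h)‖ ≤ ε * ‖D.φ g - D.φ h‖ := by
  have hp := padic_norm_p_pos (p := p)
  obtain ⟨s, hs, H⟩ := hD (‖(p : ℚ_[p])‖ * min ε 1) (by positivity)
  refine ⟨s, hs, fun g hg h hh hgs hhs => ?_⟩
  refine le_of_tendsto (((hD.tendsto_approxLog hg).sub (hD.tendsto_approxLog hh)).sub_const _).norm
    (Eventually.of_forall fun n => ?_)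
  refine (norm_approxLog_sub_sub H (by positivity) (min_le_right _ _) hg hh hgs hhs n).trans ?_
  gcongr
  exact min_le_left _ _

theorem StrictMul.norm_limLog (hD : D.StrictMul) {g : G} (hg : g ∈ D.U) :
    ‖D.limLog g‖ = ‖D.φ g‖ := by
  simpa [limLog_one, D.map_one] using hD.norm_limLog_sub hg D.U.one_mem

theorem StrictMul.limLog_mem_ball (hD : D.StrictMul) {g : G} (hg : g ∈ D.U) :
    D.limLog g ∈ ball (0 : E) D.r := by
  rw [mem_ball_zero_iff, hD.norm_limLog hg]
  exact D.norm_lt hg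

theorem StrictMul.limLog_pow (hD : D.StrictMul) {g : G} (hg : g ∈ D.U) (m : ℕ) :
    D.limLog (g ^ p ^ m) = (p : ℚ_[p]) ^ m • D.limLog g := by
  refine tendsto_nhds_unique (hD.tendsto_approxLog (D.U.pow_mem hg _)) ?_
  simp only [approxLog_pow]
  exact ((tendsto_add_atTop_iff_nat m).2 (hD.tendsto_approxLog hg)).const_smul _

/-- Injectivity is the isometry property. For surjectivity, `v` is solved for exactly at each finite
level by some `x n`; uniform convergence gives `limLog (x n) → v`, and the isometry property makes
the coordinates of `x n` a Cauchy sequence. -/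
theorem StrictMul.bijOn_limLog (hD : D.StrictMul) : BijOn D.limLog D.U (ball (0 : E) D.r) := by
  refine ⟨fun g hg => hD.limLog_mem_ball hg, fun g hg h hh e => ?_, fun v hv => ?_⟩
  · have := hD.norm_limLog_sub hg hh
    rw [e, sub_self, norm_zero] at this
    exact D.injOn hg hh (sub_eq_zero.1 (norm_eq_zero.1 this.symm))
  · choose x hxU hx using D.exists_approxLog_eq hv
    have hlim : Tendsto (fun n => D.limLog (x n)) atTop (𝓝 v) := by
      rw [Metric.tendsto_atTop]
      intro ε hε
      obtain ⟨n₀, h⟩ := hD.exists_norm_limLog_sub_le hε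
      refine ⟨n₀, fun n hn => ?_⟩
      have h1 := h n hn (x n) (hxU n)
      rw [hx n] at h1
      rw [dist_eq_norm]
      have h2 := (D.norm_lt (hxU n)).trans D.r_lt_one
      exact h1.trans_lt (by nlinarith)
    have hcau : CauchySeq fun n => D.φ (x n) := by
      have hc := hlim.cauchySeq
      rw [Metric.cauchySeq_iff'] at hc ⊢
      intro ε hε
      obtain ⟨N, hN⟩ := hc ε hε
      refine ⟨N, fun n hn => ?_⟩
      rw [dist_eq_norm, ← hD.norm_limLog_sub (hxU n) (hxU N), ← dist_eq_norm]
      exact hN n hn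
    obtain ⟨y, hy⟩ := cauchySeq_tendsto_of_complete hcau
    have hyb : y ∈ ball (0 : E) D.r :=
      (IsUltrametricDist.isClosed_ball (0 : E) D.r).mem_of_tendsto hy
        (Eventually.of_forall fun n => D.map_mem_ball (hxU n))
    refine ⟨D.φ.symm y, D.symm_mem hyb, ?_⟩
    refine tendsto_nhds_unique ?_ hlim
    rw [tendsto_iff_norm_sub_tendsto_zero]
    have h1 := tendsto_iff_norm_sub_tendsto_zero.1 hy
    refine h1.congr fun n => ?_
    rw [hD.norm_limLog_sub (hxU n) (D.symm_mem hyb), D.right_inv hyb]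

theorem StrictMul.hasStrictFDerivAt_limLog (hD : D.StrictMul) :
    HasStrictFDerivAt (fun x => D.limLog (D.φ.symm x)) (ContinuousLinearMap.id ℚ_[p] E) 0 := by
  rw [hasStrictFDerivAt_iff_isLittleO, Asymptotics.isLittleO_iff]
  intro ε hε
  obtain ⟨s, hs, H⟩ := hD.exists_norm_limLog_sub_sub_le hε
  have hr := D.r_pos
  filter_upwards [ball_mem_nhds ((0 : E), (0 : E)) (lt_min hs hr)] with q hq
  obtain ⟨x, y⟩ := q
  rw [← ball_prod_same, mem_prod, mem_ball_zero_iff, mem_ball_zero_iff] at hq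
  obtain ⟨hx, hy⟩ := hq
  simp only [lt_min_iff] at hx hy
  have hxb : x ∈ ball (0 : E) D.r := mem_ball_zero_iff.2 hx.2
  have hyb : y ∈ ball (0 : E) D.r := mem_ball_zero_iff.2 hy.2
  have h1 := H _ (D.symm_mem hxb) _ (D.symm_mem hyb)
  rw [D.right_inv hxb, D.right_inv hyb] at h1
  exact h1 hx.1 hy.1

theorem StrictMul.tendsto_limLog (hD : D.StrictMul) : Tendsto D.limLog (𝓝 1) (𝓝 0) := by
  rw [tendsto_zero_iff_norm_tendsto_zero]
  have h1 := (D.continuousAt_φ D.U.one_mem).tendsto.norm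
  rw [D.map_one, norm_zero] at h1
  refine h1.congr' ?_
  filter_upwards [D.U_mem_nhds D.U.one_mem] with g hg
  exact (hD.norm_limLog hg).symm

end Ultrametric

end AdaptedChart

end PadicLie

namespace PadicLie

universe u v w

theorem IsSC1LieGroup.exists_hasStrictFDerivAt_mul_left {𝕜 : Type} [NontriviallyNormedField 𝕜]
    {E : Type u} [NormedAddCommGroup E] [NormedSpace 𝕜 E] {G : Type v} [Group G]
    [TopologicalSpace G] [IsTopologicalGroup G] [ChartedSpace E G] (hG : IsSC1LieGroup 𝕜 E G)
    {e e' : OpenPartialHomeomorph G E} (he : e ∈ atlas E G) (he' : e' ∈ atlas E G) (g : G) {y : E}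
    (hy : y ∈ e.target) (hgy : g * e.symm y ∈ e'.source) :
    ∃ A : E →L[𝕜] E, HasStrictFDerivAt (fun y => e' (g * e.symm y)) A y := by
  set d := chartAt E g with hd
  have hgd : g ∈ d.source := mem_chart_source E g
  obtain ⟨M, hM⟩ := hG.mul d (chart_mem_atlas E g) e he e' he' (d g, y)
    ⟨d.map_source hgd, hy, by simpa [d.left_inv hgd] using hgy⟩
  have h1 := HasStrictFDerivAt.comp (f := fun y => (d g, y)) y hM
    ((hasStrictFDerivAt_const (𝕜 := 𝕜) (d g) y).prodMk (hasStrictFDerivAt_id y))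
  simp only [d.left_inv hgd] at h1
  exact ⟨_, h1⟩

variable {p : ℕ} [Fact p.Prime]

namespace AdaptedChart

variable {k : ℕ∞} {E : Type u} [NormedAddCommGroup E]
    [NormedSpace ℚ_[p] E] {G : Type v} [Group G] [TopologicalSpace G]
    [ChartedSpace E G] {D : AdaptedChart p k E G} [IsUltrametricDist E] [CompleteSpace E]
    [IsTopologicalGroup G] [T2Space G]

theorem exists_isPadicHom (D : AdaptedChart p k E G) {g : G} (hg : g ∈ D.U) :
    ∃ ξ : ℚ_[p] → G, IsPadicHom p (PadicInt.subring p).toAddSubgroup ξ ∧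
      (∀ z, ‖z‖ ≤ 1 → ξ z ∈ D.U) ∧ ξ 1 = g ∧
      ∀ z w, ‖z‖ ≤ 1 → ‖w‖ ≤ 1 → ‖D.φ (ξ z) - D.φ (ξ w)‖ ≤ ‖z - w‖ * ‖D.φ g‖ := by
  obtain ⟨η, hc, hU, hnat, hadd, hlip⟩ := D.exists_oneParam hg
  obtain ⟨ξ, hξ, hξη⟩ := isPadicHom_extend hc hadd
  refine ⟨ξ, hξ, fun z hz => ?_, ?_, fun z w hz hw => ?_⟩
  · rw [hξη ⟨z, hz⟩]
    exact hU _
  · have := hξη 1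
    rw [PadicInt.coe_one] at this
    rw [this]
    simpa using hnat 1
  · rw [hξη ⟨z, hz⟩, hξη ⟨w, hw⟩]
    exact hlip _ _

/-! ### Derivatives of one-parameter subgroups. -/

section Hom

variable {ξ : ℚ_[p] → G} (hξ : IsPadicHom p (PadicInt.subring p).toAddSubgroup ξ)
  (hU : ∀ z, ‖z‖ ≤ 1 → ξ z ∈ D.U)

include hξ hU

theorem norm_hom_sub_le {z w : ℚ_[p]} (hz : ‖z‖ ≤ 1) (hw : ‖w‖ ≤ 1) :
    ‖D.φ (ξ z) - D.φ (ξ w)‖ ≤ ‖z - w‖ := by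
  obtain ⟨ξ', hξ', -, h1, h⟩ := D.exists_isPadicHom (hU 1 (by simp))
  rw [hξ.eqOn_of_map_one hξ' h1.symm hz, hξ.eqOn_of_map_one hξ' h1.symm hw]
  refine (h z w hz hw).trans (mul_le_of_le_one_right (norm_nonneg _) ?_)
  exact ((D.norm_lt (hU 1 (by simp))).trans D.r_lt_one).le

theorem norm_hom_le {z : ℚ_[p]} (hz : ‖z‖ ≤ 1) : ‖D.φ (ξ z)‖ ≤ ‖z‖ := by
  simpa [hξ.map_zero, D.map_one] using norm_hom_sub_le hξ hU hz (w := 0) (by simp)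

/-- For natural `u` this is the power estimate for `ξ 1 ^ pⁿ` against `1`. Both sides are continuous
in `u`, so density of `ℕ` in `ℤ_p` finishes. -/
theorem norm_hom_pow_mul_sub {ε s : ℝ} (H : MulEstimate D.φ ε s) (hε0 : 0 ≤ ε) (hε1 : ε ≤ 1)
    {n : ℕ} (hn : ‖(p : ℚ_[p])‖ ^ n * D.r ≤ s) (u : ℤ_[p]) :
    ‖D.φ (ξ ((p : ℚ_[p]) ^ n * u)) - (u : ℚ_[p]) • D.φ (ξ 1 ^ p ^ n)‖ ≤
      ε * ‖D.φ (ξ 1 ^ p ^ n)‖ := by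
  have hp1 : ‖(p : ℚ_[p]) ^ n‖ ≤ 1 := by
    rw [norm_pow]
    exact pow_le_one₀ (norm_nonneg _) (IsUltrametricDist.norm_natCast_le_one ℚ_[p] p)
  have hle : ∀ u : ℤ_[p], ‖(p : ℚ_[p]) ^ n * u‖ ≤ 1 := fun u => by
    rw [norm_mul]
    exact mul_le_one₀ hp1 (norm_nonneg _) u.2
  have hg : ξ 1 ∈ D.U := hU 1 (by simp)
  have hgs : ‖D.φ (ξ 1 ^ p ^ n)‖ < s := by
    rw [D.norm_pow_pow hg]
    refine lt_of_lt_of_le ?_ hn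
    have := pow_pos (padic_norm_p_pos (p := p)) n
    have := D.norm_lt hg
    gcongr
  have hpow : ξ ((p : ℚ_[p]) ^ n) = ξ 1 ^ p ^ n := by
    simpa using hξ.map_pow_mul (z := 1) (by simp) n
  refine PadicInt.denseRange_natCast.induction_on (p := fun u : ℤ_[p] =>
    ‖D.φ (ξ ((p : ℚ_[p]) ^ n * u)) - (u : ℚ_[p]) • D.φ (ξ 1 ^ p ^ n)‖ ≤
      ε * ‖D.φ (ξ 1 ^ p ^ n)‖) u ?_ fun m => ?_
  · refine isClosed_le ?_ continuous_const
    refine Continuous.norm (Continuous.sub ?_ ?_)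
    · refine (LipschitzWith.of_dist_le_mul (K := 1) fun z w => ?_).continuous
      rw [dist_eq_norm, dist_eq_norm, NNReal.coe_one, one_mul]
      refine (norm_hom_sub_le hξ hU (hle z) (hle w)).trans ?_
      rw [← mul_sub, norm_mul, PadicInt.norm_def]
      push_cast
      exact mul_le_of_le_one_left (norm_nonneg _) hp1
    · exact continuous_subtype_val.smul continuous_const
  · have h1 := H.pow_sub (p := p) hε0 hε1 D.one_mem_source D.map_one
      (D.mem_source.2 (D.U.pow_mem hg (p ^ n))) hgs D.one_mem_source
      (by rw [D.map_one, norm_zero]; exact (norm_nonneg _).trans_lt hgs) m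
    have e := hξ.map_natCast_mul (z := (p : ℚ_[p]) ^ n) hp1 m
    rw [one_pow, D.map_one, sub_zero, sub_zero] at h1
    rw [PadicInt.coe_natCast, mul_comm, e, hpow]
    exact h1

theorem StrictMul.exists_norm_hom_sub_le (hD : D.StrictMul) {ε : ℝ} (hε : 0 < ε) :
    ∃ δ > 0, ∀ z, ‖z‖ < δ → ‖D.φ (ξ z) - z • D.limLog (ξ 1)‖ ≤ ε * ‖z‖ := by
  have hp := padic_norm_p_pos (p := p)
  have hg : ξ 1 ∈ D.U := hU 1 (by simp)
  have hg1 : ‖D.φ (ξ 1)‖ ≤ 1 := ((D.norm_lt hg).trans D.r_lt_one).le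
  obtain ⟨s, hs, H⟩ := hD (min ε 1) (by positivity)
  obtain ⟨n₁, h₁⟩ := D.exists_pow_mul_le hs
  obtain ⟨n₂, h₂⟩ := hD.exists_norm_limLog_sub_le hε
  -- A nonzero `z` below this bound is `pⁿ u` with `u` a unit and `n` past both thresholds, so `φ (ξ
  -- z) ≈ u φ (ξ 1 ^ pⁿ) ≈ z limLog (ξ 1)`.
  refine ⟨‖(p : ℚ_[p])‖ ^ max n₁ n₂, pow_pos hp _, fun z hz => ?_⟩
  rcases eq_or_ne z 0 with rfl | hz0
  · simp [hξ.map_zero, D.map_one]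
  have hz1 : ‖z‖ ≤ 1 := hz.le.trans
    (pow_le_one₀ hp.le (IsUltrametricDist.norm_natCast_le_one ℚ_[p] p))
  obtain ⟨u, n, hzu, hu, hzn⟩ := exists_padicInt_eq_unit_mul_pow (z := ⟨z, hz1⟩)
    (fun h => hz0 (congrArg Subtype.val h))
  have hzn' : ‖z‖ = ‖(p : ℚ_[p])‖ ^ n := hzn
  have hzu' : z = (p : ℚ_[p]) ^ n * u := by
    have := congrArg Subtype.val hzu
    rw [mul_comm]
    simpa using this
  have hn : max n₁ n₂ < n := by
    rw [hzn'] at hz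
    exact (pow_lt_pow_iff_right_of_lt_one₀ hp Padic.norm_p_lt_one).1 hz
  have e1 := norm_hom_pow_mul_sub hξ hU H (by positivity) (min_le_right _ _)
    (h₁ n ((le_max_left _ _).trans hn.le)) u
  have e2 := h₂ n ((le_max_right _ _).trans hn.le) (ξ 1) hg
  rw [D.norm_pow_pow hg, ← hzn'] at e1
  rw [← hzu'] at e1
  have e3 : (u : ℚ_[p]) • D.φ (ξ 1 ^ p ^ n) - z • D.limLog (ξ 1) =
      -(z • (D.limLog (ξ 1) - D.approxLog n (ξ 1))) := by
    rw [approxLog, smul_sub, neg_sub, smul_smul]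
    congr 2
    rw [hzu']
    have := pow_ne_zero n (padic_p_ne_zero (p := p))
    field_simp
  have e4 := IsUltrametricDist.norm_add_le_max (D.φ (ξ z) - (u : ℚ_[p]) • D.φ (ξ 1 ^ p ^ n))
    ((u : ℚ_[p]) • D.φ (ξ 1 ^ p ^ n) - z • D.limLog (ξ 1))
  rw [sub_add_sub_cancel] at e4
  refine e4.trans (max_le (e1.trans ?_) ?_)
  · calc _ ≤ ε * (‖z‖ * 1) := by gcongr; exact min_le_left _ _
      _ = _ := by rw [mul_one]
  · rw [e3, norm_neg, norm_smul]
    calc _ ≤ ‖z‖ * (ε * 1) := by gcongr; exact e2.trans (by gcongr)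
      _ = _ := by ring

theorem StrictMul.hasStrictDerivAt_hom (hD : D.StrictMul) :
    HasStrictDerivAt (fun z => D.φ (ξ z)) (D.limLog (ξ 1)) 0 := by
  rw [hasStrictDerivAt_iff_hasStrictFDerivAt, hasStrictFDerivAt_iff_isLittleO,
    Asymptotics.isLittleO_iff]
  intro ε hε
  obtain ⟨s, hs, H⟩ := hD ε hε
  obtain ⟨δ, hδ, h⟩ := StrictMul.exists_norm_hom_sub_le hξ hU hD hε
  set ρ := min (min s δ) 1 with hρ
  have hρ0 : 0 < ρ := by positivity
  filter_upwards [ball_mem_nhds ((0 : ℚ_[p]), (0 : ℚ_[p])) hρ0] with q hq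
  obtain ⟨z, w⟩ := q
  rw [← ball_prod_same, mem_prod, mem_ball_zero_iff, mem_ball_zero_iff] at hq
  obtain ⟨hz, hw⟩ := hq
  simp only at hz hw
  have hzw : ‖z - w‖ < ρ := by
    have := IsUltrametricDist.norm_add_le_max z (-w)
    rw [← sub_eq_add_neg, norm_neg] at this
    exact this.trans_lt (max_lt hz hw)
  have hρs : ρ ≤ s := (min_le_left _ _).trans (min_le_left _ _)
  have hρδ : ρ ≤ δ := (min_le_left _ _).trans (min_le_right _ _)
  have hρ1 : ρ ≤ 1 := min_le_right _ _
  have hw1 := hw.le.trans hρ1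
  have hzw1 := hzw.le.trans hρ1
  have hnw : ‖D.φ (ξ w)‖ < s := (norm_hom_le hξ hU hw1).trans_lt (hw.trans_le hρs)
  have hnzw : ‖D.φ (ξ (z - w))‖ < s := (norm_hom_le hξ hU hzw1).trans_lt (hzw.trans_le hρs)
  -- Since `ξ z = ξ w ξ (z - w)`, the multiplication estimate replaces `φ (ξ z) - φ (ξ w)` by `φ (ξ
  -- (z - w))`, which upgrades the derivative at `0` to a strict one.
  have h1 := (H _ (D.mem_source.2 (hU w hw1)) _ (D.mem_source.2 (hU w hw1)) _
    (D.mem_source.2 (hU _ hzw1)) 1 D.one_mem_source hnw hnw hnzw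
    (by rw [D.map_one, norm_zero]; exact hs)).2
  rw [← hξ.map_add_of_norm_le hw1 hzw1, add_sub_cancel, mul_one, D.map_one, sub_self, sub_zero,
    sub_zero, norm_zero, max_eq_right (norm_nonneg _)] at h1
  have h2 := h (z - w) (hzw.trans_le hρδ)
  have h3 := IsUltrametricDist.norm_add_le_max (D.φ (ξ z) - D.φ (ξ w) - D.φ (ξ (z - w)))
    (D.φ (ξ (z - w)) - (z - w) • D.limLog (ξ 1))
  rw [sub_add_sub_cancel] at h3
  simp only [ContinuousLinearMap.toSpanSingleton_apply]
  refine h3.trans (max_le (h1.trans ?_) h2)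
  gcongr
  exact norm_hom_le hξ hU hzw1

theorem StrictMul.hasStrictDerivAt_chartAt_hom (hD : D.StrictMul) (hk : 1 ≤ k) :
    HasStrictDerivAt (fun z => chartAt E (1 : G) (ξ z)) (D.limLog (ξ 1)) 0 := by
  have h1 := StrictMul.hasStrictDerivAt_hom hξ hU hD
  have h2 : HasStrictFDerivAt (fun y => chartAt E (1 : G) (D.φ.symm y))
      (ContinuousLinearMap.id ℚ_[p] E) (D.φ (ξ 0)) := by
    rw [hξ.map_zero, D.map_one]
    exact D.hasStrictFDerivAt_chart_symm hk
  have h3 := h2.comp_hasStrictDerivAt (0 : ℚ_[p]) h1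
  refine h3.congr_of_eventuallyEq ?_
  filter_upwards [closedBall_mem_nhds (0 : ℚ_[p]) one_pos] with z hz
  simp only [Function.comp]
  rw [D.left_inv (hU z (mem_closedBall_zero_iff.1 hz))]

/-- Both sides are the derivative at `0` of `t ↦ φ (ξ (t z))`. -/
theorem StrictMul.limLog_hom (hD : D.StrictMul) {z : ℚ_[p]} (hz : ‖z‖ ≤ 1) :
    D.limLog (ξ z) = z • D.limLog (ξ 1) := by
  have hm : ∀ w : ℚ_[p], ‖w‖ ≤ 1 → ‖w * z‖ ≤ 1 := fun w hw => by
    rw [norm_mul]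
    exact mul_le_one₀ hw (norm_nonneg _) hz
  have h1 := (StrictMul.hasStrictDerivAt_hom (hξ.comp_mul hz) (fun w hw => hU _ (hm w hw))
    hD).hasDerivAt
  rw [one_mul] at h1
  have h2 : HasDerivAt (fun t : ℚ_[p] => t * z) z 0 := by
    simpa using (hasDerivAt_id (0 : ℚ_[p])).mul_const z
  have h3 := HasDerivAt.scomp_of_eq (0 : ℚ_[p])
    (StrictMul.hasStrictDerivAt_hom hξ hU hD).hasDerivAt h2 (by simp)
  exact h1.unique h3

/-- Near `w` one has `ξ z = ξ w ξ (z - w)`, so strict differentiability at `0` is transported by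
left translation. -/
theorem StrictMul.isSC1_hom (hD : D.StrictMul) (hk : 1 ≤ k) (hG : IsSC1LieGroup ℚ_[p] E G)
    {e : OpenPartialHomeomorph G E} (he : e ∈ atlas E G) :
    IsSC1 ℚ_[p] (fun z => e (ξ z)) {z | ‖z‖ ≤ 1 ∧ ξ z ∈ e.source} := by
  rintro w ⟨hw, hwe⟩
  set c := chartAt E (1 : G) with hc
  have hc1 : (1 : G) ∈ c.source := mem_chart_source E 1
  obtain ⟨A, hA⟩ := hG.exists_hasStrictFDerivAt_mul_left (chart_mem_atlas E 1) he (ξ w)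
    (c.map_source hc1) (by rwa [← hc, c.left_inv hc1, mul_one])
  have h1 := (StrictMul.hasStrictDerivAt_chartAt_hom hξ hU hD hk).hasStrictFDerivAt
  have h2 : HasStrictFDerivAt (fun z : ℚ_[p] => z - w) (ContinuousLinearMap.id ℚ_[p] ℚ_[p]) w :=
    (hasStrictFDerivAt_id w).sub_const w
  rw [← sub_self w] at h1
  have h3 := HasStrictFDerivAt.comp (f := fun z => z - w) w h1 h2
  have hA' : HasStrictFDerivAt (fun y => e (ξ w * c.symm y)) A (c (ξ (w - w))) := by
    rw [sub_self, hξ.map_zero]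
    exact hA
  have h4 := HasStrictFDerivAt.comp (f := fun z => c (ξ (z - w))) w hA' h3
  refine ⟨_, h4.congr_of_eventuallyEq ?_⟩
  have hcont : Tendsto (fun z => ξ (z - w)) (𝓝 w) (𝓝 1) := by
    have h5 : ContinuousAt ξ 0 := hξ.continuousOn.continuousAt (hξ.isOpen.mem_nhds (zero_mem _))
    have h6 : Tendsto (fun z => z - w) (𝓝 w) (𝓝 0) := by
      have : Continuous fun z => z - w := by fun_prop
      simpa using this.tendsto w
    have h7 := h5.tendsto.comp h6
    rwa [hξ.map_zero] at h7
  have hball : ∀ᶠ z in 𝓝 w, ‖z - w‖ ≤ 1 := by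
    filter_upwards [closedBall_mem_nhds w one_pos] with z hz
    rwa [← dist_eq_norm]
  filter_upwards [hcont.eventually (c.open_source.mem_nhds hc1), hball] with z hz hz1
  rw [c.left_inv hz, ← hξ.map_add_of_norm_le hw hz1, add_sub_cancel]

end Hom

/-! ### `log_G` and `exp_G`. -/

variable {g : G} {v : E}

theorem StrictMul.isLog_limLog (hD : D.StrictMul) (hg : g ∈ D.U) : D.IsLog g (D.limLog g) := by
  obtain ⟨ξ, hξ, hU, h1, -⟩ := D.exists_isPadicHom hg
  refine ⟨ξ, hξ, hU, h1, ?_⟩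
  rw [← h1]
  exact (StrictMul.hasStrictDerivAt_hom hξ hU hD).hasDerivAt

/-- The choice hidden in `log` is harmless: every admissible homomorphism through `g` has derivative
`limLog g`. -/
theorem StrictMul.log_eq (hD : D.StrictMul) (hg : g ∈ D.U) : D.log g = D.limLog g := by
  have hex : ∃ v, D.IsLog g v := ⟨_, hD.isLog_limLog hg⟩
  rw [log, dif_pos hex]
  obtain ⟨ξ, hξ, hU, h1, h2⟩ := hex.choose_spec
  have h3 := (StrictMul.hasStrictDerivAt_hom hξ hU hD).hasDerivAt
  rw [h1] at h3
  exact h2.unique h3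

theorem StrictMul.bijOn_log (hD : D.StrictMul) : BijOn D.log D.U (ball (0 : E) D.r) :=
  hD.bijOn_limLog.congr fun _ hg => (hD.log_eq hg).symm

theorem StrictMul.exp_mem (hD : D.StrictMul) (hv : v ∈ ball (0 : E) D.r) : D.exp v ∈ D.U :=
  Function.invFunOn_mem (hD.bijOn_log.surjOn hv)

theorem StrictMul.limLog_exp (hD : D.StrictMul) (hv : v ∈ ball (0 : E) D.r) :
    D.limLog (D.exp v) = v := by
  rw [← hD.log_eq (hD.exp_mem hv)]
  exact Function.invFunOn_eq (hD.bijOn_log.surjOn hv)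

theorem StrictMul.exp_limLog (hD : D.StrictMul) (hg : g ∈ D.U) : D.exp (D.limLog g) = g :=
  hD.bijOn_limLog.injOn (hD.exp_mem (hD.limLog_mem_ball hg)) hg
    (hD.limLog_exp (hD.limLog_mem_ball hg))

theorem StrictMul.norm_exp_sub (hD : D.StrictMul) {w : E} (hv : v ∈ ball (0 : E) D.r)
    (hw : w ∈ ball (0 : E) D.r) : ‖D.φ (D.exp v) - D.φ (D.exp w)‖ = ‖v - w‖ := by
  rw [← hD.norm_limLog_sub (hD.exp_mem hv) (hD.exp_mem hw), hD.limLog_exp hv, hD.limLog_exp hw]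

theorem StrictMul.norm_exp (hD : D.StrictMul) (hv : v ∈ ball (0 : E) D.r) :
    ‖D.φ (D.exp v)‖ = ‖v‖ := by
  rw [← hD.norm_limLog (hD.exp_mem hv), hD.limLog_exp hv]

theorem StrictMul.continuousAt_exp (hD : D.StrictMul) (hv : v ∈ ball (0 : E) D.r) :
    ContinuousAt D.exp v := by
  have h1 : ContinuousAt (fun w => D.φ (D.exp w)) v := by
    rw [ContinuousAt, tendsto_iff_norm_sub_tendsto_zero]
    have h2 : Tendsto (fun w => ‖w - v‖) (𝓝 v) (𝓝 0) :=
      tendsto_iff_norm_sub_tendsto_zero.1 tendsto_id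
    refine h2.congr' ?_
    filter_upwards [isOpen_ball.mem_nhds hv] with w hw
    exact (hD.norm_exp_sub hw hv).symm
  have h3 : ContinuousAt D.φ.symm (D.φ (D.exp v)) :=
    D.continuousAt_symm (D.map_mem_ball (hD.exp_mem hv))
  refine (ContinuousAt.comp (f := fun w => D.φ (D.exp w)) h3 h1).congr ?_
  filter_upwards [isOpen_ball.mem_nhds hv] with w hw
  exact D.left_inv (hD.exp_mem hw)

theorem StrictMul.exp_smul (hD : D.StrictMul) {ξ : ℚ_[p] → G}
    (hξ : IsPadicHom p (PadicInt.subring p).toAddSubgroup ξ) (hU : ∀ z, ‖z‖ ≤ 1 → ξ z ∈ D.U)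
    {z : ℚ_[p]} (hz : ‖z‖ ≤ 1) : D.exp (z • D.limLog (ξ 1)) = ξ z := by
  rw [← StrictMul.limLog_hom hξ hU hD hz, hD.exp_limLog (hU z hz)]

/-- The one-parameter subgroup `z ↦ exp (z v)`. -/
theorem StrictMul.exists_hom_exp (hD : D.StrictMul) (hv : v ∈ ball (0 : E) D.r) :
    ∃ ξ : ℚ_[p] → G, IsPadicHom p (PadicInt.subring p).toAddSubgroup ξ ∧
      (∀ z, ‖z‖ ≤ 1 → ξ z ∈ D.U) ∧ D.limLog (ξ 1) = v ∧ ∀ z, ‖z‖ ≤ 1 → D.exp (z • v) = ξ z := by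
  obtain ⟨ξ, hξ, hU, h1, -⟩ := D.exists_isPadicHom (hD.exp_mem hv)
  have h2 : D.limLog (ξ 1) = v := by rw [h1, hD.limLog_exp hv]
  refine ⟨ξ, hξ, hU, h2, fun z hz => ?_⟩
  conv_lhs => rw [← h2]
  exact hD.exp_smul hξ hU hz

theorem StrictMul.isExpMap (hD : D.StrictMul) (hk : 1 ≤ k) (hG : IsSC1LieGroup ℚ_[p] E G) :
    IsExpMap p (ball (0 : E) D.r) D.exp where
  nhds_zero := ball_mem_nhds 0 D.r_pos
  balanced := balanced_ball_zero
  image_nhds_one := by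
    have : D.exp '' ball (0 : E) D.r = D.U := by
      refine Subset.antisymm ?_ fun g hg => ⟨_, hD.limLog_mem_ball hg, hD.exp_limLog hg⟩
      rintro _ ⟨v, hv, rfl⟩
      exact hD.exp_mem hv
    rw [this]
    exact D.U_mem_nhds D.U.one_mem
  continuousAt_zero := hD.continuousAt_exp (mem_ball_self D.r_pos)
  map_add x hx z w hz hw := by
    obtain ⟨ξ, hξ, -, -, h⟩ := hD.exists_hom_exp hx
    have hzw : ‖z + w‖ ≤ 1 := (IsUltrametricDist.norm_add_le_max z w).trans (max_le hz hw)
    rw [h _ hzw, h _ hz, h _ hw, hξ.map_add_of_norm_le hz hw]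
  class_C1 x hx := by
    obtain ⟨ξ, hξ, hU, -, h⟩ := hD.exists_hom_exp hx
    have h' : ∀ z ∈ closedBall (0 : ℚ_[p]) 1, D.exp (z • x) = ξ z := fun z hz =>
      h z (mem_closedBall_zero_iff.1 hz)
    have hcont : ContinuousOn ξ (closedBall 0 1) := hξ.continuousOn.mono fun z hz => by
      simpa [PadicInt.mem_subring_iff] using hz
    refine ⟨hcont.congr h', fun e he e' he' => ?_⟩
    rw [chartedSpaceSelf_atlas] at he
    subst he
    set S : Set ℚ_[p] := {z | ‖z‖ ≤ 1 ∧ ξ z ∈ e'.source} with hS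
    have hSo : IsOpen S := by
      have := hcont.isOpen_inter_preimage
        (IsUltrametricDist.isOpen_closedBall (0 : ℚ_[p]) one_ne_zero) e'.open_source
      convert this using 1
      ext z
      simp [hS]
    have h1 := (StrictMul.isSC1_hom hξ hU hD hk hG he').isCn_one hSo
    have hsub : {y : ℚ_[p] | y ∈ (OpenPartialHomeomorph.refl ℚ_[p]).target ∧
        (OpenPartialHomeomorph.refl ℚ_[p]).symm y ∈ closedBall (0 : ℚ_[p]) 1 ∧
        D.exp ((OpenPartialHomeomorph.refl ℚ_[p]).symm y • x) ∈ e'.source} ⊆ S := by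
      rintro y ⟨-, hy, hye⟩
      refine ⟨mem_closedBall_zero_iff.1 hy, ?_⟩
      rw [← h' y hy]
      exact hye
    intro n hn
    have hn1 : n ≤ 1 := by exact_mod_cast hn
    interval_cases n
    · exact isCn_congr (IsCn.mono (n := 0) h1.1 hsub) fun y hy => by
        simpa using congrArg e' (h' y hy.2.1)
    · exact isCn_congr (h1.mono hsub) fun y hy => by
        simpa using congrArg e' (h' y hy.2.1)
  hasDerivAt x hx := by
    obtain ⟨ξ, hξ, hU, h1, h⟩ := hD.exists_hom_exp hx
    have h2 := (StrictMul.hasStrictDerivAt_chartAt_hom hξ hU hD hk).hasDerivAt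
    rw [h1] at h2
    refine h2.congr_of_eventuallyEq ?_
    filter_upwards [closedBall_mem_nhds (0 : ℚ_[p]) one_pos] with z hz
    rw [h z (mem_closedBall_zero_iff.1 hz)]

/-! ### The limit formula for sums. -/

section Root

variable {x y : E}

/-- The norm bound is exactly the condition for a `pⁿ`-th root in `U` to exist. -/
theorem StrictMul.exp_mul_exp_mem (hD : D.StrictMul) (hx : x ∈ ball (0 : E) D.r)
    (hy : y ∈ ball (0 : E) D.r) (n : ℕ) :
    D.exp ((p : ℚ_[p]) ^ n • x) * D.exp ((p : ℚ_[p]) ^ n • y) ∈ D.U ∧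
    ‖D.φ (D.exp ((p : ℚ_[p]) ^ n • x) * D.exp ((p : ℚ_[p]) ^ n • y))‖ <
      ‖(p : ℚ_[p])‖ ^ n * D.r := by
  have h1 := D.pow_smul_mem_ball hx n
  have h2 := D.pow_smul_mem_ball hy n
  refine ⟨D.U.mul_mem (hD.exp_mem h1) (hD.exp_mem h2), ?_⟩
  refine (D.norm_mul_le (hD.exp_mem h1) (hD.exp_mem h2)).trans_lt ?_
  rw [hD.norm_exp h1, hD.norm_exp h2, norm_smul, norm_smul, norm_pow]
  rw [mem_ball_zero_iff] at hx hy
  have := pow_pos (padic_norm_p_pos (p := p)) n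
  refine max_lt ?_ ?_ <;> gcongr

theorem StrictMul.existsUnique_root (hD : D.StrictMul) (hx : x ∈ ball (0 : E) D.r)
    (hy : y ∈ ball (0 : E) D.r) (n : ℕ) :
    ∃! g : G, g ∈ D.U ∧
      g ^ (p ^ n) = D.exp ((p : ℚ_[p]) ^ n • x) * D.exp ((p : ℚ_[p]) ^ n • y) := by
  obtain ⟨h1, h2⟩ := hD.exp_mul_exp_mem hx hy n
  obtain ⟨g, hg, hgn⟩ := D.exists_root h1 n h2
  exact ⟨g, ⟨hg, hgn⟩, fun g' hg' => D.root_unique hg'.1 hg n (hg'.2.trans hgn.symm)⟩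

theorem StrictMul.root_exp_mem (hD : D.StrictMul) (hx : x ∈ ball (0 : E) D.r)
    (hy : y ∈ ball (0 : E) D.r) (n : ℕ) :
    D.root n (D.exp ((p : ℚ_[p]) ^ n • x) * D.exp ((p : ℚ_[p]) ^ n • y)) ∈ D.U :=
  (D.root_spec (hD.exp_mul_exp_mem hx hy n).1 n (hD.exp_mul_exp_mem hx hy n).2).1

theorem StrictMul.tendsto_log_root (hD : D.StrictMul) (hx : x ∈ ball (0 : E) D.r)
    (hy : y ∈ ball (0 : E) D.r) :
    Tendsto (fun n : ℕ => D.log (D.root n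
      (D.exp ((p : ℚ_[p]) ^ n • x) * D.exp ((p : ℚ_[p]) ^ n • y)))) atTop (𝓝 (x + y)) := by
  rw [Metric.tendsto_atTop]
  intro ε hε
  obtain ⟨s, hs, H⟩ := hD (ε / 2) (by positivity)
  obtain ⟨s', hs', H'⟩ := hD.exists_norm_limLog_sub_sub_le (ε := ε / 2) (by positivity)
  obtain ⟨n₀, hn₀⟩ := D.exists_pow_mul_le (s := min s s') (by positivity)
  refine ⟨n₀, fun n hn => ?_⟩
  have hx' := D.pow_smul_mem_ball hx n
  have hy' := D.pow_smul_mem_ball hy n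
  obtain ⟨hmU, hmn⟩ := hD.exp_mul_exp_mem hx hy n
  obtain ⟨hrU, hrn⟩ := D.root_spec hmU n hmn
  set a := D.exp ((p : ℚ_[p]) ^ n • x) with ha
  set b := D.exp ((p : ℚ_[p]) ^ n • y) with hb
  have haU : a ∈ D.U := hD.exp_mem hx'
  have hbU : b ∈ D.U := hD.exp_mem hy'
  have hpn := pow_pos (padic_norm_p_pos (p := p)) n
  have hpn0 := pow_ne_zero n (padic_p_ne_zero (p := p))
  have hna : ‖D.φ a‖ < ‖(p : ℚ_[p])‖ ^ n * D.r := by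
    rw [hD.norm_exp hx', norm_smul, norm_pow]
    rw [mem_ball_zero_iff] at hx
    gcongr
  have hnb : ‖D.φ b‖ < ‖(p : ℚ_[p])‖ ^ n * D.r := by
    rw [hD.norm_exp hy', norm_smul, norm_pow]
    rw [mem_ball_zero_iff] at hy
    gcongr
  have hlt : ∀ {t : ℝ}, t < ‖(p : ℚ_[p])‖ ^ n * D.r → t < s ∧ t < s' := fun ht =>
    lt_min_iff.1 (ht.trans_le (hn₀ n hn))
  have hlin : ∀ g ∈ D.U, ‖D.φ g‖ < ‖(p : ℚ_[p])‖ ^ n * D.r →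
      ‖D.limLog g - D.φ g‖ ≤ ε / 2 * ‖(p : ℚ_[p])‖ ^ n := by
    intro g hg hgn
    have h1 := H' g hg 1 D.U.one_mem (hlt hgn).2 (by rwa [D.map_one, norm_zero])
    rw [limLog_one, D.map_one, sub_zero, sub_zero] at h1
    refine h1.trans ?_
    have := D.r_lt_one
    gcongr
    nlinarith
  have h1 := (H.norm_sub_sub_le D.one_mem_source D.map_one (D.mem_source.2 haU)
    (D.mem_source.2 hbU) (hlt hna).1 (hlt hnb).1).2
  have h1' : ‖D.φ (a * b) - D.φ a - D.φ b‖ ≤ ε / 2 * ‖(p : ℚ_[p])‖ ^ n := by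
    refine h1.trans ?_
    have := D.r_lt_one
    gcongr
    refine max_le ?_ ?_ <;> nlinarith
  have h2 := hlin _ hmU hmn
  have h3 := hlin a haU hna
  have h4 := hlin b hbU hnb
  -- The error splits into the nonlinearity of `limLog` at `a b`, `a` and `b` and the failure of `φ`
  -- to be additive. Each term is at most `ε / 2 * ‖p‖ⁿ`, and the prefactor `p⁻ⁿ` cancels the power.
  have e : D.log (D.root n (a * b)) - (x + y) =
      ((p : ℚ_[p]) ^ n)⁻¹ • ((D.limLog (a * b) - D.φ (a * b)) +
        ((D.φ (a * b) - D.φ a - D.φ b) + (-(D.limLog a - D.φ a) + -(D.limLog b - D.φ b)))) := by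
    have e1 : D.log (D.root n (a * b)) = ((p : ℚ_[p]) ^ n)⁻¹ • D.limLog (a * b) := by
      rw [hD.log_eq hrU]
      conv_rhs => rw [← hrn]
      rw [hD.limLog_pow hrU, smul_smul, inv_mul_cancel₀ hpn0, one_smul]
    have e2 : x + y = ((p : ℚ_[p]) ^ n)⁻¹ • (D.limLog a + D.limLog b) := by
      rw [ha, hb, hD.limLog_exp hx', hD.limLog_exp hy', ← smul_add, smul_smul,
        inv_mul_cancel₀ hpn0, one_smul]
    rw [e1, e2, ← smul_sub]
    congr 1
    abel
  rw [dist_eq_norm, e, norm_smul, norm_inv, norm_pow]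
  have h5 : ‖(D.limLog (a * b) - D.φ (a * b)) +
        ((D.φ (a * b) - D.φ a - D.φ b) + (-(D.limLog a - D.φ a) + -(D.limLog b - D.φ b)))‖ ≤
        ε / 2 * ‖(p : ℚ_[p])‖ ^ n := by
    rw [← norm_neg] at h3 h4
    refine (IsUltrametricDist.norm_add_le_max _ _).trans (max_le h2 ?_)
    refine (IsUltrametricDist.norm_add_le_max _ _).trans (max_le h1' ?_)
    exact (IsUltrametricDist.norm_add_le_max _ _).trans (max_le h3 h4)
  calc _ ≤ (‖(p : ℚ_[p])‖ ^ n)⁻¹ * (ε / 2 * ‖(p : ℚ_[p])‖ ^ n) := by gcongr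
    _ = ε / 2 := by field_simp
    _ < ε := half_lt_self hε

end Root

end AdaptedChart

end PadicLie

namespace PadicLie

universe u v w

variable {p : ℕ} [Fact p.Prime] {k : ℕ∞} {G : Type v} [Group G] [TopologicalSpace G]

/-! ### Germs and exponential maps. -/

section Theta

variable {E : Type u} [NormedAddCommGroup E] [NormedSpace ℚ_[p] E]
    [ChartedSpace E G] {Ω Ω' : Set E} {ψ ψ' : E → G}

/-- The bijection `θ` does not depend on the exponential map. -/
theorem IsExpMap.thetaEquiv_eq [T2Space G] (h : IsExpMap p Ω ψ) (h' : IsExpMap p Ω' ψ') :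
    h.thetaEquiv = h'.thetaEquiv := by
  ext1 x
  obtain ⟨y, hy⟩ := h'.theta_surjective (h.theta x)
  have h1 : (fun t : ℚ_[p] => ψ' (t • y)) =ᶠ[𝓝 0] (fun t : ℚ_[p] => ψ (t • x)) :=
    Germ.coe_eq.1 (congrArg Subtype.val hy)
  have h2 := (h.hasDerivAt_all x).congr_of_eventuallyEq (h1.fun_comp (chartAt E (1 : G)))
  have h3 : y = x := (h'.hasDerivAt_all y).unique h2
  rw [h3] at hy
  exact hy.symm

theorem IsExpMap.add_eq [T2Space G] (h : IsExpMap p Ω ψ) (h' : IsExpMap p Ω' ψ')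
    (a b : Gam p G) : h.add a b = h'.add a b := by
  rw [IsExpMap.add, IsExpMap.add, h.thetaEquiv_eq h']

/-- `θ` intertwines the scalar multiplication of `L(G)` with reparametrization of germs. -/
theorem IsExpMap.theta_smul_eq {E' : Type w} [NormedAddCommGroup E'] [NormedSpace ℚ_[p] E']
    [ChartedSpace E' G] {Ω' : Set E'} {ψ' : E' → G} (h : IsExpMap p Ω ψ)
    (h' : IsExpMap p Ω' ψ') {x : E} {x' : E'} (e : h.theta x = h'.theta x') (z : ℚ_[p]) :
    h.theta (z • x) = h'.theta (z • x') := by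
  have h1 : (fun t : ℚ_[p] => ψ (t • x)) =ᶠ[𝓝 0] (fun t : ℚ_[p] => ψ' (t • x')) :=
    Germ.coe_eq.1 (congrArg Subtype.val e)
  refine Subtype.ext (Germ.coe_eq.2 ?_)
  have h2 : Tendsto (fun t : ℚ_[p] => t * z) (𝓝 0) (𝓝 0) := by
    have : Continuous fun t : ℚ_[p] => t * z := by fun_prop
    simpa using this.tendsto 0
  filter_upwards [h2.eventually h1] with t ht
  simpa only [smul_smul] using ht

theorem Gam.exists_germ_eq (a : Gam p G) :
    ∃ (W : AddSubgroup ℚ_[p]) (ξ : ℚ_[p] → G) (h : IsPadicHom p W ξ), h.germ = a := by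
  obtain ⟨γ, W, ξ, h, e⟩ := a
  exact ⟨W, ξ, h, Subtype.ext e⟩

theorem IsExpMap.eventuallyEq_of_theta_eq (h : IsExpMap p Ω ψ) {W : AddSubgroup ℚ_[p]}
    {ξ : ℚ_[p] → G} (hξ : IsPadicHom p W ξ) {x : E} (e : h.theta x = hξ.germ) :
    ∀ᶠ t in 𝓝 (0 : ℚ_[p]), t ∈ W ∧ ξ t = ψ (t • x) := by
  have h1 : (fun t : ℚ_[p] => ψ (t • x)) =ᶠ[𝓝 0] ξ :=
    Germ.coe_eq.1 (congrArg Subtype.val e)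
  filter_upwards [h1, hξ.isOpen.mem_nhds W.zero_mem] with t ht htW
  exact ⟨htW, ht.symm⟩

end Theta

namespace AdaptedChart

/-! ### Sums of germs. -/

section Sum

variable {E : Type u} [NormedAddCommGroup E] [NormedSpace ℚ_[p] E]
    [ChartedSpace E G] {D : AdaptedChart p k E G} [IsUltrametricDist E] [CompleteSpace E]
    [IsTopologicalGroup G] [T2Space G]

/-- The sum of germs of one-parameter subgroups as a limit of roots of products. -/
theorem StrictMul.exists_tendsto_root (hD : D.StrictMul) (hk : 1 ≤ k)
    (hG : IsSC1LieGroup ℚ_[p] E G) {Ω : Set E} {ψ : E → G} (h : IsExpMap p Ω ψ)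
    {W₁ W₂ W₃ : AddSubgroup ℚ_[p]} {ξ₁ ξ₂ ξ₃ : ℚ_[p] → G}
    (h₁ : IsPadicHom p W₁ ξ₁) (h₂ : IsPadicHom p W₂ ξ₂) (h₃ : IsPadicHom p W₃ ξ₃)
    (hadd : h.add h₁.germ h₂.germ = h₃.germ) :
    ∃ δ : ℝ, 0 < δ ∧ ∀ t : ℚ_[p], ‖t‖ ≤ δ →
      (t ∈ W₁ ∧ t ∈ W₂ ∧ t ∈ W₃) ∧
      (ξ₁ t ∈ D.U ∧ ξ₂ t ∈ D.U ∧ ξ₃ t ∈ D.U) ∧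
      (∀ n : ℕ, ∃! g : G, g ∈ D.U ∧
        g ^ (p ^ n) = ξ₁ ((p : ℚ_[p]) ^ n * t) * ξ₂ ((p : ℚ_[p]) ^ n * t)) ∧
      Tendsto (fun n : ℕ => D.root n
          (ξ₁ ((p : ℚ_[p]) ^ n * t) * ξ₂ ((p : ℚ_[p]) ^ n * t)))
        atTop (𝓝 (ξ₃ t)) := by
  have hE := hD.isExpMap hk hG
  rw [h.add_eq hE] at hadd
  set v₁ := hE.thetaEquiv.symm h₁.germ with hv₁
  set v₂ := hE.thetaEquiv.symm h₂.germ with hv₂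
  have e₁ : hE.theta v₁ = h₁.germ := hE.thetaEquiv.apply_symm_apply _
  have e₂ : hE.theta v₂ = h₂.germ := hE.thetaEquiv.apply_symm_apply _
  have e₃ : hE.theta (v₁ + v₂) = h₃.germ := hadd
  have hball : ∀ v : E, ∀ᶠ t in 𝓝 (0 : ℚ_[p]), t • v ∈ ball (0 : E) D.r := fun v => by
    have h1 : Tendsto (fun t : ℚ_[p] => t • v) (𝓝 0) (𝓝 0) := by
      have : Continuous fun t : ℚ_[p] => t • v := by fun_prop
      simpa using this.tendsto 0
    exact h1.eventually (ball_mem_nhds 0 D.r_pos)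
  have hev := (((hE.eventuallyEq_of_theta_eq h₁ e₁).and (hE.eventuallyEq_of_theta_eq h₂ e₂)).and
    (hE.eventuallyEq_of_theta_eq h₃ e₃)).and ((hball v₁).and ((hball v₂).and (hball (v₁ + v₂))))
  obtain ⟨δ, hδ, H⟩ := Metric.nhds_basis_closedBall.eventually_iff.1 hev
  refine ⟨δ, hδ, fun t ht => ?_⟩
  -- Multiplication by `pⁿ` preserves the ball of radius `δ`, so a single `δ` serves all `n`.
  have hpt : ∀ n : ℕ, ‖(p : ℚ_[p]) ^ n * t‖ ≤ δ := fun n => by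
    rw [norm_mul, norm_pow]
    refine (mul_le_of_le_one_left (norm_nonneg _) ?_).trans ht
    exact pow_le_one₀ (norm_nonneg _) (IsUltrametricDist.norm_natCast_le_one ℚ_[p] p)
  have H' : ∀ t : ℚ_[p], ‖t‖ ≤ δ → _ := fun t ht => H (mem_closedBall_zero_iff.2 ht)
  obtain ⟨⟨⟨⟨w₁, x₁⟩, ⟨w₂, x₂⟩⟩, ⟨w₃, x₃⟩⟩, b₁, b₂, b₃⟩ := H' t ht
  have hprod : ∀ n : ℕ, ξ₁ ((p : ℚ_[p]) ^ n * t) * ξ₂ ((p : ℚ_[p]) ^ n * t) =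
      D.exp ((p : ℚ_[p]) ^ n • t • v₁) * D.exp ((p : ℚ_[p]) ^ n • t • v₂) := fun n => by
    obtain ⟨⟨⟨⟨-, y₁⟩, ⟨-, y₂⟩⟩, -⟩, -⟩ := H' _ (hpt n)
    rw [y₁, y₂, mul_smul, mul_smul]
  refine ⟨⟨w₁, w₂, w₃⟩, ⟨?_, ?_, ?_⟩, fun n => ?_, ?_⟩
  · rw [x₁]; exact hD.exp_mem b₁
  · rw [x₂]; exact hD.exp_mem b₂
  · rw [x₃]; exact hD.exp_mem b₃
  · rw [hprod]
    exact hD.existsUnique_root b₁ b₂ n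
  · simp only [hprod]
    rw [smul_add] at b₃ x₃
    have h1 := (hD.continuousAt_exp b₃).tendsto.comp (hD.tendsto_log_root b₁ b₂)
    rw [x₃]
    refine h1.congr fun n => ?_
    have h2 := hD.root_exp_mem b₁ b₂ n
    simp only [Function.comp]
    rw [hD.log_eq h2, hD.exp_limLog h2]

/-- The isometry property turns the linearization estimate for `limLog` into the same estimate for
its inverse, so no inverse function theorem is needed. -/
theorem StrictMul.hasStrictFDerivAt_exp (hD : D.StrictMul) :
    HasStrictFDerivAt (fun v => D.φ (D.exp v)) (ContinuousLinearMap.id ℚ_[p] E) 0 := by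
  rw [hasStrictFDerivAt_iff_isLittleO, Asymptotics.isLittleO_iff]
  intro ε hε
  obtain ⟨s, hs, H⟩ := hD.exists_norm_limLog_sub_sub_le hε
  have hr := D.r_pos
  filter_upwards [ball_mem_nhds ((0 : E), (0 : E)) (lt_min hs hr)] with q hq
  obtain ⟨x, y⟩ := q
  rw [← ball_prod_same, mem_prod, mem_ball_zero_iff, mem_ball_zero_iff] at hq
  obtain ⟨hx, hy⟩ := hq
  simp only [lt_min_iff] at hx hy
  have hxb : x ∈ ball (0 : E) D.r := mem_ball_zero_iff.2 hx.2
  have hyb : y ∈ ball (0 : E) D.r := mem_ball_zero_iff.2 hy.2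
  have h1 := H _ (hD.exp_mem hxb) _ (hD.exp_mem hyb)
  rw [hD.limLog_exp hxb, hD.limLog_exp hyb, hD.norm_exp hxb, hD.norm_exp hyb,
    hD.norm_exp_sub hxb hyb, norm_sub_rev] at h1
  exact h1 hx.1 hy.1

theorem StrictMul.exp_zero (hD : D.StrictMul) : D.exp 0 = 1 := by
  have := hD.exp_limLog D.U.one_mem
  rwa [limLog_one] at this

theorem StrictMul.tendsto_exp (hD : D.StrictMul) : Tendsto D.exp (𝓝 0) (𝓝 1) := by
  have := (hD.continuousAt_exp (mem_ball_self D.r_pos)).tendsto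
  rwa [hD.exp_zero] at this

end Sum

/-! ### Two Lie group structures on one topological group. -/

section Comparison

variable {E : Type u} [NormedAddCommGroup E] [NormedSpace ℚ_[p] E] [IsUltrametricDist E]
    [CompleteSpace E] [ChartedSpace E G] [IsTopologicalGroup G] [T2Space G]
    {E' : Type w} [NormedAddCommGroup E'] [NormedSpace ℚ_[p] E'] [IsUltrametricDist E']
    [CompleteSpace E'] [ChartedSpace E' G]
    {D : AdaptedChart p k E G} {D' : AdaptedChart p k E' G}
    {Ω : Set E} {ψ : E → G} {Ω' : Set E'} {ψ' : E' → G}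

/-- Both sums are limits of roots of the same products. As `D'.U ≤ D.U`, a root taken in `D'.U` is
also one in `D.U`, where roots are unique; so the two sequences coincide. -/
theorem StrictMul.add_eq_of_subset (hk : 1 ≤ k) (hD : D.StrictMul)
    (hG : IsSC1LieGroup ℚ_[p] E G) (hD' : D'.StrictMul)
    (hG' : IsSC1LieGroup ℚ_[p] E' G) (hUU : D'.U ≤ D.U) (h : IsExpMap p Ω ψ)
    (h' : IsExpMap p Ω' ψ') (a b : Gam p G) : h.add a b = h'.add a b := by
  obtain ⟨W₁, ξ₁, h₁, rfl⟩ := Gam.exists_germ_eq a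
  obtain ⟨W₂, ξ₂, h₂, rfl⟩ := Gam.exists_germ_eq b
  obtain ⟨W₃, ξ₃, h₃, e₃⟩ := Gam.exists_germ_eq (h.add h₁.germ h₂.germ)
  obtain ⟨W₄, ξ₄, h₄, e₄⟩ := Gam.exists_germ_eq (h'.add h₁.germ h₂.germ)
  obtain ⟨δ, hδ, H⟩ := hD.exists_tendsto_root hk hG h h₁ h₂ h₃ e₃.symm
  obtain ⟨δ', hδ', H'⟩ := hD'.exists_tendsto_root hk hG' h' h₁ h₂ h₄ e₄.symm
  rw [← e₃, ← e₄]
  refine Subtype.ext (Germ.coe_eq.2 ?_)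
  filter_upwards [closedBall_mem_nhds (0 : ℚ_[p]) hδ, closedBall_mem_nhds (0 : ℚ_[p]) hδ']
    with t ht ht'
  obtain ⟨-, -, hr, hl⟩ := H t (mem_closedBall_zero_iff.1 ht)
  obtain ⟨-, -, hr', hl'⟩ := H' t (mem_closedBall_zero_iff.1 ht')
  refine tendsto_nhds_unique hl (hl'.congr fun n => ?_)
  have hx : ∃ y ∈ (D.U : Set G), y ^ p ^ n = _ := (hr n).exists
  have hx' : ∃ y ∈ (D'.U : Set G), y ^ p ^ n = _ := (hr' n).exists
  refine (hr n).unique ⟨hUU ?_, ?_⟩ ⟨?_, ?_⟩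
  · exact Function.invFunOn_mem hx'
  · exact Function.invFunOn_eq hx'
  · exact Function.invFunOn_mem hx
  · exact Function.invFunOn_eq hx

/-- The comparison of the Lie algebras of two Lie group structures on a topological group. -/
theorem StrictMul.exists_comparison (hk : 1 ≤ k) (hD : D.StrictMul)
    (hG : IsSC1LieGroup ℚ_[p] E G) (hD' : D'.StrictMul) (hG' : IsSC1LieGroup ℚ_[p] E' G)
    (hadd : ∀ a b : Gam p G, (hD.isExpMap hk hG).add a b = (hD'.isExpMap hk hG').add a b) :
    ∃ T : E →L[ℚ_[p]] E',
      (∀ x, (hD.isExpMap hk hG).theta x = (hD'.isExpMap hk hG').theta (T x)) ∧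
      ∀ᶠ x in 𝓝 (0 : E), T x = D'.limLog (D.exp x) := by
  set h := hD.isExpMap hk hG with hh
  set h' := hD'.isExpMap hk hG' with hh'
  set T : E → E' := fun x => h'.thetaEquiv.symm (h.theta x) with hT
  have hTθ : ∀ x, h'.theta (T x) = h.theta x := fun x => h'.thetaEquiv.apply_symm_apply _
  have hTadd : ∀ x y, T (x + y) = T x + T y := fun x y => by
    have h1 := hadd (h.theta x) (h.theta y)
    have h2 : h.add (h.theta x) (h.theta y) = h.theta (x + y) := by
      rw [IsExpMap.add]
      have : ∀ x, h.thetaEquiv.symm (h.theta x) = x := fun x => h.thetaEquiv.symm_apply_apply x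
      rw [this, this]
      rfl
    rw [h2, IsExpMap.add] at h1
    exact (Equiv.symm_apply_eq _).2 h1
  have hTsmul : ∀ (z : ℚ_[p]) (x), T (z • x) = z • T x := fun z x =>
    (Equiv.symm_apply_eq _).2 (h.theta_smul_eq h' (hTθ x).symm z)
  -- For small `x` the whole one-parameter subgroup `z ↦ exp (z x)` on `ℤ_p` lies in `D'.U`, so the
  -- second structure recognizes it as its own, with generator `limLog (exp x)`.
  have hTlog : ∀ᶠ x in 𝓝 (0 : E), T x = D'.limLog (D.exp x) := by
    have h1 := (hD.tendsto_exp.eventually (D'.U_mem_nhds D'.U.one_mem)).and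
      (ball_mem_nhds (0 : E) D.r_pos)
    obtain ⟨ρ, hρ, H⟩ := Metric.nhds_basis_ball.eventually_iff.1 h1
    filter_upwards [ball_mem_nhds (0 : E) hρ] with x hx
    obtain ⟨ξ, hξ, -, -, hexp⟩ := hD.exists_hom_exp (H hx).2
    have hU' : ∀ z, ‖z‖ ≤ 1 → ξ z ∈ D'.U := fun z hz => by
      rw [← hexp z hz]
      refine (H ?_).1
      rw [mem_ball_zero_iff] at hx ⊢
      rw [norm_smul]
      exact (mul_le_of_le_one_left (norm_nonneg _) hz).trans_lt hx
    have h2 : D.exp x = ξ 1 := by simpa using hexp 1 (by simp)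
    refine (Equiv.symm_apply_eq _).2 (Subtype.ext (Germ.coe_eq.2 ?_))
    filter_upwards [closedBall_mem_nhds (0 : ℚ_[p]) one_pos] with z hz
    have hz1 := mem_closedBall_zero_iff.1 hz
    rw [hexp z hz1, h2]
    exact (hD'.exp_smul hξ hU' hz1).symm
  let L : E →ₗ[ℚ_[p]] E' := { toFun := T, map_add' := hTadd, map_smul' := hTsmul }
  have hcont : Continuous L := by
    refine continuous_of_continuousAt_zero L ?_
    have h1 : Tendsto (fun x => D'.limLog (D.exp x)) (𝓝 0) (𝓝 0) :=
      hD'.tendsto_limLog.comp hD.tendsto_exp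
    have h2 : L 0 = 0 := map_zero L
    rw [ContinuousAt, h2]
    exact h1.congr' (hTlog.mono fun x hx => hx.symm)
  exact ⟨⟨L, hcont⟩, fun x => (hTθ x).symm, hTlog⟩

/-- The change between adapted charts for two Lie group structures is strictly differentiable. -/
theorem StrictMul.hasStrictFDerivAt_change (hD : D.StrictMul) (hD' : D'.StrictMul)
    {T : E →L[ℚ_[p]] E'} (hT : ∀ᶠ x in 𝓝 (0 : E), T x = D'.limLog (D.exp x)) :
    HasStrictFDerivAt (fun x => D'.φ (D.φ.symm x)) T 0 := by
  have hs0 := symm_zero_eq_one D.one_mem_source D.map_one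
  have hts := tendsto_symm_zero D.one_mem_source D.map_one
  have h1 := hD.hasStrictFDerivAt_limLog
  have hl0 : D.limLog (D.φ.symm 0) = 0 := by rw [hs0, limLog_one]
  have h2 : HasStrictFDerivAt T T (D.limLog (D.φ.symm 0)) := T.hasStrictFDerivAt
  have h3 := HasStrictFDerivAt.comp (f := fun x => D.limLog (D.φ.symm x)) 0 h2 h1
  have h4 : HasStrictFDerivAt (fun v => D'.φ (D'.exp v)) (ContinuousLinearMap.id ℚ_[p] E')
      (T (D.limLog (D.φ.symm 0))) := by
    rw [hl0, T.map_zero]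
    exact hD'.hasStrictFDerivAt_exp
  have h5 := HasStrictFDerivAt.comp (f := fun x => T (D.limLog (D.φ.symm x))) 0 h4 h3
  rw [ContinuousLinearMap.id_comp, ContinuousLinearMap.comp_id] at h5
  refine h5.congr_of_eventuallyEq ?_
  filter_upwards [hts.eventually (D.U_mem_nhds D.U.one_mem),
    hts.eventually (D'.U_mem_nhds D'.U.one_mem),
    (hD.tendsto_limLog.comp hts).eventually hT] with x hxU hxU' hx
  simp only [Function.comp] at hx
  rw [hx, hD.exp_limLog hxU, hD'.exp_limLog hxU']

/-- Around `g`, write `z = g (g⁻¹ z)`: a left translation of the first structure leads to the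
identity, the change of adapted charts is strictly differentiable there, and a left translation of
the second structure leads back. -/
theorem StrictMul.sc1Map_id (hk : 1 ≤ k) (hD : D.StrictMul)
    (hG : IsSC1LieGroup ℚ_[p] E G) (hD' : D'.StrictMul) (hG' : IsSC1LieGroup ℚ_[p] E' G)
    {T : E →L[ℚ_[p]] E'} (hT : ∀ᶠ x in 𝓝 (0 : E), T x = D'.limLog (D.exp x)) :
    SC1Map ℚ_[p] E E' (fun x : G => x) := by
  refine ⟨continuous_id, fun e he e' he' y hy => ?_⟩
  obtain ⟨hy, hye⟩ := hy
  set c := chartAt E (1 : G) with hc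
  set c' := chartAt E' (1 : G) with hc'
  have hc1 : (1 : G) ∈ c.source := mem_chart_source E 1
  have hc1' : (1 : G) ∈ c'.source := mem_chart_source E' 1
  set g := e.symm y with hg
  obtain ⟨A, hA⟩ := hG.exists_hasStrictFDerivAt_mul_left he (chart_mem_atlas E 1) g⁻¹ hy
    (by rwa [← hg, inv_mul_cancel])
  obtain ⟨B, hB⟩ := hG'.exists_hasStrictFDerivAt_mul_left (chart_mem_atlas E' 1) he' g
    (c'.map_source hc1') (by rwa [← hc', c'.left_inv hc1', mul_one])
  have h1 := D.hasStrictFDerivAt_chart hk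
  have h2 : HasStrictFDerivAt (fun x => D'.φ (D.φ.symm x)) T (D.φ (c.symm (c 1))) := by
    rw [c.left_inv hc1, D.map_one]
    exact hD.hasStrictFDerivAt_change hD' hT
  have h3 := HasStrictFDerivAt.comp (f := fun y => D.φ (c.symm y)) (c 1) h2 h1
  have h4 : HasStrictFDerivAt (fun y => c' (D'.φ.symm y)) (ContinuousLinearMap.id ℚ_[p] E')
      (D'.φ (D.φ.symm (D.φ (c.symm (c 1))))) := by
    rw [c.left_inv hc1, D.left_inv D.U.one_mem, D'.map_one]
    exact D'.hasStrictFDerivAt_chart_symm hk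
  have h5 := HasStrictFDerivAt.comp (f := fun y => D'.φ (D.φ.symm (D.φ (c.symm y)))) (c 1) h4 h3
  have e1 : c (g⁻¹ * e.symm y) = c 1 := by rw [← hg, inv_mul_cancel]
  rw [← e1] at h5
  have h6 := HasStrictFDerivAt.comp (f := fun y => c (g⁻¹ * e.symm y)) y h5 hA
  have h7 : HasStrictFDerivAt (fun y => e' (g * c'.symm y)) B
      (c' (D'.φ.symm (D'.φ (D.φ.symm (D.φ (c.symm (c (g⁻¹ * e.symm y)))))))) := by
    rw [e1, c.left_inv hc1, D.left_inv D.U.one_mem, D'.left_inv D'.U.one_mem]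
    exact hB
  have h8 := HasStrictFDerivAt.comp
    (f := fun y => c' (D'.φ.symm (D'.φ (D.φ.symm (D.φ (c.symm (c (g⁻¹ * e.symm y)))))))) y h7 h6
  refine ⟨_, h8.congr_of_eventuallyEq ?_⟩
  have hlim : Tendsto (fun y => g⁻¹ * e.symm y) (𝓝 y) (𝓝 1) := by
    have := (e.continuousAt_symm hy).tendsto.const_mul g⁻¹
    rwa [← hg, inv_mul_cancel] at this
  filter_upwards [hlim.eventually (c.open_source.mem_nhds hc1),
    hlim.eventually (c'.open_source.mem_nhds hc1'), hlim.eventually (D.U_mem_nhds D.U.one_mem),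
    hlim.eventually (D'.U_mem_nhds D'.U.one_mem)] with z hz1 hz2 hz3 hz4
  rw [c.left_inv hz1, D.left_inv hz3, D'.left_inv hz4, c'.left_inv hz2, mul_inv_cancel_left]

end Comparison

end AdaptedChart

theorem IsExpMap.topology_le {E : Type u} [NormedAddCommGroup E] [NormedSpace ℚ_[p] E]
    [ChartedSpace E G] [T2Space G] {E' : Type w} [NormedAddCommGroup E'] [NormedSpace ℚ_[p] E']
    [ChartedSpace E' G] {Ω : Set E} {ψ : E → G} {Ω' : Set E'} {ψ' : E' → G}
    (h : IsExpMap p Ω ψ) (h' : IsExpMap p Ω' ψ') {T : E → E'} (hT : Continuous T)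
    (e : ∀ x, h.thetaEquiv x = h'.thetaEquiv (T x)) : h.topology ≤ h'.topology := by
  have e1 : (h.thetaEquiv : E → Gam p G) = h'.thetaEquiv ∘ T := funext e
  rw [IsExpMap.topology, IsExpMap.topology, e1, ← coinduced_compose]
  exact coinduced_mono hT.coinduced_le

end PadicLie

open PadicLie
theorem lemma5p4 {p : ℕ} [Fact p.Prime] {k : ℕ∞} (hk : 1 ≤ k)
    {E : Type*} [NormedAddCommGroup E] [NormedSpace ℚ_[p] E] [CompleteSpace E]
    [IsUltrametricDist E]
    {G : Type*} [Group G] [TopologicalSpace G] [IsTopologicalGroup G] [T2Space G]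
    [ChartedSpace E G] (hG : IsCkLieGroup ℚ_[p] (kPlus p k E) E G) :
    -- adapted charts exist
    Nonempty (AdaptedChart p k E G) ∧
    -- for every adapted chart, `log_G`, `exp_G` are well defined, and (a), (b) hold
    (∀ D : AdaptedChart p k E G,
      (∀ x ∈ D.U, D.IsLog x (D.log x)) ∧
      BijOn D.log (D.U : Set G) (ball (0 : E) D.r) ∧
      IsExpMap p (ball (0 : E) D.r) D.exp ∧
      (∀ x ∈ ball (0 : E) D.r, ∀ y ∈ ball (0 : E) D.r,
        (∀ n : ℕ, ∃! g : G, g ∈ D.U ∧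
          g ^ (p ^ n) = D.exp ((p : ℚ_[p]) ^ n • x) * D.exp ((p : ℚ_[p]) ^ n • y)) ∧
        Tendsto (fun n : ℕ => D.log (D.root n
            (D.exp ((p : ℚ_[p]) ^ n • x) * D.exp ((p : ℚ_[p]) ^ n • y))))
          atTop (𝓝 (x + y))) ∧
      (∀ (Ω : Set E) (ψ : E → G) (h : IsExpMap p Ω ψ)
        (W₁ W₂ W₃ : AddSubgroup ℚ_[p]) (ξ₁ ξ₂ ξ₃ : ℚ_[p] → G)
        (h₁ : IsPadicHom p W₁ ξ₁) (h₂ : IsPadicHom p W₂ ξ₂) (h₃ : IsPadicHom p W₃ ξ₃),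
        h.add h₁.germ h₂.germ = h₃.germ →
        ∃ δ : ℝ, 0 < δ ∧ ∀ t : ℚ_[p], ‖t‖ ≤ 1 → ‖t‖ ≤ δ →
          (t ∈ W₁ ∧ t ∈ W₂ ∧ t ∈ W₃) ∧
          (ξ₁ t ∈ D.U ∧ ξ₂ t ∈ D.U ∧ ξ₃ t ∈ D.U) ∧
          (∀ n : ℕ, ∃! g : G, g ∈ D.U ∧
            g ^ (p ^ n) = ξ₁ ((p : ℚ_[p]) ^ n * t) * ξ₂ ((p : ℚ_[p]) ^ n * t)) ∧
          Tendsto (fun n : ℕ => D.root n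
              (ξ₁ ((p : ℚ_[p]) ^ n * t) * ξ₂ ((p : ℚ_[p]) ^ n * t)))
            atTop (𝓝 (ξ₃ t)))) ∧
    -- (c), for a second Lie group structure on the same topological group
    (∀ (E' : Type*) [NormedAddCommGroup E'] [NormedSpace ℚ_[p] E'] [CompleteSpace E']
      [IsUltrametricDist E'] [ChartedSpace E' G],
      IsCkLieGroup ℚ_[p] (kPlus p k E') E' G →
      (∀ (Ω : Set E) (ψ : E → G) (h : IsExpMap p Ω ψ)
        (Ω' : Set E') (ψ' : E' → G) (h' : IsExpMap p Ω' ψ'),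
        (∀ a b : Gam p G, h.add a b = h'.add a b) ∧
        (∀ (z : ℚ_[p]) (a : Gam p G), h.smul z a = h'.smul z a) ∧
        h.topology = h'.topology) ∧
      IsSC1LieGroup ℚ_[p] E G ∧ IsSC1LieGroup ℚ_[p] E' G ∧
      SC1Map ℚ_[p] E E' (fun x : G => x) ∧ SC1Map ℚ_[p] E' E (fun x : G => x)) := by
  have hS := hG.isSC1LieGroup hk
  have hM : ∀ D : AdaptedChart p k E G, D.StrictMul := fun D _ hε =>
    D.exists_mulEstimate hk hS hε
  refine ⟨(exists_adaptedChart hk hG univ_mem).nonempty, fun D => ?_, ?_⟩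
  · have hD := hM D
    refine ⟨fun x hx => ?_, hD.bijOn_log, hD.isExpMap hk hS,
      fun x hx y hy => ⟨hD.existsUnique_root hx hy, hD.tendsto_log_root hx hy⟩, ?_⟩
    · rw [hD.log_eq hx]
      exact hD.isLog_limLog hx
    · intro Ω ψ h W₁ W₂ W₃ ξ₁ ξ₂ ξ₃ h₁ h₂ h₃ hadd
      obtain ⟨δ, hδ, H⟩ := hD.exists_tendsto_root hk hS h h₁ h₂ h₃ hadd
      exact ⟨δ, hδ, fun t _ ht => H t ht⟩
  · intro E' _ _ _ _ _ hG'
    have hS' := hG'.isSC1LieGroup hk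
    obtain ⟨D, -⟩ := exists_adaptedChart hk hG univ_mem
    -- The second subgroup is chosen inside the first, as the comparison of roots requires.
    obtain ⟨D', hUU⟩ := exists_adaptedChart hk hG' (D.U_mem_nhds D.U.one_mem)
    have hD := hM D
    have hD' : D'.StrictMul := fun _ hε => D'.exists_mulEstimate hk hS' hε
    have hadd := fun {Ω : Set E} {ψ : E → G} (h : IsExpMap p Ω ψ) {Ω' : Set E'} {ψ' : E' → G}
      (h' : IsExpMap p Ω' ψ') => hD.add_eq_of_subset hk hS hD' hS' hUU h h'
    obtain ⟨T, hTθ, hT⟩ := hD.exists_comparison hk hS hD' hS' (hadd _ _)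
    obtain ⟨T', hTθ', hT'⟩ := hD'.exists_comparison hk hS' hD hS fun a b => (hadd _ _ a b).symm
    refine ⟨fun Ω ψ h Ω' ψ' h' => ⟨hadd h h', fun z a => ?_, ?_⟩, hS, hS',
      hD.sc1Map_id hk hS hD' hS' hT, hD'.sc1Map_id hk hS' hD hS hT'⟩
    · refine h.theta_smul_eq h' ?_ z
      exact (h.thetaEquiv.apply_symm_apply a).trans (h'.thetaEquiv.apply_symm_apply a).symm
    · refine le_antisymm (h.topology_le h' T.continuous fun x => ?_)
        (h'.topology_le h T'.continuous fun x => ?_)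
      -- As `θ` is independent of the exponential map, the given maps may be replaced by those of
      -- `D` and `D'`, for which `T` was built.
      · rw [h.thetaEquiv_eq (hD.isExpMap hk hS), h'.thetaEquiv_eq (hD'.isExpMap hk hS')]
        exact hTθ x
      · rw [h.thetaEquiv_eq (hD.isExpMap hk hS), h'.thetaEquiv_eq (hD'.isExpMap hk hS')]
        exact hTθ' x
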